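/- Let $m\ge 0$, $q_0=3^m$, $q=3q_0^2=3^{2m+1}$, and let $F_R=\mathbb F_q(x,y_1,y_2)$ be the Ree function field, i.e. the ring of fractions of $\mathbb F_q[x,y_1,y_2]$ modulo the relations $$y_1^q-y_1=x^{q_0}(x^q-x),\qquad y_2^q-y_2=x^{q_0}(y_1^q-y_1).$$ Let ${}^2G_2(q)=\operatorname{Aut}(F_R/\mathbb F_q)$ be the Ree group. Put $$w_1=x^{3q_0+1}-y_1^{3q_0},\quad w_2=xy_1^{3q_0}-y_2^{3q_0},\quad w_3=xy_2^{3q_0}-w_1^{3q_0},\quad w_4=xw_2^{q_0}-y_1w_1^{q_0},$$ $$v=xw_3^{q_0}-y_2w_1^{q_0},\quad w_5=y_1w_3^{q_0}-y_2w_2^{q_0},\quad w_6=v^{3q_0}-w_2^{3q_0}+xw_4^{3q_0},\quad w_7=w_2+v,$$ $$w_8=w_5^{3q_0}+xw_7^{3q_0},\quad w_9=w_4w_2^{q_0}-y_1w_6^{q_0},\quad w_{10}=y_2w_6^{q_0}-w_3^{q_0}w_4,$$ write $(d_0,\dots,d_{13})=(1,x,y_1,y_2,w_1,\dots,w_{10})$,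 and let $\mathcal D'=\langle d_0,\dots,d_{13}\rangle_{\mathbb F_q}\subseteq F_R$. Let $\mathcal R\subset\mathbb P^{13}(\overline{\mathbb F_q})$ be the model of the Ree curve, which consists of the points $[1:x:y_1:y_2:w_1:\cdots:w_{10}]$, where $(x,y_1,y_2)\in\overline{\mathbb F_q}^3$ satisfies the two relations above and the $w_i$ are given by the formulas above, together with the point $P'_\infty=[0:\cdots:0:1:0:0]$ whose only nonzero coordinate is that of $w_8$. Then $F_R$ is a field, and the whole Ree group acts on $\mathcal D'$ and on $\mathcal R$, in the following sense. There are group homomorphisms $\rho:{}^2G_2(q)\to GL_{\mathbb F_q}(\mathcal D')$ and $\Theta:{}^2G_2(q)\to GL_{14}(\mathbb F_q)$ such that 1. for every $\sigma\in{}^2G_2(q)$ there is $u_\sigma\in F_R^\times$ with $\rho(\sigma)f=u_\sigma\,\sigma(f)$ for all $f\in\mathcal D'$; 2. $\rho(\sigma^{-1})d_i=\sum_j\Theta(\sigma)_{ij}\,d_j$ for all $\sigma$ and $i$; 3. for every $\sigma$ the projective linear transformation of $\mathbb P^{13}(\overline{\mathbb F_q})$ given by $\Theta(\sigma)$ maps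 $\mathcal R$ onto itself. Moreover, ${}^2G_2(q)$ contains an involution $\phi$ which, up to the factor $w_8$, swaps $1\leftrightarrow w_8$, $x\leftrightarrow w_6$, $w_1\leftrightarrow w_3$, $y_1\leftrightarrow w_{10}$, $y_2\leftrightarrow w_9$, $w_4\leftrightarrow w_5$ and negates $w_2$ and $w_7$; that is, $w_8\,\phi(1)=w_8$, $w_8\,\phi(w_8)=1$, $w_8\,\phi(x)=w_6$, $w_8\,\phi(w_6)=x$, and so on, with $w_8\,\phi(w_2)=-w_2$ and $w_8\,\phi(w_7)=-w_7$. -/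

import Mathlib

open scoped LinearAlgebra.Projectivization

namespace Ree

/-- `(x, y₁, y₂)` satisfies the two affine equations of the Ree curve, where `q₀ = 3 ^ m` and
`q = 3 * q₀ ^ 2 = 3 ^ (2 * m + 1)`. -/
def OnCurve (m : ℕ) {A : Type*} [CommRing A] (x y₁ y₂ : A) : Prop :=
  y₁ ^ 3 ^ (2 * m + 1) - y₁ = x ^ 3 ^ m * (x ^ 3 ^ (2 * m + 1) - x) ∧
  y₂ ^ 3 ^ (2 * m + 1) - y₂ = x ^ 3 ^ m * (y₁ ^ 3 ^ (2 * m + 1) - y₁)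

/-- The fourteen functions `1, x, y₁, y₂, w₁, …, w₁₀`, in this order, as polynomial expressions in
`x, y₁, y₂`; here `q₀ = 3 ^ m` and `t = 3 * q₀`. -/
def coords (m : ℕ) {A : Type*} [CommRing A] (x y₁ y₂ : A) : Fin 14 → A :=
  let q₀ := 3 ^ m
  let t := 3 * q₀
  let w₁ := x ^ (t + 1) - y₁ ^ t
  let w₂ := x * y₁ ^ t - y₂ ^ t
  let w₃ := x * y₂ ^ t - w₁ ^ t
  let w₄ := x * w₂ ^ q₀ - y₁ * w₁ ^ q₀
  let v := x * w₃ ^ q₀ - y₂ * w₁ ^ q₀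
  let w₅ := y₁ * w₃ ^ q₀ - y₂ * w₂ ^ q₀
  let w₆ := v ^ t - w₂ ^ t + x * w₄ ^ t
  let w₇ := w₂ + v
  let w₈ := w₅ ^ t + x * w₇ ^ t
  let w₉ := w₄ * w₂ ^ q₀ - y₁ * w₆ ^ q₀
  let w₁₀ := y₂ * w₆ ^ q₀ - w₃ ^ q₀ * w₄
  ![1, x, y₁, y₂, w₁, w₂, w₃, w₄, w₅, w₆, w₇, w₈, w₉, w₁₀]

theorem coords_ne_zero (m : ℕ) {A : Type*} [CommRing A] [Nontrivial A] (x y₁ y₂ : A) :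
    coords m x y₁ y₂ ≠ 0 := fun h =>
  one_ne_zero (α := A) (congrFun h 0)

section FunctionField

variable (K : Type*) [Field K] (m : ℕ)

/-- The ideal of the affine Ree curve in `K[x, y₁, y₂]`. -/
noncomputable def ideal : Ideal (MvPolynomial (Fin 3) K) :=
  Ideal.span
    {MvPolynomial.X 1 ^ 3 ^ (2 * m + 1) - MvPolynomial.X 1 -
        MvPolynomial.X 0 ^ 3 ^ m * (MvPolynomial.X 0 ^ 3 ^ (2 * m + 1) - MvPolynomial.X 0),
      MvPolynomial.X 2 ^ 3 ^ (2 * m + 1) - MvPolynomial.X 2 -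
        MvPolynomial.X 0 ^ 3 ^ m * (MvPolynomial.X 1 ^ 3 ^ (2 * m + 1) - MvPolynomial.X 1)}

/-- The affine coordinate ring of the Ree curve. -/
abbrev CoordRing : Type _ := MvPolynomial (Fin 3) K ⧸ ideal K m

/-- The Ree function field `K(x, y₁, y₂)`: the ring of fractions of the affine coordinate ring. -/
abbrev FunctionField : Type _ := FractionRing (CoordRing K m)

/-- The generators `x = gen 0`, `y₁ = gen 1`, `y₂ = gen 2` of the Ree function field. -/
noncomputable def gen (i : Fin 3) : FunctionField K m :=
  algebraMap (CoordRing K m) (FunctionField K m)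
    (Ideal.Quotient.mk (ideal K m) (MvPolynomial.X i))

/-- The Ree group: the automorphism group of the Ree function field over `K`. -/
abbrev ReeGroup : Type _ := FunctionField K m ≃ₐ[K] FunctionField K m

/-- The functions `1, x, y₁, y₂, w₁, …, w₁₀` in the Ree function field. -/
noncomputable def fn : Fin 14 → FunctionField K m :=
  coords m (gen K m 0) (gen K m 1) (gen K m 2)

/-- The `K`-vector space `D' = ⟨1, x, y₁, y₂, w₁, …, w₁₀⟩`. -/
noncomputable def D' : Submodule K (FunctionField K m) :=
  Submodule.span K (Set.range (fn K m))

/-- The functions `1, x, y₁, y₂, w₁, …, w₁₀` as elements of `D'`. -/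
noncomputable def fnD' (i : Fin 14) : D' K m :=
  ⟨fn K m i, Submodule.subset_span (Set.mem_range_self i)⟩

/-- The model of the Ree curve in the projective space of dimension 13 over the algebraic closure
of `K`: the points `[1 : x : y₁ : y₂ : w₁ : … : w₁₀]` for the points `(x, y₁, y₂)` of the affine
curve, and the point at infinity, whose only nonzero coordinate is the one of `w₈`. -/
def model : Set (ℙ (AlgebraicClosure K) (Fin 14 → AlgebraicClosure K)) :=
  {p | (∃ x y₁ y₂ : AlgebraicClosure K, OnCurve m x y₁ y₂ ∧
      p = Projectivization.mk (AlgebraicClosure K) (coords m x y₁ y₂) (coords_ne_zero m x y₁ y₂)) ∨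
    p = Projectivization.mk (AlgebraicClosure K) (Pi.single 11 1)
      (Pi.single_ne_zero_iff.mpr one_ne_zero)}

end FunctionField

end Ree

/-! On the curve, with X = x^q₀, the powers occurring in the w_i can be eliminated by the five
relations of `Flag`. The fourteen functions then become polynomials in x, y₁, y₂, w₁, w₂ that do not
depend on m (`Flag.coords_eq`). The effect of translations, scalings and the inversion on them
reduces to polynomial identities in characteristic 3.

The geometry is read off valuations. Wherever v x > 1, the relations force all pole orders,
normalised so that x has order q² (`Flag.hasOrder`). The order of w₈ is prime to q², so 1, w₈, …,
w₈^(q²-1) are independent over K[x]. The coordinate ring is spanned over K[x] by q² monomials, so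
these are independent too and the ring is a domain (`evalHom_injective`, `isDomain_coordRing`). At
the origin x is a uniformiser and the residue field is K, so only one valuation ring is centred
there. The inversion takes infinity to the origin, and translations take every other place with
rational x-value to the origin.

Let σ fix the place at infinity. After replacing σ by its inverse if necessary, (σ(x)^q - σ(x)) /
(x^q - x) has no pole, so it is constant, and σ(x) = a x + b follows (`exists_eq_affine`). The
translations and the inversion bring an arbitrary automorphism into this situation, so together with
the scalings they generate the group (`closure_standardGenerators`).

Each generator acts on the vector of the fourteen functions by a matrix, up to a scalar function.
Since these functions are independent and K is algebraically closed in the function field, the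
matrix is unique up to K^×, which gives a projective representation. It lifts to a linear one: the
matrices preserve the span of 1, x, w₁, w₂, w₃, w₆, w₈, a scalar c changes the determinant there by
c^7, and 7 is prime to q - 1. Hence exactly one multiple has determinant 1, and this choice is
multiplicative (`exists_matrixRepresentation`). Invariance of the model is also checked on
generators; for the inversion it needs that w₈ vanishes only at the origin
(`Flag.eq_zero_of_w₈_eq_zero`). -/

namespace Ree

/-! ### Elimination of Frobenius powers. -/

/-- The fourteen coordinate functions as polynomials, independent of `m`, in `x, y₁, y₂, w₁, w₂`. -/
def flagCoords {A : Type*} [CommRing A] (x y₁ y₂ w₁ w₂ : A) : Fin 14 → A :=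
  let w₃ := y₁ ^ 3 - x ^ 2 * w₁ - x * w₂
  let w₄ := y₁ ^ 2 - x * y₂
  let v := y₁ * y₂ - x * w₁
  let w₅ := y₂ ^ 2 - y₁ * w₁
  let w₆ := y₂ ^ 3 - x * w₁ ^ 2 + w₁ * w₂
  let w₇ := w₂ + v
  let w₈ := w₂ ^ 2 - w₁ * w₃ - x * w₆
  let w₉ := y₁ * w₂ - y₂ * w₄ - y₁ * v
  let w₁₀ := y₂ * v - y₂ * w₂ + w₁ * w₄
  ![1, x, y₁, y₂, w₁, w₂, w₃, w₄, w₅, w₆, w₇, w₈, w₉, w₁₀]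

/-- The Frobenius relations between `x, y₁, y₂, w₁, w₂` and `X = x ^ q₀` on the Ree curve. -/
structure Flag (m : ℕ) {A : Type*} [CommRing A] (X x y₁ y₂ w₁ w₂ : A) : Prop where
  pow_x : x ^ 3 ^ m = X
  pow_w₁ : w₁ ^ 3 ^ m = X * x - y₁
  pow_w₂ : w₂ ^ 3 ^ m = X * y₁ - y₂
  pow_y₁ : y₁ ^ (3 * 3 ^ m) = X ^ 3 * x - w₁
  pow_y₂ : y₂ ^ (3 * 3 ^ m) = x * (X ^ 3 * x - w₁) - w₂

/-- Unfolds the nested definitions into separate equations, so that each can be checked with the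
earlier w_i already in polynomial form. -/
theorem coords_eq_of {m : ℕ} {A : Type*} [CommRing A]
    {x y₁ y₂ w₁ w₂ w₃ w₄ v w₅ w₆ w₇ w₈ w₉ w₁₀ : A}
    (h₁ : x ^ (3 * 3 ^ m + 1) - y₁ ^ (3 * 3 ^ m) = w₁)
    (h₂ : x * y₁ ^ (3 * 3 ^ m) - y₂ ^ (3 * 3 ^ m) = w₂)
    (h₃ : x * y₂ ^ (3 * 3 ^ m) - w₁ ^ (3 * 3 ^ m) = w₃)
    (h₄ : x * w₂ ^ 3 ^ m - y₁ * w₁ ^ 3 ^ m = w₄)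
    (hv : x * w₃ ^ 3 ^ m - y₂ * w₁ ^ 3 ^ m = v)
    (h₅ : y₁ * w₃ ^ 3 ^ m - y₂ * w₂ ^ 3 ^ m = w₅)
    (h₆ : v ^ (3 * 3 ^ m) - w₂ ^ (3 * 3 ^ m) + x * w₄ ^ (3 * 3 ^ m) = w₆)
    (h₇ : w₂ + v = w₇)
    (h₈ : w₅ ^ (3 * 3 ^ m) + x * w₇ ^ (3 * 3 ^ m) = w₈)
    (h₉ : w₄ * w₂ ^ 3 ^ m - y₁ * w₆ ^ 3 ^ m = w₉)
    (h₁₀ : y₂ * w₆ ^ 3 ^ m - w₃ ^ 3 ^ m * w₄ = w₁₀) :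
    coords m x y₁ y₂ = ![1, x, y₁, y₂, w₁, w₂, w₃, w₄, w₅, w₆, w₇, w₈, w₉, w₁₀] := by
  subst h₁ h₂ h₃ h₄ hv h₅ h₆ h₇ h₈ h₉ h₁₀
  rfl

theorem pow_t {m : ℕ} {A : Type*} [CommRing A] (a : A) :
    a ^ (3 * 3 ^ m) = (a ^ 3 ^ m) ^ 3 := pow_mul' _ _ _

theorem pow_t_q₀ {m : ℕ} {A : Type*} [CommRing A] (a : A) :
    (a ^ (3 * 3 ^ m)) ^ 3 ^ m = a ^ 3 ^ (2 * m + 1) := by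
  rw [← pow_mul]; congr 1; ring

section Char3

variable {m : ℕ} {A : Type*} [CommRing A] [CharP A 3]

theorem sub_pow_q₀ (a b : A) : (a - b) ^ 3 ^ m = a ^ 3 ^ m - b ^ 3 ^ m := sub_pow_char_pow a b _

theorem add_pow_q₀ (a b : A) : (a + b) ^ 3 ^ m = a ^ 3 ^ m + b ^ 3 ^ m := add_pow_char_pow a b _ _

theorem sub_pow_t (a b : A) :
    (a - b) ^ (3 * 3 ^ m) = a ^ (3 * 3 ^ m) - b ^ (3 * 3 ^ m) := by
  rw [← pow_succ']; exact sub_pow_char_pow a b _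

theorem add_pow_t (a b : A) :
    (a + b) ^ (3 * 3 ^ m) = a ^ (3 * 3 ^ m) + b ^ (3 * 3 ^ m) := by
  rw [← pow_succ']; exact add_pow_char_pow a b _ _

namespace Flag

variable {X x y₁ y₂ w₁ w₂ : A}

/-- As t q₀ = q, the relations for w₁^q₀ and w₂^q₀ are the two curve equations; those for y₁ and y₂
rearrange the definitions of w₁ and w₂. -/
theorem of_onCurve (h : OnCurve m x y₁ y₂) :
    Flag m (x ^ 3 ^ m) x y₁ y₂ (x ^ (3 * 3 ^ m + 1) - y₁ ^ (3 * 3 ^ m))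
      (x * y₁ ^ (3 * 3 ^ m) - y₂ ^ (3 * 3 ^ m)) := by
  obtain ⟨h₁, h₂⟩ := h
  refine ⟨rfl, ?_, ?_, ?_, ?_⟩
  · rw [sub_pow_q₀, pow_t_q₀, pow_succ, mul_pow, pow_t_q₀]
    linear_combination -h₁
  · rw [sub_pow_q₀, mul_pow, pow_t_q₀, pow_t_q₀]
    linear_combination -h₂
  · rw [← pow_t]; ring
  · rw [← pow_t]; ring

/-- The q₀-th powers of the relations for y₁ and y₂ recover the curve equations. Transformed points
are shown to lie on the curve by exhibiting their flag. -/
theorem onCurve (h : Flag m X x y₁ y₂ w₁ w₂) : OnCurve m x y₁ y₂ := by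
  have hX : (X ^ 3) ^ 3 ^ m = x ^ 3 ^ (2 * m + 1) := by
    rw [← pow_t_q₀, pow_t, h.pow_x]
  have h₁ : y₁ ^ 3 ^ (2 * m + 1) = x ^ 3 ^ (2 * m + 1) * X - (X * x - y₁) := by
    rw [← pow_t_q₀, h.pow_y₁, sub_pow_q₀, mul_pow, hX, h.pow_w₁, h.pow_x]
  have h₂ : y₂ ^ 3 ^ (2 * m + 1) =
      X * (x ^ 3 ^ (2 * m + 1) * X - (X * x - y₁)) - (X * y₁ - y₂) := by
    rw [← pow_t_q₀, h.pow_y₂, sub_pow_q₀, mul_pow, sub_pow_q₀, mul_pow, hX, h.pow_w₁, h.pow_x,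
      h.pow_w₂]
  constructor
  · rw [h₁, h.pow_x]; ring
  · rw [h₁, h₂, h.pow_x]; ring

/-- Frobenius turns w₃, w₆ and w₈ into polynomials of degree one in `X`: w₃^q₀ = X y₂ - w₁, w₆^q₀ =
X w₄ + v - w₂ and w₈^q₀ = X w₇ + w₅. -/
theorem pow_w₃ (h : Flag m X x y₁ y₂ w₁ w₂) :
    (flagCoords x y₁ y₂ w₁ w₂ 6) ^ 3 ^ m = X * y₂ - w₁ := by
  change (y₁ ^ 3 - x ^ 2 * w₁ - x * w₂) ^ 3 ^ m = _
  rw [sub_pow_q₀, sub_pow_q₀, mul_pow, mul_pow, ← pow_mul, h.pow_y₁, ← pow_mul, pow_mul', h.pow_x,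
    h.pow_w₁, h.pow_w₂]
  ring

theorem pow_w₆ (h : Flag m X x y₁ y₂ w₁ w₂) :
    (flagCoords x y₁ y₂ w₁ w₂ 9) ^ 3 ^ m = X * (y₁ ^ 2 - x * y₂) + (y₁ * y₂ - x * w₁) - w₂ := by
  change (y₂ ^ 3 - x * w₁ ^ 2 + w₁ * w₂) ^ 3 ^ m = _
  rw [add_pow_q₀, sub_pow_q₀, mul_pow, mul_pow, ← pow_mul, h.pow_y₂, ← pow_mul, pow_mul', h.pow_x,
    h.pow_w₁, h.pow_w₂]
  grind

theorem pow_w₈ (h : Flag m X x y₁ y₂ w₁ w₂) :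
    (flagCoords x y₁ y₂ w₁ w₂ 11) ^ 3 ^ m =
      X * (w₂ + (y₁ * y₂ - x * w₁)) + (y₂ ^ 2 - y₁ * w₁) := by
  change (w₂ ^ 2 - w₁ * (flagCoords x y₁ y₂ w₁ w₂ 6) -
    x * (flagCoords x y₁ y₂ w₁ w₂ 9)) ^ 3 ^ m = _
  rw [sub_pow_q₀, sub_pow_q₀, mul_pow, mul_pow, ← pow_mul, pow_mul', h.pow_x,
    h.pow_w₁, h.pow_w₂, h.pow_w₃, h.pow_w₆]
  grind

theorem coords_eq (h : Flag m X x y₁ y₂ w₁ w₂) :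
    coords m x y₁ y₂ = flagCoords x y₁ y₂ w₁ w₂ := by
  have h₁ := h.pow_w₁
  have h₂ := h.pow_w₂
  have h₃ := h.pow_w₃
  have h₆ := h.pow_w₆
  have k₁ := h.pow_y₁
  have k₂ := h.pow_y₂
  have hw₁ : w₁ ^ (3 * 3 ^ m) = (X * x - y₁) ^ 3 := by rw [pow_t, h₁]
  have hw₂ : w₂ ^ (3 * 3 ^ m) = (X * y₁ - y₂) ^ 3 := by rw [pow_t, h₂]
  have hx : x ^ (3 * 3 ^ m) = X ^ 3 := by rw [pow_t, h.pow_x]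
  change (y₁ ^ 3 - x ^ 2 * w₁ - x * w₂) ^ 3 ^ m = _ at h₃
  change (y₂ ^ 3 - x * w₁ ^ 2 + w₁ * w₂) ^ 3 ^ m = _ at h₆
  apply coords_eq_of (v := y₁ * y₂ - x * w₁)
  · rw [pow_succ, hx, k₁]; ring
  · rw [k₁, k₂]; ring
  · rw [k₂, hw₁]; clear * -; grind
  · rw [h₁, h₂]; ring
  · rw [h₁, h₃]; ring
  · rw [h₂, h₃]; ring
  · simp only [sub_pow_t, mul_pow, pow_right_comm _ 2 (3 * 3 ^ m), hx, hw₁, hw₂, k₁, k₂]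
    clear * -; grind
  · rfl
  · simp only [sub_pow_t, add_pow_t, mul_pow, pow_right_comm _ 2 (3 * 3 ^ m), hx, hw₁, hw₂, k₁, k₂]
    clear * -; grind
  · rw [h₂, h₆]; ring
  · rw [h₆, h₃]; ring

end Flag

end Char3

/-! ### Rational pole orders in an arbitrary value group. -/

section Order

variable {L Γ₀ : Type*} [Field L] [LinearOrderedCommGroupWithZero Γ₀] (v : Valuation L Γ₀)

/-- A nonzero term of largest valuation would strictly dominate all others and could not cancel. -/
theorem eq_zero_of_sum_eq_zero_of_valuation_ne {ι : Type*} (S : Finset ι) (a : ι → L)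
    (ha : ∀ i ∈ S, ∀ j ∈ S, a i ≠ 0 → a j ≠ 0 → v (a i) = v (a j) → i = j)
    (h : ∑ i ∈ S, a i = 0) : ∀ i ∈ S, a i = 0 := by
  classical
  by_contra! hne
  obtain ⟨i₀, hi₀, hne₀⟩ := hne
  obtain ⟨i, hi, hmax⟩ := S.exists_max_image (fun i => v (a i)) ⟨i₀, hi₀⟩
  have hai : a i ≠ 0 := fun h0 => hne₀ <| by
    have := hmax i₀ hi₀
    simpa [h0] using this
  have hlt : v (∑ j ∈ S.erase i, a j) < v (a i) := by
    apply v.map_sum_lt (v.ne_zero_iff.2 hai)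
    intro j hj
    obtain ⟨hji, hjS⟩ := Finset.mem_erase.1 hj
    refine lt_of_le_of_ne (hmax j hjS) fun heq => hji ?_
    refine ha j hjS i hi (fun h0 => hai ?_) hai heq
    rw [h0, map_zero] at heq
    exact v.zero_iff.1 heq.symm
  rw [← Finset.add_sum_erase _ _ hi] at h
  have := v.map_add_eq_of_lt_left hlt
  rw [h, map_zero] at this
  exact hai (v.zero_iff.1 this.symm)

/-- `v a` is the `n / N`-th power of `g`. -/
def HasOrder (g : Γ₀) (N : ℕ) (a : L) (n : ℕ) : Prop := v a ^ N = g ^ n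

/-- `v a` is less than the `n / N`-th power of `g`. -/
def OrderLT (g : Γ₀) (N : ℕ) (a : L) (n : ℕ) : Prop := v a ^ N < g ^ n

variable {v} {g : Γ₀} {N : ℕ} {a b : L} {n k : ℕ}

namespace HasOrder

theorem mul (ha : HasOrder v g N a n) (hb : HasOrder v g N b k) :
    HasOrder v g N (a * b) (n + k) := by
  unfold HasOrder at *
  rw [map_mul, mul_pow, ha, hb, pow_add]

theorem pow (ha : HasOrder v g N a n) (k : ℕ) : HasOrder v g N (a ^ k) (k * n) := by
  unfold HasOrder at *
  rw [map_pow, pow_right_comm, ha, ← pow_mul, mul_comm]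

theorem of_pow (hk : k ≠ 0) (ha : HasOrder v g N (a ^ k) (k * n)) : HasOrder v g N a n := by
  unfold HasOrder at *
  rw [map_pow, pow_right_comm, mul_comm k n, pow_mul] at ha
  exact (pow_left_inj₀ (zero_le) (zero_le) hk).1 ha

theorem neg (ha : HasOrder v g N a n) : HasOrder v g N (-a) n := by
  unfold HasOrder at *
  rwa [Valuation.map_neg]

theorem of_mul (hg : g ≠ 0) (ha : HasOrder v g N a n) (hab : HasOrder v g N (a * b) (n + k)) :
    HasOrder v g N b k := by
  unfold HasOrder at *
  rw [map_mul, mul_pow, ha, pow_add] at hab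
  exact mul_left_cancel₀ (pow_ne_zero _ hg) hab

theorem congr (ha : HasOrder v g N a n) (hab : a = b) (hnk : n = k) : HasOrder v g N b k := by
  rwa [← hab, ← hnk]

theorem lt (hg : 1 < g) (ha : HasOrder v g N a n) (h : n < k) : OrderLT v g N a k := by
  unfold HasOrder OrderLT at *
  rw [ha]
  exact pow_lt_pow_right₀ hg h

theorem ne_zero (hg : 1 < g) (hN : N ≠ 0) (ha : HasOrder v g N a n) : a ≠ 0 := by
  rintro rfl
  unfold HasOrder at ha
  rw [map_zero, zero_pow hN] at ha
  exact pow_ne_zero n (zero_lt_one.trans hg).ne' ha.symm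

theorem add (ha : HasOrder v g N a n) (hb : OrderLT v g N b n) : HasOrder v g N (a + b) n := by
  have : v b < v a := by
    unfold HasOrder OrderLT at *
    rw [← ha] at hb
    exact lt_of_pow_lt_pow_left₀ N (zero_le) hb
  unfold HasOrder at *
  rwa [v.map_add_eq_of_lt_left this]

theorem valuation_lt (hg : 1 < g) (ha : HasOrder v g N a n) (hb : HasOrder v g N b k)
    (h : n < k) : v a < v b := by
  have := ha.lt hg h
  unfold OrderLT at this
  unfold HasOrder at hb
  rw [← hb] at this
  exact lt_of_pow_lt_pow_left₀ N (zero_le) this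

theorem eq_of_valuation_eq (hg : 1 < g) (ha : HasOrder v g N a n) (hb : HasOrder v g N b k)
    (h : v a = v b) : n = k := by
  unfold HasOrder at *
  rw [h, hb] at ha
  exact pow_right_injective₀ (zero_lt_one.trans hg) hg.ne' ha.symm

/-- The order of a root of an Artin–Schreier equation. -/
theorem of_pow_sub (hg : 1 < g) (hn : 0 < n) (hk : 1 < k)
    (ha : HasOrder v g N (a ^ k - a) (k * n)) : HasOrder v g N a n := by
  have hk0 : k ≠ 0 := by omega
  -- Were v a ≤ 1, then a ^ k - a would be integral, against its positive pole order. Beyond 1 the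
  -- term a ^ k dominates.
  have h1 : 1 < v a := by
    by_contra! hle
    have h2 : v (a ^ k - a) ≤ 1 := (v.map_sub _ _).trans (max_le (by
      rw [map_pow]; exact pow_le_one' hle k) hle)
    have h3 : v (a ^ k - a) ^ N ≤ 1 := pow_le_one' h2 N
    unfold HasOrder at ha
    rw [ha] at h3
    exact absurd h3 (not_le.2 (one_lt_pow₀ hg (by positivity)))
  have h2 : v a < v (a ^ k) := by
    rw [map_pow]
    exact lt_self_pow₀ h1 hk
  refine of_pow hk0 ?_
  unfold HasOrder at *
  rwa [v.map_sub_eq_of_lt_left h2] at ha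

end HasOrder

namespace OrderLT

theorem add (ha : OrderLT v g N a n) (hb : OrderLT v g N b n) :
    OrderLT v g N (a + b) n := by
  unfold OrderLT at *
  rcases le_max_iff.1 (v.map_add a b) with h | h
  · exact (pow_le_pow_left₀ (zero_le) h N).trans_lt ha
  · exact (pow_le_pow_left₀ (zero_le) h N).trans_lt hb

theorem neg (ha : OrderLT v g N a n) : OrderLT v g N (-a) n := by
  unfold OrderLT at *
  rwa [Valuation.map_neg]

theorem of_pow (ha : OrderLT v g N (a ^ k) (k * n)) : OrderLT v g N a n := by
  unfold OrderLT at *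
  rw [map_pow, pow_right_comm, mul_comm k n, pow_mul] at ha
  exact lt_of_pow_lt_pow_left₀ k (zero_le) ha

end OrderLT

theorem HasOrder.sub (ha : HasOrder v g N a n) (hb : OrderLT v g N b n) :
    HasOrder v g N (a - b) n := by
  rw [sub_eq_add_neg]; exact ha.add hb.neg

end Order

/-! ### Pole orders at infinity. -/

/-- The pole orders at infinity of the fourteen coordinate functions, for `q₀ = s`. -/
def poleOrder (s : ℕ) : Fin 14 → ℕ :=
  ![0, 9 * s ^ 4, 9 * s ^ 4 + 3 * s ^ 3, 9 * s ^ 4 + 6 * s ^ 3, 9 * s ^ 4 + 9 * s ^ 3,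
    9 * s ^ 4 + 9 * s ^ 3 + 3 * s ^ 2, 9 * s ^ 4 + 9 * s ^ 3 + 6 * s ^ 2,
    9 * s ^ 4 + 6 * s ^ 3 + 3 * s ^ 2, 9 * s ^ 4 + 9 * s ^ 3 + 3 * s ^ 2 + s,
    9 * s ^ 4 + 9 * s ^ 3 + 6 * s ^ 2 + 3 * s, 9 * s ^ 4 + 6 * s ^ 3 + 3 * s ^ 2 + s,
    9 * s ^ 4 + 9 * s ^ 3 + 6 * s ^ 2 + 3 * s + 1, 9 * s ^ 4 + 9 * s ^ 3 + 6 * s ^ 2 + s,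
    9 * s ^ 4 + 9 * s ^ 3 + 6 * s ^ 2 + 2 * s]

/-- On a flag this reads w₈^q₀ w₁₀ = w₆^q₀ w₆ - w₃^q₀ w₈. The formula for w₁₀ itself suffers
cancellation at infinity, whereas here the first term on the right dominates. The relation for w₉
serves the same purpose. -/
theorem flag_rel_w₁₀ {A : Type*} [CommRing A] [CharP A 3] (X x y₁ y₂ w₁ w₂ : A) :
    (X * (w₂ + (y₁ * y₂ - x * w₁)) + (y₂ ^ 2 - y₁ * w₁)) * flagCoords x y₁ y₂ w₁ w₂ 13 =
      (X * (y₁ ^ 2 - x * y₂) + (y₁ * y₂ - x * w₁) - w₂) * (y₂ ^ 3 - x * w₁ ^ 2 + w₁ * w₂) -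
      (X * y₂ - w₁) * flagCoords x y₁ y₂ w₁ w₂ 11 := by
  simp only [flagCoords, Matrix.cons_val]
  grind

theorem flag_rel_w₉ {A : Type*} [CommRing A] [CharP A 3] (X x y₁ y₂ w₁ w₂ : A) :
    (X * (w₂ + (y₁ * y₂ - x * w₁)) + (y₂ ^ 2 - y₁ * w₁)) * flagCoords x y₁ y₂ w₁ w₂ 12 =
      (X * (y₁ ^ 2 - x * y₂) + (y₁ * y₂ - x * w₁) - w₂) * flagCoords x y₁ y₂ w₁ w₂ 13 +
      (X * y₁ - y₂) * flagCoords x y₁ y₂ w₁ w₂ 11 := by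
  simp only [flagCoords, Matrix.cons_val]
  grind

section PoleOrder

variable {m : ℕ} {L Γ₀ : Type*} [Field L] [CharP L 3] [LinearOrderedCommGroupWithZero Γ₀]
  {v : Valuation L Γ₀} {X x y₁ y₂ w₁ w₂ : L}

/-- Apart from w₉ and w₁₀, each function beyond x, y₁, y₂ has a q₀-th or 3q₀-th power in which one
summand dominates. The extra clause is for m = 0, where w₁ and w₄ share the order 18. -/
theorem Flag.hasOrder (h : Flag m X x y₁ y₂ w₁ w₂) (hx : 1 < v x) :
    (∀ i, HasOrder v (v x) (9 * (3 ^ m) ^ 4) (flagCoords x y₁ y₂ w₁ w₂ i)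
      (poleOrder (3 ^ m) i)) ∧
    (m = 0 → HasOrder v (v x) 9 (w₁ + (y₁ ^ 2 - x * y₂)) 16) := by
  have hcurve := h.onCurve
  have e1 := h.pow_w₁
  have e2 := h.pow_w₂
  have e3 := h.pow_w₃
  have e6 := h.pow_w₆
  have e8 := h.pow_w₈
  have k1 := h.pow_y₁
  have k2 := h.pow_y₂
  have l1 : w₁ ^ (3 * 3 ^ m) = (X * x - y₁) ^ 3 := by rw [pow_t, e1]
  have l2 : w₂ ^ (3 * 3 ^ m) = (X * y₁ - y₂) ^ 3 := by rw [pow_t, e2]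
  have lx : x ^ (3 * 3 ^ m) = X ^ 3 := by rw [pow_t, h.pow_x]
  have hq : 3 ^ (2 * m + 1) = 3 * (3 ^ m) ^ 2 := by ring
  unfold OnCurve at hcurve
  rw [hq, h.pow_x] at hcurve
  have hs1 : 1 ≤ 3 ^ m := Nat.one_le_pow _ _ (by norm_num)
  have hm0 : m = 0 → 3 ^ m = 1 := fun hm => by rw [hm, pow_zero]
  have l4 : (y₁ ^ 2 - x * y₂) ^ (3 * 3 ^ m) = -(X ^ 3 * x * w₁) + X ^ 3 * w₂ + w₁ ^ 2 := by
    simp only [sub_pow_t, mul_pow, pow_right_comm _ 2 (3 * 3 ^ m), lx, k1, k2]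
    clear * -; grind
  have lv : (y₁ * y₂ - x * w₁) ^ (3 * 3 ^ m) =
      -(X ^ 3 * x ^ 2 * w₁) + x * w₁ ^ 2 + w₁ * w₂ +
        X ^ 3 * (y₁ ^ 3 - x ^ 2 * w₁ - x * w₂) := by
    simp only [sub_pow_t, mul_pow, lx, k1, k2, l1]
    clear * -; grind
  have l7 : (w₂ + (y₁ * y₂ - x * w₁)) ^ (3 * 3 ^ m) =
      X ^ 3 * x * w₂ + x * w₁ ^ 2 + w₁ * w₂ - X ^ 3 * (y₁ ^ 3 - x ^ 2 * w₁ - x * w₂) -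
        y₂ ^ 3 := by
    rw [add_pow_t, lv, l2]
    clear * -; grind
  have l5 : (y₂ ^ 2 - y₁ * w₁) ^ (3 * 3 ^ m) =
      -(X ^ 3 * x ^ 2 * w₂) + X ^ 3 * x * (y₁ ^ 3 - x ^ 2 * w₁ - x * w₂) + x * w₁ * w₂ + w₂ ^ 2
        - w₁ * (y₁ ^ 3 - x ^ 2 * w₁ - x * w₂) := by
    simp only [sub_pow_t, mul_pow, pow_right_comm _ 2 (3 * 3 ^ m), k1, k2, l1]
    clear * -; grind
  have hX := h.pow_x
  change (y₁ ^ 3 - x ^ 2 * w₁ - x * w₂) ^ 3 ^ m = _ at e3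
  change (y₂ ^ 3 - x * w₁ ^ 2 + w₁ * w₂) ^ 3 ^ m = _ at e6
  have c10 := flag_rel_w₁₀ X x y₁ y₂ w₁ w₂
  have c9 := flag_rel_w₉ X x y₁ y₂ w₁ w₂
  rw [← e8, ← e6, ← e3] at c10
  rw [← e8, ← e6, ← e2] at c9
  -- For m = 0 the leading parts of w₁ and w₄ cancel in the sum. Its cube is led by -x⁴y₁, of order
  -- 48 = 3 · 16.
  have hlow : m = 0 → (w₁ + (y₁ ^ 2 - x * y₂)) ^ 3 =
      -(x ^ 4 * y₁) - x ^ 3 * y₂ + x ^ 2 - y₁ + x ^ 2 * y₁ + y₁ ^ 2 := by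
    rintro rfl
    simp only [pow_zero, pow_one, mul_one] at hX e1 e2 k1 k2
    subst hX e1 e2
    clear * - k1 k2
    grind
  generalize hw₃ : y₁ ^ 3 - x ^ 2 * w₁ - x * w₂ = w₃ at *
  generalize hw₄ : y₁ ^ 2 - x * y₂ = w₄ at *
  generalize hv : y₁ * y₂ - x * w₁ = u at *
  generalize hw₅ : y₂ ^ 2 - y₁ * w₁ = w₅ at *
  generalize hw₆ : y₂ ^ 3 - x * w₁ ^ 2 + w₁ * w₂ = w₆ at *
  generalize hw₇ : w₂ + u = w₇ at *
  generalize hw₈ : flagCoords x y₁ y₂ w₁ w₂ 11 = w₈ at *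
  generalize hw₉ : flagCoords x y₁ y₂ w₁ w₂ 12 = w₉ at *
  generalize hw₁₀ : flagCoords x y₁ y₂ w₁ w₂ 13 = w₁₀ at *
  generalize 3 ^ m = s at *
  clear h
  have hs0 : s ≠ 0 := by omega
  have ht0 : 3 * s ≠ 0 := by omega
  have hs2 : s ≤ s ^ 2 := by nlinarith
  have hs3 : s ^ 2 ≤ s ^ 3 := Nat.pow_le_pow_right hs1 (by norm_num)
  have hs4 : s ^ 3 ≤ s ^ 4 := Nat.pow_le_pow_right hs1 (by norm_num)
  have hs5 : s ^ 4 ≤ s ^ 5 := Nat.pow_le_pow_right hs1 (by norm_num)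
  have hs6 : s ^ 5 ≤ s ^ 6 := Nat.pow_le_pow_right hs1 (by norm_num)
  have Hx : HasOrder v (v x) (9 * s ^ 4) x (9 * s ^ 4) := rfl
  have HX : HasOrder v (v x) (9 * s ^ 4) X (s * (9 * s ^ 4)) := hX ▸ Hx.pow s
  have HX3 := HX.pow 3
  have Hxq := (Hx.pow (3 * s ^ 2)).sub (Hx.lt hx (by nlinarith))
  have Hy₁ : HasOrder v (v x) (9 * s ^ 4) y₁ (9 * s ^ 4 + 3 * s ^ 3) := by
    refine .of_pow_sub hx (by positivity) (k := 3 * s ^ 2) (by nlinarith) ?_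
    exact (HX.mul Hxq).congr hcurve.1.symm (by ring)
  have Hy₂ : HasOrder v (v x) (9 * s ^ 4) y₂ (9 * s ^ 4 + 6 * s ^ 3) := by
    refine .of_pow_sub hx (by positivity) (k := 3 * s ^ 2) (by nlinarith) ?_
    exact (HX.mul (HX.mul Hxq)).congr (by rw [hcurve.2, hcurve.1]) (by ring)
  have Hw₁ : HasOrder v (v x) (9 * s ^ 4) w₁ (9 * s ^ 4 + 9 * s ^ 3) := by
    refine .of_pow hs0 ?_
    exact ((HX.mul Hx).sub (Hy₁.lt hx (by nlinarith only [hs1, hs2, hs3, hs4, hs5, hs6]))).congr e1.symm (by ring)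
  have Hw₂ : HasOrder v (v x) (9 * s ^ 4) w₂ (9 * s ^ 4 + 9 * s ^ 3 + 3 * s ^ 2) := by
    refine .of_pow hs0 ?_
    exact ((HX.mul Hy₁).sub (Hy₂.lt hx (by nlinarith only [hs1, hs2, hs3, hs4, hs5, hs6]))).congr e2.symm (by ring)
  have Hw₃ : HasOrder v (v x) (9 * s ^ 4) w₃ (9 * s ^ 4 + 9 * s ^ 3 + 6 * s ^ 2) := by
    refine .of_pow hs0 ?_
    exact ((HX.mul Hy₂).sub (Hw₁.lt hx (by nlinarith only [hs1, hs2, hs3, hs4, hs5, hs6]))).congr e3.symm (by ring)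
  have Hw₄ : HasOrder v (v x) (9 * s ^ 4) w₄ (9 * s ^ 4 + 6 * s ^ 3 + 3 * s ^ 2) := by
    refine .of_pow ht0 ?_
    exact ((((HX3.mul Hx).mul Hw₁).neg.add ((HX3.mul Hw₂).lt hx (by nlinarith only [hs1, hs2, hs3, hs4, hs5, hs6]))).add
      ((Hw₁.pow 2).lt hx (by nlinarith only [hs1, hs2, hs3, hs4, hs5, hs6]))).congr l4.symm (by ring)
  -- Only an upper bound for v is needed: it must stay below X w₄ in w₆^q₀ = X w₄ + v - w₂.
  have Hu : OrderLT v (v x) (9 * s ^ 4) u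
      (s * (9 * s ^ 4) + (9 * s ^ 4 + 6 * s ^ 3 + 3 * s ^ 2)) := by
    refine .of_pow (k := 3 * s) ?_
    rw [lv]
    exact (((((HX3.mul (Hx.pow 2)).mul Hw₁).neg.lt hx (by nlinarith only [hs1, hs2, hs3, hs4, hs5, hs6])).add
      ((Hx.mul (Hw₁.pow 2)).lt hx (by nlinarith only [hs1, hs2, hs3, hs4, hs5, hs6]))).add ((Hw₁.mul Hw₂).lt hx (by nlinarith only [hs1, hs2, hs3, hs4, hs5, hs6]))).add
      ((HX3.mul Hw₃).lt hx (by nlinarith only [hs1, hs2, hs3, hs4, hs5, hs6]))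
  have Hw₆ : HasOrder v (v x) (9 * s ^ 4) w₆ (9 * s ^ 4 + 9 * s ^ 3 + 6 * s ^ 2 + 3 * s) := by
    refine .of_pow hs0 ?_
    exact (((HX.mul Hw₄).add Hu).sub (Hw₂.lt hx (by nlinarith only [hs1, hs2, hs3, hs4, hs5, hs6]))).congr e6.symm (by ring)
  have Hw₇ : HasOrder v (v x) (9 * s ^ 4) w₇ (9 * s ^ 4 + 6 * s ^ 3 + 3 * s ^ 2 + s) := by
    refine .of_pow ht0 ?_
    exact ((((((HX3.mul Hx).mul Hw₂).add ((Hx.mul (Hw₁.pow 2)).lt hx (by nlinarith only [hs1, hs2, hs3, hs4, hs5, hs6]))).add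
      ((Hw₁.mul Hw₂).lt hx (by nlinarith only [hs1, hs2, hs3, hs4, hs5, hs6]))).sub ((HX3.mul Hw₃).lt hx (by nlinarith only [hs1, hs2, hs3, hs4, hs5, hs6]))).sub
      ((Hy₂.pow 3).lt hx (by nlinarith only [hs1, hs2, hs3, hs4, hs5, hs6]))).congr l7.symm (by ring)
  have Hw₅ : HasOrder v (v x) (9 * s ^ 4) w₅ (9 * s ^ 4 + 9 * s ^ 3 + 3 * s ^ 2 + s) := by
    refine .of_pow ht0 ?_
    exact (((((((HX3.mul (Hx.pow 2)).mul Hw₂).neg).add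
      (((HX3.mul Hx).mul Hw₃).lt hx (by nlinarith only [hs1, hs2, hs3, hs4, hs5, hs6]))).add
      (((Hx.mul Hw₁).mul Hw₂).lt hx (by nlinarith only [hs1, hs2, hs3, hs4, hs5, hs6]))).add ((Hw₂.pow 2).lt hx (by nlinarith only [hs1, hs2, hs3, hs4, hs5, hs6]))).sub
      ((Hw₁.mul Hw₃).lt hx (by nlinarith only [hs1, hs2, hs3, hs4, hs5, hs6]))).congr l5.symm (by ring)
  have Hw₈ : HasOrder v (v x) (9 * s ^ 4) w₈
      (9 * s ^ 4 + 9 * s ^ 3 + 6 * s ^ 2 + 3 * s + 1) := by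
    refine .of_pow hs0 ?_
    exact ((HX.mul Hw₇).add (Hw₅.lt hx (by nlinarith only [hs1, hs2, hs3, hs4, hs5, hs6]))).congr e8.symm (by ring)
  have hvx : v x ≠ 0 := (zero_lt_one.trans hx).ne'
  have Hw₁₀ : HasOrder v (v x) (9 * s ^ 4) w₁₀
      (9 * s ^ 4 + 9 * s ^ 3 + 6 * s ^ 2 + 2 * s) := by
    refine .of_mul hvx (Hw₈.pow s) ?_
    exact (((Hw₆.pow s).mul Hw₆).sub (((Hw₃.pow s).mul Hw₈).lt hx (by nlinarith only [hs1, hs2, hs3, hs4, hs5, hs6]))).congr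
      c10.symm (by ring)
  have Hw₉ : HasOrder v (v x) (9 * s ^ 4) w₉
      (9 * s ^ 4 + 9 * s ^ 3 + 6 * s ^ 2 + s) := by
    refine .of_mul hvx (Hw₈.pow s) ?_
    exact (((Hw₆.pow s).mul Hw₁₀).add (((Hw₂.pow s).mul Hw₈).lt hx (by nlinarith only [hs1, hs2, hs3, hs4, hs5, hs6]))).congr
      c9.symm (by ring)
  constructor
  · subst hw₃ hw₄ hw₅ hw₆ hw₇ hv
    intro i
    fin_cases i
    · exact (by simp [HasOrder] : HasOrder v (v x) _ (1 : L) 0)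
    · exact Hx
    · exact Hy₁
    · exact Hy₂
    · exact Hw₁
    · exact Hw₂
    · exact Hw₃
    · exact Hw₄
    · exact Hw₅
    · exact Hw₆
    · exact Hw₇
    · exact hw₈ ▸ Hw₈
    · exact hw₉ ▸ Hw₉
    · exact hw₁₀ ▸ Hw₁₀
  · intro hm
    obtain rfl := hm0 hm
    refine .of_pow (k := 3) (by norm_num) ?_
    exact (((((((Hx.pow 4).mul Hy₁).neg.sub (((Hx.pow 3).mul Hy₂).lt hx (by norm_num))).add
      ((Hx.pow 2).lt hx (by norm_num))).sub (Hy₁.lt hx (by norm_num))).add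
      (((Hx.pow 2).mul Hy₁).lt hx (by norm_num))).add ((Hy₁.pow 2).lt hx (by norm_num))).congr
      (hlow hm).symm (by norm_num)

end PoleOrder

/-! ### Valuation rings and constants. -/

section Places

variable {K L : Type*} [Field K] [Field L] [Algebra K L]

/-- The integral closure of K in L is an intersection of valuation rings of L. -/
theorem exists_valuationSubring_notMem {a : L} (ha : ¬ IsIntegral K a) :
    ∃ V : ValuationSubring L, a ∉ V := by
  have : IsIntegrallyClosedIn (integralClosure K L).toSubring L :=
    inferInstanceAs (IsIntegrallyClosedIn (integralClosure K L) L)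
  obtain ⟨V, -, hV⟩ := Subring.exists_le_valuationSubring_of_isIntegrallyClosedIn
    (R := (integralClosure K L).toSubring) (x := a) ha
  exact ⟨V, hV⟩

/-- Nonzero elements of a finite field are roots of unity, and an ordered value group has no
torsion. -/
theorem valuation_algebraMap_eq_one [Finite K] {Γ₀ : Type*} [LinearOrderedCommGroupWithZero Γ₀]
    (v : Valuation L Γ₀) {c : K} (hc : c ≠ 0) : v (algebraMap K L c) = 1 := by
  have : Fintype K := Fintype.ofFinite K
  have h : c ^ (Fintype.card K - 1) = 1 := FiniteField.pow_card_sub_one_eq_one c hc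
  have h' : v (algebraMap K L c) ^ (Fintype.card K - 1) = 1 := by
    rw [← map_pow, ← map_pow, h, map_one, map_one]
  refine (pow_eq_one_iff_of_nonneg zero_le ?_).1 h'
  have := Fintype.one_lt_card (α := K)
  omega

theorem isTrivialOn_of_finite [Finite K] {Γ₀ : Type*} [LinearOrderedCommGroupWithZero Γ₀]
    (v : Valuation L Γ₀) : v.IsTrivialOn K :=
  ⟨fun _ hc => valuation_algebraMap_eq_one v hc⟩

theorem isIntegral_of_forall_mem {a : L} (h : ∀ V : ValuationSubring L, a ∈ V) :
    IsIntegral K a := by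
  by_contra ha
  obtain ⟨V, hV⟩ := exists_valuationSubring_notMem ha
  exact hV (h V)

variable [Finite K] {m : ℕ} [CharP L 3] {Γ₀ : Type*} [LinearOrderedCommGroupWithZero Γ₀]
  {v : Valuation L Γ₀} {x y₁ y₂ : L}

theorem OnCurve.hasOrder (h : OnCurve m x y₁ y₂) (hx : 1 < v x) :
    (∀ i, HasOrder v (v x) (9 * (3 ^ m) ^ 4) (coords m x y₁ y₂ i) (poleOrder (3 ^ m) i)) ∧
    (m = 0 → HasOrder v (v x) 9 (coords m x y₁ y₂ 4 + coords m x y₁ y₂ 7) 16) := by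
  have := (Flag.of_onCurve h).hasOrder hx
  rwa [(Flag.of_onCurve h).coords_eq]

/-- The order of w₈ is prime to N = q², a power of 3. As x has order N, the order of the j-th term
modulo N determines j, so nonzero terms have distinct valuations. -/
theorem aeval_eq_zero_of_sum_mul_pow_eq_zero (h : OnCurve m x y₁ y₂) (hx : 1 < v x)
    (p : Fin (9 * (3 ^ m) ^ 4) → Polynomial K)
    (hp : ∑ j, Polynomial.aeval x (p j) * coords m x y₁ y₂ 11 ^ (j : ℕ) = 0) (j) : p j = 0 := by
  have := isTrivialOn_of_finite (K := K) v
  have key : ∀ j, p j ≠ 0 → HasOrder v (v x) (9 * (3 ^ m) ^ 4)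
      (Polynomial.aeval x (p j) * coords m x y₁ y₂ 11 ^ (j : ℕ))
      ((p j).natDegree * (9 * (3 ^ m) ^ 4) + j * poleOrder (3 ^ m) 11) := by
    intro j hj
    refine .mul ?_ (((h.hasOrder hx).1 11).pow _)
    unfold HasOrder
    rw [Polynomial.valuation_aeval_eq_valuation_X_pow_natDegree_of_one_lt_valuation_X x hx hj,
      ← pow_mul]
  have hN : 9 * (3 ^ m) ^ 4 ≠ 0 := by positivity
  by_contra hj
  refine ((key j hj).ne_zero hx hN) ?_
  refine eq_zero_of_sum_eq_zero_of_valuation_ne v Finset.univ _ ?_ hp j (Finset.mem_univ j)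
  intro i _ k _ hi hk hik
  have hi' : p i ≠ 0 := fun h0 => hi (by simp [h0])
  have hk' : p k ≠ 0 := fun h0 => hk (by simp [h0])
  have h1 := (key i hi').eq_of_valuation_eq hx (key k hk') hik
  have hcop : Nat.Coprime (9 * (3 ^ m) ^ 4) (poleOrder (3 ^ m) 11) := by
    rw [show 9 * (3 ^ m) ^ 4 = 3 ^ (4 * m + 2) by ring]
    apply Nat.Coprime.pow_left
    rw [Nat.Prime.coprime_iff_not_dvd Nat.prime_three]
    simp only [poleOrder, Matrix.cons_val]
    omega
  have h2 : (i : ℕ) ≡ k [MOD 9 * (3 ^ m) ^ 4] := by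
    apply Nat.ModEq.cancel_right_of_coprime hcop
    unfold Nat.ModEq
    have := congrArg (· % (9 * (3 ^ m) ^ 4)) h1
    simpa [Nat.add_mod] using this
  exact Fin.ext (Nat.ModEq.eq_of_lt_of_lt h2 i.2 k.2)

end Places

/-! ### The coordinate ring is a domain. -/

section CoordRing

variable (K : Type*) [Field K] (m : ℕ)

/-- The classes of `x, y₁, y₂` in the coordinate ring. -/
noncomputable def cls (i : Fin 3) : CoordRing K m :=
  Ideal.Quotient.mk (ideal K m) (MvPolynomial.X i)

theorem onCurve_cls : OnCurve m (cls K m 0) (cls K m 1) (cls K m 2) := by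
  constructor <;>
  · rw [← sub_eq_zero]
    simp only [cls, ← map_pow, ← map_sub, ← map_mul]
    rw [Ideal.Quotient.eq_zero_iff_mem]
    exact Ideal.subset_span (by simp)

variable {K m}

/-- The evaluation of the coordinate ring at a point of the curve. -/
noncomputable def evalHom {A : Type*} [CommRing A] [Algebra K A] {x y₁ y₂ : A}
    (h : OnCurve m x y₁ y₂) : CoordRing K m →ₐ[K] A :=
  Ideal.Quotient.liftₐ (ideal K m) (MvPolynomial.aeval ![x, y₁, y₂]) (by
    intro a ha
    change a ∈ RingHom.ker (MvPolynomial.aeval ![x, y₁, y₂])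
    revert a
    change ideal K m ≤ RingHom.ker _
    rw [ideal, Ideal.span_le]
    rintro _ (rfl | rfl)
    · simpa [RingHom.mem_ker, sub_eq_zero] using h.1
    · simpa [RingHom.mem_ker, sub_eq_zero] using h.2)

theorem evalHom_cls {A : Type*} [CommRing A] [Algebra K A] {x y₁ y₂ : A}
    (h : OnCurve m x y₁ y₂) (i : Fin 3) :
    evalHom (K := K) h (cls K m i) = ![x, y₁, y₂] i := by
  change MvPolynomial.aeval ![x, y₁, y₂] (MvPolynomial.X i) = _
  simp

theorem algHom_ext_cls {A : Type*} [CommRing A] [Algebra K A] {f g : CoordRing K m →ₐ[K] A}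
    (h : ∀ i, f (cls K m i) = g (cls K m i)) : f = g := by
  apply Ideal.Quotient.algHom_ext
  apply MvPolynomial.algHom_ext
  exact h

theorem one_lt_q : 1 < 3 ^ (2 * m + 1) := Nat.one_lt_pow (by omega) (by norm_num)

/-- The equations are monic of degree q in y₁ and y₂, so higher powers reduce. -/
theorem exists_eq_sum_monomials (r : CoordRing K m) :
    ∃ p : Fin (3 ^ (2 * m + 1)) × Fin (3 ^ (2 * m + 1)) → Polynomial K,
      r = ∑ ij, Polynomial.aeval (cls K m 0) (p ij) *
        (cls K m 1 ^ (ij.1 : ℕ) * cls K m 2 ^ (ij.2 : ℕ)) := by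
  let : Algebra (Polynomial K) (CoordRing K m) :=
    (Polynomial.aeval (cls K m 0)).toRingHom.toAlgebra
  have hsmul : ∀ (p : Polynomial K) (r : CoordRing K m),
      p • r = Polynomial.aeval (cls K m 0) p * r := fun p r => Algebra.smul_def p r
  set q := 3 ^ (2 * m + 1) with hq
  have hq1 : 1 < q := one_lt_q
  let B : Fin q × Fin q → CoordRing K m := fun ij => cls K m 1 ^ (ij.1 : ℕ) * cls K m 2 ^ (ij.2 : ℕ)
  let N : Submodule (Polynomial K) (CoordRing K m) := Submodule.span _ (Set.range B)
  have hB : ∀ i j : ℕ, i < q → j < q → cls K m 1 ^ i * cls K m 2 ^ j ∈ N := fun i j hi hj =>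
    Submodule.subset_span ⟨(⟨i, hi⟩, ⟨j, hj⟩), rfl⟩
  obtain ⟨e₁, e₂⟩ := onCurve_cls K m
  have hpol : ∀ n : ℕ, cls K m 0 ^ 3 ^ m * (cls K m 0 ^ n) =
      Polynomial.aeval (cls K m 0) (Polynomial.X ^ 3 ^ m * Polynomial.X ^ n : Polynomial K) := by
    simp
  let f : Polynomial K := Polynomial.X ^ 3 ^ m * (Polynomial.X ^ q - Polynomial.X)
  have hf₁ : cls K m 1 ^ q = cls K m 1 + Polynomial.aeval (cls K m 0) f := by
    simp only [f, map_mul, map_sub, map_pow, Polynomial.aeval_X]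
    linear_combination e₁
  have hf₂ : cls K m 2 ^ q =
      cls K m 2 + Polynomial.aeval (cls K m 0) (Polynomial.X ^ 3 ^ m * f) := by
    simp only [f, map_mul, map_sub, map_pow, Polynomial.aeval_X]
    linear_combination e₂ + cls K m 0 ^ 3 ^ m * e₁
  have h₁ : ∀ r ∈ N, cls K m 1 * r ∈ N := by
    intro r hr
    induction hr using Submodule.span_induction with
    | mem r hr =>
      obtain ⟨⟨i, j⟩, rfl⟩ := hr
      by_cases hi : (i : ℕ) + 1 < q
      · convert hB (i + 1) j hi j.2 using 1
        simp only [B]; ring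
      · have hi' : (i : ℕ) + 1 = q := by have := i.2; omega
        have : cls K m 1 * B (i, j) = cls K m 1 ^ 1 * cls K m 2 ^ (j : ℕ) +
            f • (cls K m 1 ^ 0 * cls K m 2 ^ (j : ℕ)) := by
          simp only [B]
          rw [← mul_assoc, ← pow_succ', hi', hf₁, hsmul]
          ring
        rw [this]
        exact N.add_mem (hB 1 j hq1 j.2) (N.smul_mem _ (hB 0 j (by omega) j.2))
    | zero => simp
    | add a b _ _ ha hb => rw [mul_add]; exact N.add_mem ha hb
    | smul c a _ ha => rw [mul_smul_comm]; exact N.smul_mem _ ha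
  have h₂ : ∀ r ∈ N, cls K m 2 * r ∈ N := by
    intro r hr
    induction hr using Submodule.span_induction with
    | mem r hr =>
      obtain ⟨⟨i, j⟩, rfl⟩ := hr
      by_cases hj : (j : ℕ) + 1 < q
      · convert hB i (j + 1) i.2 hj using 1
        simp only [B]; ring
      · have hj' : (j : ℕ) + 1 = q := by have := j.2; omega
        have : cls K m 2 * B (i, j) = cls K m 1 ^ (i : ℕ) * cls K m 2 ^ 1 +
            (Polynomial.X ^ 3 ^ m * f) • (cls K m 1 ^ (i : ℕ) * cls K m 2 ^ 0) := by
          simp only [B]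
          rw [mul_left_comm, ← pow_succ', hj', hf₂, hsmul]
          ring
        rw [this]
        exact N.add_mem (hB i 1 i.2 hq1) (N.smul_mem _ (hB i 0 i.2 (by omega)))
    | zero => simp
    | add a b _ _ ha hb => rw [mul_add]; exact N.add_mem ha hb
    | smul c a _ ha => rw [mul_smul_comm]; exact N.smul_mem _ ha
  have hN : r ∈ N := by
    obtain ⟨P, rfl⟩ := Ideal.Quotient.mk_surjective r
    induction P using MvPolynomial.induction_on with
    | C a =>
      have : Ideal.Quotient.mk (ideal K m) (MvPolynomial.C a) =
          (Polynomial.C a : Polynomial K) • (cls K m 1 ^ 0 * cls K m 2 ^ 0) := by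
        rw [hsmul, Polynomial.aeval_C]
        simp
        rfl
      rw [this]
      exact N.smul_mem _ (hB 0 0 (by omega) (by omega))
    | add p q hp hq => rw [map_add]; exact N.add_mem hp hq
    | mul_X p i hp =>
      rw [map_mul, mul_comm]
      change cls K m i * _ ∈ N
      fin_cases i
      · have := N.smul_mem (Polynomial.X : Polynomial K) hp
        rwa [hsmul, Polynomial.aeval_X] at this
      · exact h₁ _ hp
      · exact h₂ _ hp
  obtain ⟨p, hp⟩ := (Submodule.mem_span_range_iff_exists_fun _).1 hN
  refine ⟨p, hp.symm.trans ?_⟩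
  simp only [hsmul, B]

/-- A rank count: the K[x]-span of the q² monomials y₁^i y₂^j in L contains q² independent powers of
w₈, hence the monomials are independent as well. -/
theorem evalHom_injective [Finite K] {L Γ₀ : Type*} [Field L] [Algebra K L] [CharP L 3]
    [LinearOrderedCommGroupWithZero Γ₀] {v : Valuation L Γ₀} {x y₁ y₂ : L}
    (h : OnCurve m x y₁ y₂) (hx : 1 < v x) : Function.Injective (evalHom (K := K) h) := by
  let : Algebra (Polynomial K) L := (Polynomial.aeval x).toRingHom.toAlgebra
  have hsmul : ∀ (p : Polynomial K) (r : L), p • r = Polynomial.aeval x p * r :=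
    fun p r => Algebra.smul_def p r
  set q := 3 ^ (2 * m + 1) with hq
  let B : Fin q × Fin q → L := fun ij => y₁ ^ (ij.1 : ℕ) * y₂ ^ (ij.2 : ℕ)
  have heval : ∀ p : Fin q × Fin q → Polynomial K,
      evalHom (K := K) h (∑ ij, Polynomial.aeval (cls K m 0) (p ij) *
        (cls K m 1 ^ (ij.1 : ℕ) * cls K m 2 ^ (ij.2 : ℕ))) = ∑ ij, p ij • B ij := by
    intro p
    simp only [map_sum, map_mul, map_pow, evalHom_cls, ← Polynomial.aeval_algHom_apply, hsmul, B,
      Matrix.cons_val]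
  have hw : LinearIndependent (Polynomial K)
      (fun j : Fin (9 * (3 ^ m) ^ 4) => coords m x y₁ y₂ 11 ^ (j : ℕ)) := by
    rw [Fintype.linearIndependent_iff]
    intro p hp
    simp only [hsmul] at hp
    exact aeval_eq_zero_of_sum_mul_pow_eq_zero h hx p hp
  have hmem : ∀ r, evalHom (K := K) h r ∈ Submodule.span (Polynomial K) (Set.range B) := by
    intro r
    obtain ⟨p, rfl⟩ := exists_eq_sum_monomials r
    rw [heval]
    exact (Submodule.mem_span_range_iff_exists_fun _).2 ⟨p, rfl⟩
  have hcoords : coords m x y₁ y₂ 11 =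
      evalHom (K := K) h (coords m (cls K m 0) (cls K m 1) (cls K m 2) 11) := by
    simp only [coords, Matrix.cons_val, map_sub, map_add, map_mul, map_pow, evalHom_cls]
  have hB : LinearIndependent (Polynomial K) B := by
    rw [linearIndependent_iff_card_le_finrank_span]
    let w : Fin (9 * (3 ^ m) ^ 4) → Submodule.span (Polynomial K) (Set.range B) :=
      fun j => ⟨coords m x y₁ y₂ 11 ^ (j : ℕ), by
        rw [hcoords, ← map_pow]; exact hmem _⟩
    have hw' : LinearIndependent (Polynomial K) w :=
      LinearIndependent.of_comp (Submodule.subtype _) hw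
    have : Module.Finite (Polynomial K) (Submodule.span (Polynomial K) (Set.range B)) :=
      Module.Finite.span_of_finite _ (Set.finite_range B)
    refine le_trans (le_of_eq ?_) hw'.fintype_card_le_finrank
    simp only [Fintype.card_prod, Fintype.card_fin, hq]
    ring
  rw [injective_iff_map_eq_zero]
  intro r hr
  obtain ⟨p, rfl⟩ := exists_eq_sum_monomials r
  rw [heval] at hr
  have := Fintype.linearIndependent_iff.1 hB p hr
  simp [this]

/-- Both equations are solvable over the algebraic closure of K(x); as x is not integral over K,
some valuation ring omits it. -/
theorem exists_onCurve [CharP K 3] [Finite K] (m : ℕ) :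
    ∃ (x y₁ y₂ : AlgebraicClosure (RatFunc K))
      (v : ValuationSubring (AlgebraicClosure (RatFunc K))),
      OnCurve m x y₁ y₂ ∧ 1 < v.valuation x := by
  let x : AlgebraicClosure (RatFunc K) := algebraMap (RatFunc K) _ RatFunc.X
  have hroot : ∀ a : AlgebraicClosure (RatFunc K), ∃ y, y ^ 3 ^ (2 * m + 1) - y = a := by
    intro a
    let P : Polynomial (AlgebraicClosure (RatFunc K)) :=
      Polynomial.X ^ 3 ^ (2 * m + 1) - Polynomial.X - Polynomial.C a
    have hP : P.degree ≠ 0 := by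
      intro h0
      have h1 := Polynomial.natDegree_eq_zero_iff_degree_le_zero.2 h0.le
      rw [Polynomial.natDegree_sub_C, FiniteField.X_pow_card_sub_X_natDegree_eq _ one_lt_q] at h1
      exact absurd h1 (by positivity)
    obtain ⟨y, hy⟩ := IsAlgClosed.exists_root P hP
    refine ⟨y, ?_⟩
    simpa [P, sub_eq_zero] using hy
  obtain ⟨y₁, h₁⟩ := hroot (x ^ 3 ^ m * (x ^ 3 ^ (2 * m + 1) - x))
  obtain ⟨y₂, h₂⟩ := hroot (x ^ 3 ^ m * (y₁ ^ 3 ^ (2 * m + 1) - y₁))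
  have hx : ¬ IsIntegral K x := by
    intro hx
    have h1 : IsAlgebraic K (RatFunc.X : RatFunc K) :=
      (isAlgebraic_algebraMap_iff (algebraMap (RatFunc K)
        (AlgebraicClosure (RatFunc K))).injective).1 hx.isAlgebraic
    exact RatFunc.transcendental_X h1
  obtain ⟨V, hV⟩ := exists_valuationSubring_notMem hx
  exact ⟨x, y₁, y₂, V, ⟨h₁, h₂⟩, not_le.1 fun h => hV ((V.valuation_le_one_iff _).1 h)⟩

theorem isDomain_coordRing [CharP K 3] [Finite K] : IsDomain (CoordRing K m) := by
  obtain ⟨x, y₁, y₂, v, h, hx⟩ := exists_onCurve (K := K) m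
  have : CharP (AlgebraicClosure (RatFunc K)) 3 := charP_of_injective_algebraMap
    (algebraMap K (AlgebraicClosure (RatFunc K))).injective 3
  exact (evalHom_injective (K := K) h hx).isDomain (evalHom (K := K) h).toRingHom

theorem transcendental_cls [CharP K 3] [Finite K] : Transcendental K (cls K m 0) := by
  obtain ⟨x, y₁, y₂, v, h, hx⟩ := exists_onCurve (K := K) m
  have := isTrivialOn_of_finite (K := K) v.valuation
  have h1 : Transcendental K x := Valuation.transcendental_of_ne_one K x (v := v.valuation)
    (by rintro rfl; simp at hx) hx.ne'
  have h2 : evalHom (K := K) h (cls K m 0) = x := evalHom_cls (K := K) h 0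
  intro h0
  have h3 := h0.algHom (evalHom (K := K) h)
  rw [h2] at h3
  exact h1 h3

end CoordRing

/-! ### The place at the origin. -/

section Origin

variable {K : Type*} [Field K] {m : ℕ}

theorem onCurve_zero {A : Type*} [CommRing A] (m : ℕ) : OnCurve m (0 : A) 0 0 := by
  simp [OnCurve]

theorem sub_evalHom_zero_mem_span (r : CoordRing K m) :
    r - algebraMap K (CoordRing K m) (evalHom (onCurve_zero (A := K) m) r) ∈
      Ideal.span {cls K m 0, cls K m 1, cls K m 2} := by
  obtain ⟨P, rfl⟩ := Ideal.Quotient.mk_surjective r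
  have hcls : ∀ i, cls K m i ∈ Ideal.span {cls K m 0, cls K m 1, cls K m 2} := by
    intro i
    apply Ideal.subset_span
    fin_cases i <;> simp
  induction P using MvPolynomial.induction_on with
  | C a =>
    have h : Ideal.Quotient.mk (ideal K m) (MvPolynomial.C a) = algebraMap K (CoordRing K m) a :=
      rfl
    rw [h, AlgHom.commutes, Algebra.algebraMap_self, RingHom.id_apply, sub_self]
    exact Ideal.zero_mem _
  | add p q hp hq =>
    rw [map_add, map_add, map_add]
    convert Ideal.add_mem _ hp hq using 1
    ring
  | mul_X p i hp =>
    have h : evalHom (onCurve_zero (A := K) m) (cls K m i) = 0 := by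
      rw [evalHom_cls]; fin_cases i <;> rfl
    rw [map_mul]
    change _ * cls K m i - _ ∈ _
    rw [map_mul]
    change _ * cls K m i - algebraMap K _ (_ * evalHom (onCurve_zero (A := K) m) (cls K m i)) ∈ _
    rw [h, mul_zero, map_zero, sub_zero]
    exact Ideal.mul_mem_left _ _ (hcls i)

variable {F : Type*} [Field F] [Algebra K F] [Algebra (CoordRing K m) F]
  [IsFractionRing (CoordRing K m) F] [IsScalarTower K (CoordRing K m) F]

/-- The maximal ideal of the origin. -/
noncomputable def originIdeal (K : Type*) [Field K] (m : ℕ) : Ideal (CoordRing K m) :=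
  RingHom.ker (evalHom (onCurve_zero (A := K) m))

instance : (originIdeal K m).IsPrime := RingHom.ker_isPrime _

/-- A valuation ring is centred at the origin if `x`, `y₁`, `y₂` belong to its maximal ideal. -/
def CentredAtOrigin (K : Type*) [Field K] (m : ℕ) {F : Type*} [Field F] [Algebra (CoordRing K m) F]
    (V : ValuationSubring F) : Prop :=
  ∀ i, V.valuation (algebraMap (CoordRing K m) F (cls K m i)) < 1

theorem originIdeal_le (K : Type*) [Field K] (m : ℕ) (F : Type*) [Field F]
    [Algebra (CoordRing K m) F] [IsFractionRing (CoordRing K m) F] : (originIdeal K m).primeCompl ≤ nonZeroDivisors (CoordRing K m) := by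
  have : IsDomain (CoordRing K m) :=
    (IsFractionRing.injective (CoordRing K m) F).isDomain (algebraMap (CoordRing K m) F)
  exact Ideal.primeCompl_le_nonZeroDivisors _

/-- In the local ring of the origin, `x` generates the maximal ideal. -/
theorem exists_mul_of_mem_originIdeal {r : CoordRing K m} (hr : r ∈ originIdeal K m) :
    ∃ s ∉ originIdeal K m, ∃ c, s * r = cls K m 0 * c := by
  obtain ⟨h₁, h₂⟩ := onCurve_cls K m
  set q := 3 ^ (2 * m + 1) with hq
  have hq1 : 1 < q := one_lt_q
  obtain ⟨k, hk⟩ : ∃ k, 3 ^ m = k + 1 := ⟨3 ^ m - 1, by have := Nat.one_le_pow m 3; omega⟩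
  have h3 : ∀ i, evalHom (onCurve_zero (A := K) m) (cls K m i) = 0 := by
    intro i; rw [evalHom_cls]; fin_cases i <;> rfl
  -- For y = y₁, y₂ the product (y^(q-1) - 1) y = y^q - y is divisible by x on the curve, while
  -- y^(q-1) - 1 is a unit at the origin.
  have hs : ∀ i, cls K m i ^ (q - 1) - 1 ∉ originIdeal K m := by
    intro i h
    rw [originIdeal, RingHom.mem_ker, map_sub, map_pow, h3, zero_pow (by omega)] at h
    simp at h
  have hpow : ∀ a : CoordRing K m, (a ^ (q - 1) - 1) * a = a ^ q - a := by
    intro a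
    rw [sub_mul, ← pow_succ, one_mul, Nat.sub_add_cancel hq1.le]
  have h := sub_evalHom_zero_mem_span r
  rw [RingHom.mem_ker.1 hr, map_zero, sub_zero] at h
  obtain ⟨a, b, hb, rfl⟩ := Ideal.mem_span_insert.1 h
  obtain ⟨b₁, c, rfl⟩ := Ideal.mem_span_pair.1 hb
  refine ⟨(cls K m 1 ^ (q - 1) - 1) * (cls K m 2 ^ (q - 1) - 1),
    (originIdeal K m).primeCompl.mul_mem (hs 1) (hs 2), ?_⟩
  rw [hk, pow_succ'] at h₁ h₂
  refine ⟨(cls K m 1 ^ (q - 1) - 1) * (cls K m 2 ^ (q - 1) - 1) * a +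
    (cls K m 2 ^ (q - 1) - 1) * b₁ * (cls K m 0 ^ k * (cls K m 0 ^ q - cls K m 0)) +
    (cls K m 1 ^ (q - 1) - 1) * c * (cls K m 0 ^ k * (cls K m 1 ^ q - cls K m 1)), ?_⟩
  linear_combination (cls K m 2 ^ (q - 1) - 1) * b₁ * (hpow (cls K m 1) + h₁) +
    (cls K m 1 ^ (q - 1) - 1) * c * (hpow (cls K m 2) + h₂)

variable (K m F) in
/-- The local ring of the origin. -/
noncomputable def originRing : Subalgebra (CoordRing K m) F :=
  Localization.subalgebra.ofField F (originIdeal K m).primeCompl (originIdeal_le K m F)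

theorem mem_originRing {f : F} : f ∈ originRing K m F ↔ ∃ a s : CoordRing K m,
    s ∉ originIdeal K m ∧ f = algebraMap _ F a * (algebraMap _ F s)⁻¹ := by
  change (∃ (a s : CoordRing K m) (_ : s ∈ (originIdeal K m).primeCompl), _) ↔ _
  simp only [exists_prop]
  rfl

/-- A Noetherian local domain with principal maximal ideal is a valuation ring. -/
theorem mem_or_inv_mem_originRing (f : F) : f ∈ originRing K m F ∨ f⁻¹ ∈ originRing K m F := by
  have hd : IsDomain (CoordRing K m) :=
    (IsFractionRing.injective (CoordRing K m) F).isDomain (algebraMap (CoordRing K m) F)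
  have : IsLocalization.AtPrime (originRing K m F) (originIdeal K m) :=
    Localization.subalgebra.isLocalization_ofField F _ (originIdeal_le K m F)
  have : IsLocalRing (originRing K m F) :=
    IsLocalization.AtPrime.isLocalRing (originRing K m F) (originIdeal K m)
  have : IsNoetherianRing (originRing K m F) :=
    IsLocalization.isNoetherianRing (originIdeal K m).primeCompl _ inferInstance
  have hp : (IsLocalRing.maximalIdeal (originRing K m F)).IsPrincipal := by
    refine ⟨algebraMap _ _ (cls K m 0), ?_⟩
    rw [← IsLocalization.AtPrime.map_eq_maximalIdeal (originIdeal K m) (originRing K m F)]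
    apply le_antisymm
    · rw [Ideal.map_le_iff_le_comap]
      intro r hr
      obtain ⟨s, hs, c, hc⟩ := exists_mul_of_mem_originIdeal hr
      have hu : IsUnit (algebraMap (CoordRing K m) (originRing K m F) s) :=
        IsLocalization.map_units (originRing K m F)
          (⟨s, hs⟩ : (originIdeal K m).primeCompl)
      rw [Ideal.mem_comap]
      change _ ∈ Ideal.span _
      rw [Ideal.mem_span_singleton, ← hu.dvd_mul_left, ← map_mul, hc, map_mul]
      exact dvd_mul_right _ _
    · change Ideal.span _ ≤ _
      rw [Ideal.span_singleton_le_iff_mem]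
      apply Ideal.mem_map_of_mem
      rw [originIdeal, RingHom.mem_ker, evalHom_cls]
      rfl
  have hval : ValuationRing (originRing K m F) :=
    ((tfae_of_isNoetherianRing_of_isLocalRing_of_isDomain (originRing K m F)).out 4 1).1 hp
  rcases ValuationRing.isInteger_or_isInteger (originRing K m F) f with ⟨a, ha⟩ | ⟨a, ha⟩
  · left; rw [← ha]; exact a.2
  · right; rw [← ha]; exact a.2

variable [Finite K]

theorem CentredAtOrigin.valuation_lt_one_of_mem {V : ValuationSubring F}
    (hV : CentredAtOrigin K m V) {r : CoordRing K m} (hr : r ∈ originIdeal K m) :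
    V.valuation (algebraMap (CoordRing K m) F r) < 1 := by
  have h := sub_evalHom_zero_mem_span r
  rw [RingHom.mem_ker.1 hr, map_zero, sub_zero] at h
  have key : ∀ s : CoordRing K m, V.valuation (algebraMap (CoordRing K m) F s) ≤ 1 := by
    intro s
    obtain ⟨P, rfl⟩ := Ideal.Quotient.mk_surjective s
    induction P using MvPolynomial.induction_on with
    | C a =>
      have h : Ideal.Quotient.mk (ideal K m) (MvPolynomial.C a) =
        algebraMap K (CoordRing K m) a := rfl
      rw [h, ← IsScalarTower.algebraMap_apply]
      by_cases ha : a = 0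
      · simp [ha]
      · exact (valuation_algebraMap_eq_one _ ha).le
    | add p q hp hq =>
      rw [map_add, map_add]
      exact (V.valuation.map_add _ _).trans (max_le hp hq)
    | mul_X p i hp =>
      rw [map_mul, map_mul, map_mul]
      exact mul_le_one' hp (hV i).le
  rw [show ({cls K m 0, cls K m 1, cls K m 2} : Set (CoordRing K m)) = Set.range (cls K m) by
    ext r; simp [Fin.exists_fin_succ, eq_comm]] at h
  obtain ⟨c, rfl⟩ := Ideal.mem_span_range_iff_exists_fun.1 h
  rw [map_sum]
  refine V.valuation.map_sum_lt one_ne_zero fun i _ => ?_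
  rw [map_mul, map_mul]
  exact (mul_le_of_le_one_left' (key _)).trans_lt (hV i)

theorem CentredAtOrigin.valuation_eq_one_of_notMem {V : ValuationSubring F}
    (hV : CentredAtOrigin K m V) {r : CoordRing K m} (hr : r ∉ originIdeal K m) :
    V.valuation (algebraMap (CoordRing K m) F r) = 1 := by
  set c := evalHom (onCurve_zero (A := K) m) r with hc
  have h1 : r - algebraMap K (CoordRing K m) c ∈ originIdeal K m := by
    simp [originIdeal, RingHom.mem_ker, hc]
  have h2 := hV.valuation_lt_one_of_mem h1
  rw [map_sub, ← IsScalarTower.algebraMap_apply] at h2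
  have h3 := valuation_algebraMap_eq_one V.valuation (c := c) hr
  rw [← h3] at h2
  rw [← h3, ← V.valuation.map_add_eq_of_lt_left h2, add_sub_cancel]

namespace CentredAtOrigin

variable {V : ValuationSubring F}

/-- `V` dominates the local ring of the origin, and a valuation ring is maximal for domination. -/
theorem mem_iff (hV : CentredAtOrigin K m V) {f : F} : f ∈ V ↔ f ∈ originRing K m F := by
  have hle : ∀ g ∈ originRing K m F, g ∈ V := by
    intro g hg
    obtain ⟨a, s, hs, rfl⟩ := mem_originRing.1 hg
    rw [← V.valuation_le_one_iff, map_mul, map_inv₀, hV.valuation_eq_one_of_notMem hs, inv_one,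
      mul_one]
    by_cases ha : a ∈ originIdeal K m
    · exact (hV.valuation_lt_one_of_mem ha).le
    · exact (hV.valuation_eq_one_of_notMem ha).le
  refine ⟨fun hf => ?_, hle f⟩
  by_contra hne
  obtain ⟨a, s, hs, h⟩ := mem_originRing.1 ((mem_or_inv_mem_originRing f).resolve_left hne)
  have ha : a ∈ originIdeal K m := by
    by_contra ha
    refine hne (mem_originRing.2 ⟨s, a, ha, ?_⟩)
    rw [← inv_inv f, h, mul_inv, inv_inv, mul_comm]
  have h1 : V.valuation f⁻¹ < 1 := by
    rw [h, map_mul, map_inv₀, hV.valuation_eq_one_of_notMem hs, inv_one, mul_one]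
    exact hV.valuation_lt_one_of_mem ha
  have hf0 : f ≠ 0 := by
    rintro rfl; exact hne (Subalgebra.zero_mem _)
  rw [map_inv₀] at h1
  have := (V.valuation_le_one_iff f).2 hf
  rw [inv_lt_one₀ (zero_lt_iff.2 (V.valuation.ne_zero_iff.2 hf0))] at h1
  exact absurd this (not_le.2 h1)

theorem eq (hV : CentredAtOrigin K m V) {W : ValuationSubring F} (hW : CentredAtOrigin K m W) :
    V = W := by
  ext f
  rw [hV.mem_iff, hW.mem_iff]

/-- x generates the maximal ideal. -/
theorem valuation_le (hV : CentredAtOrigin K m V) {f : F} (hf : V.valuation f < 1) :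
    V.valuation f ≤ V.valuation (algebraMap _ F (cls K m 0)) := by
  obtain ⟨a, s, hs, rfl⟩ := mem_originRing.1 (hV.mem_iff.1 ((V.valuation_le_one_iff f).1 hf.le))
  rw [map_mul, map_inv₀, hV.valuation_eq_one_of_notMem hs, inv_one, mul_one] at hf ⊢
  have ha : a ∈ originIdeal K m := by
    by_contra ha
    exact hf.ne (hV.valuation_eq_one_of_notMem ha)
  obtain ⟨t, ht, c, hc⟩ := exists_mul_of_mem_originIdeal ha
  have h1 := congrArg (fun r => V.valuation (algebraMap _ F r)) hc
  simp only [map_mul, hV.valuation_eq_one_of_notMem ht, one_mul] at h1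
  rw [h1]
  apply mul_le_of_le_one_right'
  by_cases hc : c ∈ originIdeal K m
  · exact (hV.valuation_lt_one_of_mem hc).le
  · exact (hV.valuation_eq_one_of_notMem hc).le

/-- The residue field at the origin is K; the constant is the quotient of the values of numerator
and denominator there. -/
theorem exists_sub_lt_one (hV : CentredAtOrigin K m V) {f : F} (hf : f ∈ V) :
    ∃ c : K, V.valuation (f - algebraMap K F c) < 1 := by
  obtain ⟨a, s, hs, rfl⟩ := mem_originRing.1 (hV.mem_iff.1 hf)
  set e := evalHom (K := K) (onCurve_zero (A := K) m) with he
  have hs0 : e s ≠ 0 := hs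
  refine ⟨e a / e s, ?_⟩
  have hsF : algebraMap (CoordRing K m) F s ≠ 0 := fun h0 => by
    have := hV.valuation_eq_one_of_notMem hs
    rw [h0, map_zero] at this
    exact zero_ne_one this
  have h1 : algebraMap _ F a * (algebraMap _ F s)⁻¹ - algebraMap K F (e a / e s) =
      algebraMap _ F (a - algebraMap K _ (e a / e s) * s) * (algebraMap _ F s)⁻¹ := by
    rw [map_sub, map_mul, ← IsScalarTower.algebraMap_apply]
    field_simp
  rw [h1, map_mul, map_inv₀, hV.valuation_eq_one_of_notMem hs, inv_one, mul_one]
  apply hV.valuation_lt_one_of_mem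
  change e _ = 0
  rw [map_sub, map_mul, AlgHom.commutes, Algebra.algebraMap_self, RingHom.id_apply]
  field_simp
  ring

end CentredAtOrigin

end Origin

/-! ### Translations and scalings of flags. -/

section Transformations

/-- The matrix of the translation `x ↦ x + b`, `y₁ ↦ y₁ + B x + c`, `y₂ ↦ y₂ - B y₁ + B² x + d`,
where `B = b ^ q₀`, `C = c ^ q₀`, `D = d ^ q₀`. -/
def transMatrix {A : Type*} [CommRing A] (b B c C d D : A) : Matrix (Fin 14) (Fin 14) A :=
  !![1, 0, 0, 0, 0, 0, 0, 0, 0, 0, 0, 0, 0, 0;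
        b, 1, 0, 0, 0, 0, 0, 0, 0, 0, 0, 0, 0, 0;
        c, B, 1, 0, 0, 0, 0, 0, 0, 0, 0, 0, 0, 0;
        d, B ^ 2, -B, 1, 0, 0, 0, 0, 0, 0, 0, 0, 0, 0;
        b * B ^ 3 - C ^ 3, B ^ 3, 0, 0, 1, 0, 0, 0, 0, 0, 0, 0, 0, 0;
        b * C ^ 3 - D ^ 3, C ^ 3, 0, 0, b, 1, 0, 0, 0, 0, 0, 0, 0, 0;
        -b ^ 3 * B ^ 3 + b * D ^ 3 + c ^ 3, D ^ 3, 0, 0, b ^ 2, -b, 1, 0, 0, 0, 0, 0, 0, 0;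
        -b * d + c ^ 2, -b * B ^ 2 - B * c - d, b * B - c, -b, 0, 0, 0, 1, 0, 0, 0, 0, 0, 0;
        -b * B ^ 3 * c + c * C ^ 3 + d ^ 2, -b * B ^ 4 - B ^ 3 * c - B ^ 2 * d + B * C ^ 3, -b *
      B ^ 3 + B * d + C ^ 3, -d, -c, -B, 0, B ^ 2, 1, 0, B, 0, 0, 0;
        -b ^ 3 * B ^ 6 - b * B ^ 3 * D ^ 3 + b * C ^ 6 + C ^ 3 * D ^ 3 + d ^ 3, -B ^ 3 * D ^ 3 +
      C ^ 6, 0, 0, -b ^ 2 * B ^ 3 - b * C ^ 3 - D ^ 3, b * B ^ 3 - C ^ 3, -B ^ 3, 0, 0, 1, 0, 0,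
      0, 0;
        -b ^ 2 * B ^ 3 - b * C ^ 3 + c * d - D ^ 3, b * B ^ 3 + B ^ 2 * c + B * d - C ^ 3, -B *
      c + d, c, 0, 0, 0, -B, 0, 0, 1, 0, 0, 0;
        -b ^ 4 * B ^ 6 - b ^ 3 * B ^ 3 * C ^ 3 - b * B ^ 3 * c ^ 3 + b * C ^ 3 * D ^ 3 - b * d ^
      3 + c ^ 3 * C ^ 3 + D ^ 6, -b ^ 3 * B ^ 6 - B ^ 3 * c ^ 3 + C ^ 3 * D ^ 3 - d ^ 3, 0, 0, b
      ^ 3 * B ^ 3 + b ^ 2 * C ^ 3 + b * D ^ 3 - c ^ 3, -b * C ^ 3 + D ^ 3, C ^ 3, 0, 0, -b, 0,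
      1, 0, 0;
        b ^ 2 * B ^ 3 * c + b * d ^ 2 + c ^ 2 * d - c * D ^ 3, b ^ 2 * B ^ 4 - b * B ^ 3 * c - b
      * B ^ 2 * d + B ^ 2 * c ^ 2 - B * c * d - B * D ^ 3 + d ^ 2, b ^ 2 * B ^ 3 + b * B * d - B
      * c ^ 2 - c * d - D ^ 3, -b * d + c ^ 2, -b * c, -b * B - c, -B, b * B ^ 2 + B * c + d, b,
      0, b * B - c, 0, 1, 0;
        b ^ 2 * B ^ 3 * d + b * B ^ 3 * c ^ 2 + b * C ^ 3 * d - c ^ 2 * C ^ 3 + c * d ^ 2 + d *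
      D ^ 3, b ^ 2 * B ^ 5 - b * B ^ 4 * c - b * B ^ 3 * d + b * B ^ 2 * C ^ 3 + B ^ 3 * c ^ 2 -
      B ^ 2 * c * d + B ^ 2 * D ^ 3 + B * c * C ^ 3 + B * d ^ 2 + C ^ 3 * d, -b ^ 2 * B ^ 4 - b
      * B ^ 3 * c - b * B * C ^ 3 + B * c * d - B * D ^ 3 + c * C ^ 3 + d ^ 2, b ^ 2 * B ^ 3 + b
      * C ^ 3 - c * d + D ^ 3, c ^ 2, -B * c, B ^ 2, b * B ^ 3 + B ^ 2 * c + B * d - C ^ 3, c,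
      0, B * c - d, 0, B, 1]

/-- The weights of the coordinate functions under `x ↦ a x`, where `B = a ^ q₀`. -/
def weights {A : Type*} [CommRing A] (a B : A) : Fin 14 → A :=
  ![1, a, a * B, a * B ^ 2, a * B ^ 3, a ^ 2 * B ^ 3, a ^ 3 * B ^ 3, a ^ 2 * B ^ 2, a ^ 2 * B ^ 4,
    a ^ 3 * B ^ 6, a ^ 2 * B ^ 3, a ^ 4 * B ^ 6, a ^ 3 * B ^ 4, a ^ 3 * B ^ 5]

variable {m : ℕ} {A : Type*} [CommRing A] {X x y₁ y₂ w₁ w₂ : A}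

theorem flagCoords_scale (a B x y₁ y₂ w₁ w₂ : A) :
    flagCoords (a * x) (a * B * y₁) (a * B ^ 2 * y₂) (a * B ^ 3 * w₁) (a ^ 2 * B ^ 3 * w₂) =
    (Matrix.diagonal (weights a B)).mulVec (flagCoords x y₁ y₂ w₁ w₂) := by
  funext i
  rw [Matrix.mulVec_diagonal]
  fin_cases i <;> simp [weights, flagCoords] <;> ring

theorem Flag.scale (h : Flag m X x y₁ y₂ w₁ w₂) {a B : A}
    (ha : a ^ 3 ^ m = B) (hB : B ^ (3 * 3 ^ m) = a) :
    Flag m (B * X) (a * x) (a * B * y₁) (a * B ^ 2 * y₂) (a * B ^ 3 * w₁)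
      (a ^ 2 * B ^ 3 * w₂) := by
  have hx := h.pow_x
  have h1 := h.pow_w₁
  have h2 := h.pow_w₂
  have k1 := h.pow_y₁
  have k2 := h.pow_y₂
  have p3 : ∀ a : A, (a ^ 3) ^ 3 ^ m = a ^ (3 * 3 ^ m) := fun a => (pow_mul _ _ _).symm
  have p2 : ∀ a : A, (a ^ 2) ^ (3 * 3 ^ m) = (a ^ (3 * 3 ^ m)) ^ 2 := fun a => pow_right_comm _ _ _
  have p2' : ∀ a : A, (a ^ 2) ^ (3 ^ m) = (a ^ (3 ^ m)) ^ 2 := fun a => pow_right_comm _ _ _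
  have la : a ^ (3 * 3 ^ m) = B ^ 3 := by rw [pow_t, ha]
  constructor
  · rw [mul_pow, hx, ha]
  · simp only [mul_pow, p3, h1, ha, hB]
    ring
  · simp only [mul_pow, p3, p2', h2, ha, hB]
    ring
  · simp only [mul_pow, la, k1, hB]
    ring
  · simp only [mul_pow, p2, la, k2, hB]
    ring

variable [CharP A 3]

theorem flagCoords_translate (b B c C d D x y₁ y₂ w₁ w₂ : A) :
    flagCoords (x + b) (y₁ + B * x + c) (y₂ - B * y₁ + B ^ 2 * x + d)
      (w₁ + B ^ 3 * x + b * B ^ 3 - C ^ 3) (w₂ + b * w₁ + C ^ 3 * x + b * C ^ 3 - D ^ 3) =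
    (transMatrix b B c C d D).mulVec (flagCoords x y₁ y₂ w₁ w₂) := by
  funext i
  simp only [Matrix.mulVec, dotProduct, Fin.sum_univ_succ, Fin.sum_univ_zero]
  fin_cases i <;> simp [transMatrix, flagCoords] <;> grind

/-- The paired hypotheses hold for elements of 𝔽_q with B = b^q₀, and so on: then B^t = b^q = b. -/
theorem Flag.translate (h : Flag m X x y₁ y₂ w₁ w₂) {b B c C d D : A}
    (hb : b ^ 3 ^ m = B) (hB : B ^ (3 * 3 ^ m) = b) (hc : c ^ 3 ^ m = C)
    (hC : C ^ (3 * 3 ^ m) = c) (hd : d ^ 3 ^ m = D) (hD : D ^ (3 * 3 ^ m) = d) :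
    Flag m (X + B) (x + b) (y₁ + B * x + c) (y₂ - B * y₁ + B ^ 2 * x + d)
      (w₁ + B ^ 3 * x + b * B ^ 3 - C ^ 3)
      (w₂ + b * w₁ + C ^ 3 * x + b * C ^ 3 - D ^ 3) := by
  have hx := h.pow_x
  have h1 := h.pow_w₁
  have h2 := h.pow_w₂
  have k1 := h.pow_y₁
  have k2 := h.pow_y₂
  have p3 : ∀ a : A, (a ^ 3) ^ 3 ^ m = a ^ (3 * 3 ^ m) := fun a => (pow_mul _ _ _).symm
  have p2 : ∀ a : A, (a ^ 2) ^ (3 * 3 ^ m) = (a ^ (3 * 3 ^ m)) ^ 2 := fun a => pow_right_comm _ _ _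
  have lx : x ^ (3 * 3 ^ m) = X ^ 3 := by rw [pow_t, hx]
  have lc : c ^ (3 * 3 ^ m) = C ^ 3 := by rw [pow_t, hc]
  have ld : d ^ (3 * 3 ^ m) = D ^ 3 := by rw [pow_t, hd]
  constructor
  · rw [add_pow_q₀, hx, hb]
  · simp only [add_pow_q₀, sub_pow_q₀, mul_pow, p3, hx, h1, hb, hB, hC]
    ring
  · simp only [add_pow_q₀, sub_pow_q₀, mul_pow, p3, hx, h1, h2, hb, hC, hD]
    clear * -
    grind
  · simp only [add_pow_t, mul_pow, lx, k1, hB, lc]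
    clear * -
    grind
  · simp only [add_pow_t, sub_pow_t, mul_pow, p2, lx, k1, k2, hB, ld]
    clear * -
    grind

end Transformations

/-! ### The inversion of flags and the zeros of w₈. -/

section Inversion

/-- The signed permutation which the inversion induces on the coordinate functions. -/
def invPerm {A : Type*} [CommRing A] (W : Fin 14 → A) : Fin 14 → A :=
  ![W 11, W 9, W 13, W 12, W 6, -W 5, W 4, W 8, W 7, W 1, -W 10, W 0, W 3, W 2]

theorem flag_rel_w₈ {A : Type*} [CommRing A] (x y₁ y₂ w₁ w₂ : A) {W : Fin 14 → A} (hW : flagCoords x y₁ y₂ w₁ w₂ = W) :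
    w₂ ^ 2 - W 6 * w₁ - W 9 * x = W 11 := by
  subst hW; simp only [flagCoords, Matrix.cons_val]; ring

variable {m : ℕ} {A : Type*} [CommRing A] [CharP A 3] (X x y₁ y₂ w₁ w₂ : A)

/-- This identity and the following ones for w₄, v, w₅, w₆, y₂, y₁ are the formulas of `flagCoords`
at (w₆, w₁₀, w₉, w₃, -w₂)/w₈ with denominators cleared. -/
theorem flag_rel_w₃ {W : Fin 14 → A} (hW : flagCoords x y₁ y₂ w₁ w₂ = W) :
    W 13 ^ 3 - W 9 ^ 2 * W 6 + W 9 * w₂ * W 11 = w₁ * W 11 ^ 2 := by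
  subst hW; simp only [flagCoords, Matrix.cons_val]; grind

theorem flag_rel_w₄ {W : Fin 14 → A} (hW : flagCoords x y₁ y₂ w₁ w₂ = W) :
    W 13 ^ 2 - W 9 * W 12 = W 8 * W 11 := by
  subst hW; simp only [flagCoords, Matrix.cons_val]; grind

theorem flag_rel_v {W : Fin 14 → A} (hW : flagCoords x y₁ y₂ w₁ w₂ = W) :
    W 13 * W 12 - W 9 * W 6 = -(W 10 - w₂) * W 11 := by
  subst hW; simp only [flagCoords, Matrix.cons_val]; grind

theorem flag_rel_w₅ {W : Fin 14 → A} (hW : flagCoords x y₁ y₂ w₁ w₂ = W) :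
    W 12 ^ 2 - W 13 * W 6 = W 7 * W 11 := by
  subst hW; simp only [flagCoords, Matrix.cons_val]; grind

theorem flag_rel_w₆ {W : Fin 14 → A} (hW : flagCoords x y₁ y₂ w₁ w₂ = W) :
    W 12 ^ 3 - W 9 * W 6 ^ 2 - W 6 * w₂ * W 11 = x * W 11 ^ 2 := by
  subst hW; simp only [flagCoords, Matrix.cons_val]; grind

theorem flag_rel_y₂ {W : Fin 14 → A} (hW : flagCoords x y₁ y₂ w₁ w₂ = W) :
    -W 13 * w₂ - W 12 * W 8 + W 13 * (W 10 - w₂) = y₂ * W 11 := by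
  subst hW; simp only [flagCoords, Matrix.cons_val]; grind

theorem flag_rel_y₁ {W : Fin 14 → A} (hW : flagCoords x y₁ y₂ w₁ w₂ = W) :
    -W 12 * (W 10 - w₂) + W 12 * w₂ + W 6 * W 8 = y₁ * W 11 := by
  subst hW; simp only [flagCoords, Matrix.cons_val]; grind

/-- On a flag this says w₃^q₀ w₈ = w₆^q₀ w₆ - w₈^q₀ w₁₀, which is the relation `pow_w₁` of the
inverted point. The next identity plays this role for `pow_w₂`. -/
theorem flag_rel_pow_w₁ {W : Fin 14 → A} (hW : flagCoords x y₁ y₂ w₁ w₂ = W) :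
    (X * y₂ - w₁) * W 11 = (X * (y₁ ^ 2 - x * y₂) + (y₁ * y₂ - x * w₁) - w₂) * W 9 -
      (X * (w₂ + (y₁ * y₂ - x * w₁)) + (y₂ ^ 2 - y₁ * w₁)) * W 13 := by
  subst hW; simp only [flagCoords, Matrix.cons_val]; grind

theorem flag_rel_pow_w₂ {W : Fin 14 → A} (hW : flagCoords x y₁ y₂ w₁ w₂ = W) :
    -(X * y₁ - y₂) * W 11 = (X * (y₁ ^ 2 - x * y₂) + (y₁ * y₂ - x * w₁) - w₂) * W 13 -
      (X * (w₂ + (y₁ * y₂ - x * w₁)) + (y₂ ^ 2 - y₁ * w₁)) * W 12 := by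
  subst hW; simp only [flagCoords, Matrix.cons_val]; grind

theorem flag_rel_w₅_w₂ {W : Fin 14 → A} (hW : flagCoords x y₁ y₂ w₁ w₂ = W) :
    y₂ * (X * (w₂ + (y₁ * y₂ - x * w₁)) + (y₂ ^ 2 - y₁ * w₁)) =
      -W 8 * (X * y₁ - y₂) - W 13 * X := by
  subst hW; simp only [flagCoords, Matrix.cons_val]; grind

theorem flag_rel_w₅_w₁ {W : Fin 14 → A} (hW : flagCoords x y₁ y₂ w₁ w₂ = W) :
    y₁ * (X * (w₂ + (y₁ * y₂ - x * w₁)) + (y₂ ^ 2 - y₁ * w₁)) =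
      W 12 * X - (X * x - y₁) * W 8 := by
  subst hW; simp only [flagCoords, Matrix.cons_val]; grind

namespace Flag

variable {X x y₁ y₂ w₁ w₂}

/-- These yield the relations `pow_y₁` and `pow_y₂` of the inverted point. -/
theorem pow_w₉_w₁₀ (h : Flag m X x y₁ y₂ w₁ w₂) {W : Fin 14 → A}
    (hW : flagCoords x y₁ y₂ w₁ w₂ = W) :
    W 13 ^ (3 * 3 ^ m) * W 11 = W 9 ^ (3 * 3 ^ m) * W 9 - W 6 * W 11 ^ (3 * 3 ^ m) ∧
    W 12 ^ (3 * 3 ^ m) * W 11 = W 9 * W 13 ^ (3 * 3 ^ m) + w₂ * W 11 ^ (3 * 3 ^ m) := by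
  have h6 : W 9 ^ (3 * 3 ^ m) = (X * (y₁ ^ 2 - x * y₂) + (y₁ * y₂ - x * w₁) - w₂) ^ 3 := by
    rw [pow_t, ← hW, h.pow_w₆]
  have h8 : W 11 ^ (3 * 3 ^ m) =
      (X * (w₂ + (y₁ * y₂ - x * w₁)) + (y₂ ^ 2 - y₁ * w₁)) ^ 3 := by
    rw [pow_t, ← hW, h.pow_w₈]
  have lx : x ^ (3 * 3 ^ m) = X ^ 3 := by rw [pow_t, h.pow_x]
  have l1 : w₁ ^ (3 * 3 ^ m) = (X * x - y₁) ^ 3 := by rw [pow_t, h.pow_w₁]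
  have l2 : w₂ ^ (3 * 3 ^ m) = (X * y₁ - y₂) ^ 3 := by rw [pow_t, h.pow_w₂]
  have h10 : W 13 ^ (3 * 3 ^ m) = (y₂ * (y₁ * y₂ - x * w₁) - y₂ * w₂ +
      w₁ * (y₁ ^ 2 - x * y₂)) ^ (3 * 3 ^ m) := by rw [← hW]; rfl
  have h9 : W 12 ^ (3 * 3 ^ m) = (y₁ * w₂ - y₂ * (y₁ ^ 2 - x * y₂) -
      y₁ * (y₁ * y₂ - x * w₁)) ^ (3 * 3 ^ m) := by rw [← hW]; rfl
  simp only [add_pow_t, sub_pow_t, mul_pow, pow_right_comm _ 2 (3 * 3 ^ m), lx, l1, l2,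
    h.pow_y₁, h.pow_y₂] at h9 h10
  rw [h6, h8, h9, h10]
  subst hW
  clear * -
  simp only [flagCoords, Matrix.cons_val]
  constructor <;> grind

end Flag

variable {L : Type*} [Field L] [CharP L 3] {X x y₁ y₂ w₁ w₂ : L}

theorem Flag.inversion (h : Flag m X x y₁ y₂ w₁ w₂) {W : Fin 14 → L}
    (hW : flagCoords x y₁ y₂ w₁ w₂ = W) (h8 : W 11 ≠ 0) :
    Flag m ((W 9 / W 11) ^ 3 ^ m) (W 9 / W 11) (W 13 / W 11) (W 12 / W 11) (W 6 / W 11)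
      (-w₂ / W 11) := by
  have e3 := h.pow_w₃
  have e6 := h.pow_w₆
  have e8 := h.pow_w₈
  rw [hW] at e3 e6 e8
  have r1 := flag_rel_pow_w₁ X x y₁ y₂ w₁ w₂ hW
  have r2 := flag_rel_pow_w₂ X x y₁ y₂ w₁ w₂ hW
  obtain ⟨r3, r4⟩ := h.pow_w₉_w₁₀ hW
  have hp := pow_ne_zero (3 ^ m) h8
  refine ⟨rfl, ?_, ?_, ?_, ?_⟩
  · rw [div_pow, div_pow]
    rw [← e3, ← e6, ← e8] at r1
    field_simp
    linear_combination r1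
  · have hn : (-w₂) ^ 3 ^ m = -(w₂ ^ 3 ^ m) := by
      rw [Odd.neg_pow (Odd.pow (by decide))]
    rw [div_pow, div_pow, hn, h.pow_w₂]
    rw [← e6, ← e8] at r2
    field_simp
    linear_combination r2
  · simp only [pow_t, div_pow] at r3 ⊢
    field_simp
    linear_combination r3
  · simp only [pow_t, div_pow] at r3 r4 ⊢
    field_simp
    linear_combination W 11 * r4 + W 9 * r3

theorem flagCoords_inversion {W : Fin 14 → L}
    (hW : flagCoords x y₁ y₂ w₁ w₂ = W) (h8 : W 11 ≠ 0) :
    flagCoords (W 9 / W 11) (W 13 / W 11) (W 12 / W 11) (W 6 / W 11) (-w₂ / W 11) =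
      (W 11)⁻¹ • invPerm W := by
  have hx : W 1 = x := by rw [← hW]; rfl
  have hy₁ : W 2 = y₁ := by rw [← hW]; rfl
  have hy₂ : W 3 = y₂ := by rw [← hW]; rfl
  have h1 : W 4 = w₁ := by rw [← hW]; rfl
  have h2 : W 5 = w₂ := by rw [← hW]; rfl
  have h0 : W 0 = 1 := by rw [← hW]; rfl
  have r3 : (W 13 / W 11) ^ 3 - (W 9 / W 11) ^ 2 * (W 6 / W 11) - (W 9 / W 11) * (-w₂ / W 11) =
      w₁ / W 11 := by
    have := flag_rel_w₃ x y₁ y₂ w₁ w₂ hW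
    field_simp
    linear_combination this
  have r4 : (W 13 / W 11) ^ 2 - (W 9 / W 11) * (W 12 / W 11) = W 8 / W 11 := by
    have := flag_rel_w₄ x y₁ y₂ w₁ w₂ hW
    field_simp
    linear_combination this
  have rv : (W 13 / W 11) * (W 12 / W 11) - (W 9 / W 11) * (W 6 / W 11) =
      -(W 10 - w₂) / W 11 := by
    have := flag_rel_v x y₁ y₂ w₁ w₂ hW
    field_simp
    linear_combination this
  have r5 : (W 12 / W 11) ^ 2 - (W 13 / W 11) * (W 6 / W 11) = W 7 / W 11 := by
    have := flag_rel_w₅ x y₁ y₂ w₁ w₂ hW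
    field_simp
    linear_combination this
  have r6 : (W 12 / W 11) ^ 3 - (W 9 / W 11) * (W 6 / W 11) ^ 2 + (W 6 / W 11) * (-w₂ / W 11) =
      x / W 11 := by
    have := flag_rel_w₆ x y₁ y₂ w₁ w₂ hW
    field_simp
    linear_combination this
  have r8 := flag_rel_w₈ x y₁ y₂ w₁ w₂ hW
  have r9 := flag_rel_y₂ x y₁ y₂ w₁ w₂ hW
  have r10 := flag_rel_y₁ x y₁ y₂ w₁ w₂ hW
  funext i
  simp only [flagCoords, r3, r4, rv, r5, r6, invPerm, Pi.smul_apply, smul_eq_mul]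
  fin_cases i
  all_goals simp only [Fin.reduceFinMk, Fin.zero_eta, Fin.mk_one, Fin.isValue, Matrix.cons_val, h0,
    h1, h2, hx, hy₁, hy₂]
  all_goals field_simp
  · ring
  · linear_combination r8
  · linear_combination r9
  · linear_combination r10

/-- The function `w₈` vanishes only at the origin. -/
theorem Flag.eq_zero_of_w₈_eq_zero (h : Flag m X x y₁ y₂ w₁ w₂) {W : Fin 14 → L}
    (hW : flagCoords x y₁ y₂ w₁ w₂ = W) (h8 : W 11 = 0) : x = 0 ∧ y₁ = 0 ∧ y₂ = 0 := by
  have hq : 3 ^ m ≠ 0 := by positivity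
  have e6 := h.pow_w₆
  have e8 := h.pow_w₈
  rw [hW] at e6 e8
  rw [h8, zero_pow hq] at e8
  have h9 : W 9 = 0 := by
    have r := flag_rel_pow_w₁ X x y₁ y₂ w₁ w₂ hW
    rw [← e6, ← e8, h8, ← pow_succ] at r
    have : W 9 ^ (3 ^ m + 1) = 0 := by linear_combination -r
    exact pow_eq_zero_iff (Nat.succ_ne_zero _) |>.1 this
  have h13 : W 13 = 0 := by
    have r := flag_rel_w₄ x y₁ y₂ w₁ w₂ hW
    rw [h9, h8] at r
    have : W 13 ^ 2 = 0 := by linear_combination r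
    exact pow_eq_zero_iff (Nat.succ_ne_zero _) |>.1 this
  have h12 : W 12 = 0 := by
    have r := flag_rel_w₅ x y₁ y₂ w₁ w₂ hW
    rw [h13, h8] at r
    have : W 12 ^ 2 = 0 := by linear_combination r
    exact pow_eq_zero_iff (Nat.succ_ne_zero _) |>.1 this
  rw [h9, zero_pow hq] at e6
  have r1 := flag_rel_w₅_w₁ X x y₁ y₂ w₁ w₂ hW
  have r2 := flag_rel_w₅_w₂ X x y₁ y₂ w₁ w₂ hW
  have r8 := flag_rel_w₈ x y₁ y₂ w₁ w₂ hW
  rw [← e8, h12] at r1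
  rw [← e8, h13] at r2
  rw [h8, h9] at r8
  have z1 : X * x - y₁ = 0 → w₁ = 0 := fun hz => by
    have := h.pow_w₁
    rw [hz] at this
    exact pow_eq_zero_iff hq |>.1 this
  have z2 : X * y₁ - y₂ = 0 → w₂ = 0 := fun hz => by
    have := h.pow_w₂
    rw [hz] at this
    exact pow_eq_zero_iff hq |>.1 this
  have d6 : W 6 = y₁ ^ 3 - x ^ 2 * w₁ - x * w₂ := by rw [← hW]; rfl
  have d8 : W 8 = y₂ ^ 2 - y₁ * w₁ := by rw [← hW]; rfl
  have d9 : W 9 = y₂ ^ 3 - x * w₁ ^ 2 + w₁ * w₂ := by rw [← hW]; rfl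
  have d12 : W 12 = y₁ * w₂ - y₂ * (y₁ ^ 2 - x * y₂) - y₁ * (y₁ * y₂ - x * w₁) := by
    rw [← hW]; rfl
  rw [h9] at d9
  rw [h12] at d12
  -- If w₅ ≠ 0 then `r1` forces w₁^q₀ = 0, so w₁ = 0; now w₆ = 0 gives y₂ = 0, and w₅ = y₂² - y₁w₁
  -- vanishes after all.
  have h5 : W 8 = 0 := by
    by_contra h5
    have a1 : X * x - y₁ = 0 := by
      have : (X * x - y₁) * W 8 = 0 := by linear_combination r1
      exact (mul_eq_zero.1 this).resolve_right h5
    have a2 : X * y₁ - y₂ = 0 := by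
      have : W 8 * (X * y₁ - y₂) = 0 := by linear_combination r2
      exact (mul_eq_zero.1 this).resolve_left h5
    rw [z1 a1] at d9 d8
    have : y₂ ^ 3 = 0 := by linear_combination -d9
    rw [pow_eq_zero_iff (by norm_num)] at this
    exact h5 (by rw [d8, this]; ring)
  rw [h5] at d8
  by_cases hX : X = 0
  · have hx : x = 0 := by
      have := h.pow_x
      rw [hX] at this
      exact pow_eq_zero_iff hq |>.1 this
    have k1 := h.pow_y₁
    subst hX hx
    have a : y₁ ^ 2 * y₂ = 0 := by linear_combination d12 + y₁ * e6
    rcases mul_eq_zero.1 a with a | a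
    · rw [pow_eq_zero_iff (by norm_num)] at a
      subst a
      have : y₂ ^ 2 = 0 := by linear_combination -d8
      exact ⟨rfl, rfl, pow_eq_zero_iff (by norm_num) |>.1 this⟩
    · subst a
      have : y₁ ^ (3 * 3 ^ m + 1) = 0 := by
        rw [pow_succ]
        linear_combination y₁ * k1 - d8
      exact ⟨rfl, pow_eq_zero_iff (Nat.succ_ne_zero _) |>.1 this, rfl⟩
  -- For X ≠ 0: w₇ = 0 follows from w₈^q₀ = 0, then w₄ w₂^q₀ = 0 forces w₂ = 0, and w₈ = 0 leaves w₃
  -- w₁ = 0. Either factor leads to w₁ = 0, which finishes by `fin`.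
  · have a1 : w₂ + (y₁ * y₂ - x * w₁) = 0 := by
      have : X * (w₂ + (y₁ * y₂ - x * w₁)) = 0 := by linear_combination d8 - e8
      exact (mul_eq_zero.1 this).resolve_left hX
    have a2 : X * (y₁ ^ 2 - x * y₂) = -w₂ := by
      clear * - e6 a1
      grind
    have a3 : (y₁ ^ 2 - x * y₂) * (X * y₁ - y₂) = 0 := by
      clear * - d12 a1 a2
      grind
    have a4 : w₂ = 0 := by
      rcases mul_eq_zero.1 a3 with a | a
      · linear_combination a2 - X * a
      · exact z2 a
    have a5 : X * y₁ - y₂ = 0 := by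
      rw [← h.pow_w₂, a4, zero_pow hq]
    have fin : w₁ = 0 → x = 0 ∧ y₁ = 0 ∧ y₂ = 0 := by
      intro hw
      have b1 : X * x - y₁ = 0 := by rw [← h.pow_w₁, hw, zero_pow hq]
      have b2 : X ^ 3 * x ^ 2 = 0 := by
        rw [hw, a4] at a1
        linear_combination a1 + X ^ 2 * x * b1 + y₁ * a5 + X * y₁ * b1
      have b3 : x = 0 := pow_eq_zero_iff (by norm_num) |>.1
        ((mul_eq_zero.1 b2).resolve_left (pow_ne_zero _ hX))
      subst b3
      have b4 : y₁ = 0 := by linear_combination -b1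
      subst b4
      exact ⟨rfl, rfl, by linear_combination -a5⟩
    have a6 : W 6 * w₁ = 0 := by rw [a4] at r8; linear_combination -r8
    rcases mul_eq_zero.1 a6 with a | a
    · have b1 : w₁ = X * y₂ := by
        have := h.pow_w₃
        rw [hW, a, zero_pow hq] at this
        linear_combination this
      have b2 : y₂ * (X * x - y₁) = 0 := by
        rw [a4, b1] at a1
        linear_combination -a1
      rcases mul_eq_zero.1 b2 with b | b
      · exact fin (by rw [b1, b, mul_zero])
      · exact fin (z1 b)
    · exact fin a

end Inversion

/-! ### The field with q elements. -/

section Card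

variable {K : Type*} [Field K] [Finite K] {m : ℕ}

theorem charP_three (hK : Nat.card K = 3 ^ (2 * m + 1)) : CharP K 3 := by
  have : Fintype K := Fintype.ofFinite K
  have : Fact (Nat.Prime 3) := ⟨Nat.prime_three⟩
  rw [Nat.card_eq_fintype_card] at hK
  exact charP_of_card_eq_prime_pow hK

theorem pow_q (hK : Nat.card K = 3 ^ (2 * m + 1)) (c : K) : c ^ 3 ^ (2 * m + 1) = c := by
  have : Fintype K := Fintype.ofFinite K
  rw [← hK, Nat.card_eq_fintype_card]
  exact FiniteField.pow_card c

theorem pow_q₀_pow_t (hK : Nat.card K = 3 ^ (2 * m + 1)) (c : K) :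
    (c ^ 3 ^ m) ^ (3 * 3 ^ m) = c := by
  rw [pow_right_comm, pow_t_q₀, pow_q hK]

/-- X^q - X is the product of all X - c with c ∈ K, so some factor of a^q - a has valuation below 1.
-/
theorem exists_valuation_sub_lt_one (hK : Nat.card K = 3 ^ (2 * m + 1)) {L Γ₀ : Type*} [Field L]
    [Algebra K L] [LinearOrderedCommGroupWithZero Γ₀] (v : Valuation L Γ₀) {a : L}
    (ha : v (a ^ 3 ^ (2 * m + 1) - a) < 1) : ∃ c : K, v (a - algebraMap K L c) < 1 := by
  have : Fintype K := Fintype.ofFinite K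
  have hK' : Fintype.card K = 3 ^ (2 * m + 1) := by rw [← hK, Nat.card_eq_fintype_card]
  have hmonic : (Polynomial.X ^ 3 ^ (2 * m + 1) - Polynomial.X : Polynomial K).Monic :=
    Polynomial.monic_X_pow_sub (by rw [Polynomial.degree_X]; exact_mod_cast one_lt_q)
  have hroots := FiniteField.roots_X_pow_card_sub_X K
  rw [hK'] at hroots
  have h := Polynomial.prod_multiset_X_sub_C_of_monic_of_roots_card_eq hmonic (by
    rw [hroots, FiniteField.X_pow_card_sub_X_natDegree_eq _ one_lt_q, ← hK']
    rfl)
  rw [hroots] at h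
  have h1 := congrArg (Polynomial.aeval a) h
  change Polynomial.aeval a (∏ c : K, (Polynomial.X - Polynomial.C c)) = _ at h1
  rw [map_prod] at h1
  simp only [map_sub, map_pow, Polynomial.aeval_X, Polynomial.aeval_C] at h1
  by_contra! hc
  rw [← h1, map_prod] at ha
  exact absurd ha (not_lt.2 (Finset.one_le_prod' fun c _ => hc c))

theorem exists_eq_algebraMap (hK : Nat.card K = 3 ^ (2 * m + 1)) {L : Type*} [Field L]
    [Algebra K L] {a : L} (ha : a ^ 3 ^ (2 * m + 1) = a) : ∃ c : K, a = algebraMap K L c := by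
  -- For the trivial valuation, being less than 1 means being zero.
  obtain ⟨c, hc⟩ := exists_valuation_sub_lt_one hK (⊤ : ValuationSubring L).valuation (a := a)
    (by rw [ha, sub_self, map_zero]; exact zero_lt_one)
  refine ⟨c, ?_⟩
  rw [← ValuationSubring.mem_nonunits_iff, ValuationSubring.mem_nonunits_iff_or] at hc
  rcases hc with hc | hc
  · exact sub_eq_zero.1 hc
  · exact absurd (ValuationSubring.mem_top _) hc

end Card

/-! ### Constructing automorphisms from points of the curve. -/

section Automorphisms

variable (K : Type*) [Field K] (m : ℕ) (F : Type*) [Field F] [Algebra (CoordRing K m) F]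

/-- The generators `x, y₁, y₂` in a field of fractions of the coordinate ring. -/
noncomputable def genF (i : Fin 3) : F := algebraMap (CoordRing K m) F (cls K m i)

/-- The fourteen coordinate functions in a field of fractions of the coordinate ring. -/
noncomputable def fnF : Fin 14 → F := coords m (genF K m F 0) (genF K m F 1) (genF K m F 2)

theorem onCurve_genF : OnCurve m (genF K m F 0) (genF K m F 1) (genF K m F 2) := by
  obtain ⟨h₁, h₂⟩ := onCurve_cls K m
  constructor
  · simpa [genF] using congrArg (algebraMap (CoordRing K m) F) h₁
  · simpa [genF] using congrArg (algebraMap (CoordRing K m) F) h₂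

theorem map_coords {A B : Type*} [CommRing A] [CommRing B] (f : A →+* B) (x y₁ y₂ : A)
    (i : Fin 14) : f (coords m x y₁ y₂ i) = coords m (f x) (f y₁) (f y₂) i := by
  fin_cases i <;> simp [coords]

variable {K m F} [Algebra K F] [IsFractionRing (CoordRing K m) F]
  [IsScalarTower K (CoordRing K m) F]

theorem algHom_ext_genF {L : Type*} [Field L] [Algebra K L] {f g : F →ₐ[K] L}
    (h : ∀ i, f (genF K m F i) = g (genF K m F i)) : f = g := by
  have h1 : f.comp (IsScalarTower.toAlgHom K (CoordRing K m) F) =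
      g.comp (IsScalarTower.toAlgHom K (CoordRing K m) F) := algHom_ext_cls h
  have h2 : (f : F →+* L) = g :=
    IsFractionRing.ringHom_ext (A := CoordRing K m) fun r => DFunLike.congr_fun h1 r
  ext a
  exact DFunLike.congr_fun h2 a

variable [Finite K]

theorem transcendental_genF [CharP K 3] : Transcendental K (genF K m F 0) := by
  rw [genF, transcendental_algebraMap_iff (IsFractionRing.injective (CoordRing K m) F)]
  exact transcendental_cls

/-- A curve point over F with transcendental first coordinate has a valuation with a pole there, so
evaluation at it is injective and extends to fractions. -/
theorem exists_algHom [CharP F 3] {x y₁ y₂ : F} (h : OnCurve m x y₁ y₂)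
    (hx : Transcendental K x) :
    ∃ f : F →ₐ[K] F, f (genF K m F 0) = x ∧ f (genF K m F 1) = y₁ ∧ f (genF K m F 2) = y₂ := by
  obtain ⟨V, hV⟩ := exists_valuationSubring_notMem (K := K) (a := x)
    (fun h => hx h.isAlgebraic)
  have hV' : 1 < V.valuation x := not_le.1 fun h => hV ((V.valuation_le_one_iff _).1 h)
  have hinj := evalHom_injective (K := K) h hV'
  refine ⟨IsFractionRing.liftAlgHom hinj, ?_, ?_, ?_⟩ <;>
  · rw [IsFractionRing.liftAlgHom_apply, genF, IsFractionRing.lift_algebraMap]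
    exact evalHom_cls h _

/-- `H` says that the endomorphisms attached to the two points are mutually inverse on generators.
-/
theorem exists_algEquiv [CharP F 3] {x y₁ y₂ x' y₁' y₂' : F} (h : OnCurve m x y₁ y₂)
    (hx : Transcendental K x) (h' : OnCurve m x' y₁' y₂') (hx' : Transcendental K x')
    (H : ∀ f f' : F →ₐ[K] F,
      f (genF K m F 0) = x → f (genF K m F 1) = y₁ → f (genF K m F 2) = y₂ →
      f' (genF K m F 0) = x' → f' (genF K m F 1) = y₁' → f' (genF K m F 2) = y₂' →
      (f x' = genF K m F 0 ∧ f y₁' = genF K m F 1 ∧ f y₂' = genF K m F 2) ∧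
      (f' x = genF K m F 0 ∧ f' y₁ = genF K m F 1 ∧ f' y₂ = genF K m F 2)) :
    ∃ σ : F ≃ₐ[K] F,
      σ (genF K m F 0) = x ∧ σ (genF K m F 1) = y₁ ∧ σ (genF K m F 2) = y₂ := by
  obtain ⟨f, f0, f1, f2⟩ := exists_algHom (m := m) h hx
  obtain ⟨f', f0', f1', f2'⟩ := exists_algHom (m := m) h' hx'
  obtain ⟨⟨a0, a1, a2⟩, b0, b1, b2⟩ := H f f' f0 f1 f2 f0' f1' f2'
  refine ⟨AlgEquiv.ofAlgHom f f' (algHom_ext_genF (m := m) fun i => ?_) (algHom_ext_genF (m := m) fun i => ?_),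
    f0, f1, f2⟩
  · fin_cases i
    · exact (congrArg f f0').trans a0
    · exact (congrArg f f1').trans a1
    · exact (congrArg f f2').trans a2
  · fin_cases i
    · exact (congrArg f' f0).trans b0
    · exact (congrArg f' f1).trans b1
    · exact (congrArg f' f2).trans b2

variable (K m F) in
theorem charP_field [CharP K 3] : CharP F 3 :=
  charP_of_injective_algebraMap (algebraMap K F).injective 3

/-- The translation automorphisms. -/
def IsTranslation (σ : F ≃ₐ[K] F) (b c d : K) : Prop :=
  σ (genF K m F 0) = genF K m F 0 + algebraMap K F b ∧
  σ (genF K m F 1) =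
    genF K m F 1 + algebraMap K F (b ^ 3 ^ m) * genF K m F 0 + algebraMap K F c ∧
  σ (genF K m F 2) = genF K m F 2 - algebraMap K F (b ^ 3 ^ m) * genF K m F 1 +
    algebraMap K F (b ^ 3 ^ m) ^ 2 * genF K m F 0 + algebraMap K F d

/-- The scaling automorphisms. -/
def IsScaling (σ : F ≃ₐ[K] F) (a : K) : Prop :=
  σ (genF K m F 0) = algebraMap K F a * genF K m F 0 ∧
  σ (genF K m F 1) = algebraMap K F a * algebraMap K F (a ^ 3 ^ m) * genF K m F 1 ∧
  σ (genF K m F 2) = algebraMap K F a * algebraMap K F (a ^ 3 ^ m) ^ 2 * genF K m F 2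

/-- The inversion. -/
def IsInversion (σ : F ≃ₐ[K] F) : Prop :=
  ∀ i, fnF K m F 11 * σ (fnF K m F i) = invPerm (fnF K m F) i

theorem translate_flag (hK : Nat.card K = 3 ^ (2 * m + 1)) {L : Type*} [Field L] [Algebra K L]
    [CharP L 3] {X x y₁ y₂ w₁ w₂ : L} (h : Flag m X x y₁ y₂ w₁ w₂) (b c d : K) :
    Flag m (X + algebraMap K L (b ^ 3 ^ m)) (x + algebraMap K L b)
      (y₁ + algebraMap K L (b ^ 3 ^ m) * x + algebraMap K L c)
      (y₂ - algebraMap K L (b ^ 3 ^ m) * y₁ + algebraMap K L (b ^ 3 ^ m) ^ 2 * x +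
        algebraMap K L d)
      (w₁ + algebraMap K L (b ^ 3 ^ m) ^ 3 * x + algebraMap K L b * algebraMap K L (b ^ 3 ^ m) ^ 3
        - algebraMap K L (c ^ 3 ^ m) ^ 3)
      (w₂ + algebraMap K L b * w₁ + algebraMap K L (c ^ 3 ^ m) ^ 3 * x +
        algebraMap K L b * algebraMap K L (c ^ 3 ^ m) ^ 3 - algebraMap K L (d ^ 3 ^ m) ^ 3) :=
  h.translate (b := algebraMap K L b) (B := algebraMap K L (b ^ 3 ^ m)) (c := algebraMap K L c)
    (C := algebraMap K L (c ^ 3 ^ m)) (d := algebraMap K L d) (D := algebraMap K L (d ^ 3 ^ m))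
    (map_pow _ _ _).symm (by rw [← map_pow, pow_q₀_pow_t hK]) (map_pow _ _ _).symm
    (by rw [← map_pow, pow_q₀_pow_t hK]) (map_pow _ _ _).symm
    (by rw [← map_pow, pow_q₀_pow_t hK])

theorem scale_flag (hK : Nat.card K = 3 ^ (2 * m + 1)) {L : Type*} [Field L] [Algebra K L]
    {X x y₁ y₂ w₁ w₂ : L} (h : Flag m X x y₁ y₂ w₁ w₂) (a : K) :
    Flag m (algebraMap K L (a ^ 3 ^ m) * X) (algebraMap K L a * x)
      (algebraMap K L a * algebraMap K L (a ^ 3 ^ m) * y₁)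
      (algebraMap K L a * algebraMap K L (a ^ 3 ^ m) ^ 2 * y₂)
      (algebraMap K L a * algebraMap K L (a ^ 3 ^ m) ^ 3 * w₁)
      (algebraMap K L a ^ 2 * algebraMap K L (a ^ 3 ^ m) ^ 3 * w₂) :=
  h.scale (a := algebraMap K L a) (B := algebraMap K L (a ^ 3 ^ m))
    (map_pow _ _ _).symm (by rw [← map_pow, pow_q₀_pow_t hK])

theorem exists_isTranslation (hK : Nat.card K = 3 ^ (2 * m + 1)) (b c d : K) :
    ∃ σ : F ≃ₐ[K] F, IsTranslation (m := m) σ b c d := by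
  have := charP_three hK
  have := charP_field K F
  have hflag := Flag.of_onCurve (onCurve_genF K m F)
  have htr : ∀ b : K, Transcendental K (genF K m F 0 + algebraMap K F b) := by
    intro b h
    have := h.sub (isAlgebraic_algebraMap b)
    rw [add_sub_cancel_right] at this
    exact transcendental_genF (m := m) this
  set B := b ^ 3 ^ m with hB
  have hBn : (-b) ^ 3 ^ m = -B := by rw [Odd.neg_pow (Odd.pow (by decide))]
  have h3 : (3 : F) = 0 := by exact_mod_cast CharP.cast_eq_zero F 3
  -- The second point carries the parameters of the inverse translation, obtained by solving for x,
  -- y₁, y₂ in turn.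
  refine exists_algEquiv (translate_flag hK hflag b c d).onCurve (htr b)
    (translate_flag hK hflag (-b) (B * b - c) (-d - B * c - B ^ 2 * b)).onCurve (htr (-b)) ?_
  intro f f' f0 f1 f2 f0' f1' f2'
  simp only [map_add, map_sub, map_mul, map_pow, map_neg, AlgHom.commutes, f0, f1, f2, f0', f1',
    f2', ← hB, hBn]
  refine ⟨⟨by ring, by ring, ?_⟩, by ring, by ring, ?_⟩
  · linear_combination (algebraMap K F B) ^ 2 * genF K m F 0 * h3
  · linear_combination (algebraMap K F B) ^ 2 * (genF K m F 0 - algebraMap K F b) * h3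

theorem exists_isScaling (hK : Nat.card K = 3 ^ (2 * m + 1)) {a : K} (ha : a ≠ 0) :
    ∃ σ : F ≃ₐ[K] F, IsScaling (m := m) σ a := by
  have := charP_three hK
  have := charP_field K F
  have hflag := Flag.of_onCurve (onCurve_genF K m F)
  have htr : ∀ b : K, b ≠ 0 → Transcendental K (algebraMap K F b * genF K m F 0) := by
    intro b hb h
    have := (isAlgebraic_algebraMap (A := F) b⁻¹).mul h
    rw [← mul_assoc, ← map_mul, inv_mul_cancel₀ hb, map_one, one_mul] at this
    exact transcendental_genF (m := m) this
  have haF : algebraMap K F a ≠ 0 := (map_ne_zero _).2 ha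
  refine exists_algEquiv (scale_flag hK hflag a).onCurve (htr a ha)
    (scale_flag hK hflag a⁻¹).onCurve (htr a⁻¹ (inv_ne_zero ha)) ?_
  intro f f' f0 f1 f2 f0' f1' f2'
  simp only [map_mul, map_pow, map_inv₀, AlgHom.commutes, f0, f1, f2, f0', f1', f2', inv_pow]
  refine ⟨⟨?_, ?_, ?_⟩, ?_, ?_, ?_⟩ <;> field_simp

end Automorphisms

/-! ### Places of the Ree function field. -/

section Classification

theorem poleOrder_lt (s : ℕ) (hs : 1 ≤ s) {i : Fin 14} (hi : i ≠ 11) :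
    poleOrder s i < poleOrder s 11 := by
  fin_cases i <;> simp [poleOrder] at hi ⊢ <;> nlinarith [sq_nonneg s, Nat.zero_le (s ^ 3)]

variable {K : Type*} [Field K] {m : ℕ} {F : Type*} [Field F] [Algebra K F]

/-- The preimage of a valuation ring under an automorphism. -/
def pull (V : ValuationSubring F) (σ : F ≃ₐ[K] F) : ValuationSubring F :=
  V.comap (σ : F →+* F)

theorem mem_pull {V : ValuationSubring F} {σ : F ≃ₐ[K] F} {a : F} : a ∈ pull V σ ↔ σ a ∈ V :=
  Iff.rfl

theorem pull_pull (V : ValuationSubring F) (σ τ : F ≃ₐ[K] F) :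
    pull (pull V σ) τ = pull V (σ * τ) := rfl

theorem pull_one (V : ValuationSubring F) : pull V (1 : F ≃ₐ[K] F) = V := rfl

theorem valuation_pull_lt_one {V : ValuationSubring F} {σ : F ≃ₐ[K] F} {a : F} :
    (pull V σ).valuation a < 1 ↔ V.valuation (σ a) < 1 := by
  rw [← ValuationSubring.mem_nonunits_iff, ← ValuationSubring.mem_nonunits_iff,
    ValuationSubring.mem_nonunits_iff_or, ValuationSubring.mem_nonunits_iff_or, mem_pull, map_inv₀,
    map_eq_zero]

theorem valuation_le_iff_div_mem {V : ValuationSubring F} {a b : F} (hb : b ≠ 0) :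
    V.valuation a ≤ V.valuation b ↔ a / b ∈ V := by
  rw [← V.valuation_le_one_iff, map_div₀,
    div_le_one₀ (zero_lt_iff.2 (V.valuation.ne_zero_iff.2 hb))]

theorem one_lt_valuation_iff {V : ValuationSubring F} {a : F} : 1 < V.valuation a ↔ a ∉ V := by
  rw [← V.valuation_le_one_iff, not_le]

variable [Finite K] [Algebra (CoordRing K m) F] [IsFractionRing (CoordRing K m) F]
  [IsScalarTower K (CoordRing K m) F]

variable (K m F) in
theorem fnF_eq_flagCoords [CharP F 3] : fnF K m F = flagCoords (genF K m F 0) (genF K m F 1)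
    (genF K m F 2) (fnF K m F 4) (fnF K m F 5) :=
  (Flag.of_onCurve (onCurve_genF K m F)).coords_eq

variable (K m F) in
theorem flag_fnF [CharP F 3] : Flag m (genF K m F 0 ^ 3 ^ m) (genF K m F 0) (genF K m F 1)
    (genF K m F 2) (fnF K m F 4) (fnF K m F 5) :=
  Flag.of_onCurve (onCurve_genF K m F)

variable (K m F) in
theorem exists_genF_notMem [CharP K 3] : ∃ V : ValuationSubring F, genF K m F 0 ∉ V :=
  exists_valuationSubring_notMem (K := K) fun h => transcendental_genF h.isAlgebraic

theorem hasOrder_fnF [CharP F 3] {V : ValuationSubring F} (hV : genF K m F 0 ∉ V) (i : Fin 14) :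
    HasOrder V.valuation (V.valuation (genF K m F 0)) (9 * (3 ^ m) ^ 4) (fnF K m F i)
      (poleOrder (3 ^ m) i) :=
  ((onCurve_genF K m F).hasOrder (one_lt_valuation_iff.2 hV)).1 i

theorem fnF_ne_zero [CharP K 3] [CharP F 3] (i : Fin 14) : fnF K m F i ≠ 0 := by
  obtain ⟨V, hV⟩ := exists_genF_notMem K m F
  exact (hasOrder_fnF hV i).ne_zero (one_lt_valuation_iff.2 hV) (by positivity)

theorem valuation_fnF_div_lt_one [CharP K 3] [CharP F 3] {V : ValuationSubring F}
    (hV : genF K m F 0 ∉ V) {i : Fin 14} (hi : i ≠ 11) :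
    V.valuation (fnF K m F i / fnF K m F 11) < 1 := by
  rw [map_div₀, div_lt_one₀ (zero_lt_iff.2 (V.valuation.ne_zero_iff.2 (fnF_ne_zero 11)))]
  exact (hasOrder_fnF hV i).valuation_lt (one_lt_valuation_iff.2 hV) (hasOrder_fnF hV 11)
    (poleOrder_lt _ (Nat.one_le_pow _ _ (by norm_num)) hi)

theorem exists_isInversion (hK : Nat.card K = 3 ^ (2 * m + 1)) :
    ∃ φ : F ≃ₐ[K] F, IsInversion (m := m) φ := by
  have := charP_three hK
  have := charP_field K F
  set W := fnF K m F with hW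
  have h8 : W 11 ≠ 0 := fnF_ne_zero 11
  have hinv := (flag_fnF K m F).inversion (fnF_eq_flagCoords K m F).symm h8
  have hco := flagCoords_inversion (fnF_eq_flagCoords K m F).symm h8
  rw [← hW] at hinv hco
  -- At infinity w₆ has smaller pole order than w₈, so the quotient has a valuation different from
  -- 1; algebraic elements do not.
  have htr : Transcendental K (W 9 / W 11) := by
    obtain ⟨V, hV⟩ := exists_genF_notMem K m F
    have := isTrivialOn_of_finite (K := K) V.valuation
    exact Valuation.transcendental_of_ne_one K _ (v := V.valuation)
      (div_ne_zero (fnF_ne_zero 9) h8) (valuation_fnF_div_lt_one hV (by decide)).ne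
  have hf : ∀ f : F →ₐ[K] F, f (genF K m F 0) = W 9 / W 11 → f (genF K m F 1) = W 13 / W 11 →
      f (genF K m F 2) = W 12 / W 11 → ∀ i, f (W i) = (W 11)⁻¹ * invPerm W i := by
    intro f f0 f1 f2 i
    have h1 := map_coords m (f : F →+* F) (genF K m F 0) (genF K m F 1) (genF K m F 2) i
    have h2 : (f : F →+* F) (coords m (genF K m F 0) (genF K m F 1) (genF K m F 2) i) = f (W i) :=
      rfl
    rw [h2] at h1
    rw [h1]
    change coords m (f (genF K m F 0)) (f (genF K m F 1)) (f (genF K m F 2)) i = _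
    rw [f0, f1, f2, hinv.coords_eq, hco]
    rfl
  -- The same point serves twice, because the induced endomorphism is its own inverse.
  obtain ⟨φ, f0, f1, f2⟩ := exists_algEquiv (m := m) hinv.onCurve htr hinv.onCurve htr (by
    intro f f' f0 f1 f2 f0' f1' f2'
    have key : ∀ f : F →ₐ[K] F, f (genF K m F 0) = W 9 / W 11 →
        f (genF K m F 1) = W 13 / W 11 → f (genF K m F 2) = W 12 / W 11 →
        f (W 9 / W 11) = genF K m F 0 ∧ f (W 13 / W 11) = genF K m F 1 ∧
        f (W 12 / W 11) = genF K m F 2 := by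
      intro f f0 f1 f2
      have h := hf f f0 f1 f2
      have h0 : W 0 = 1 := rfl
      simp only [map_div₀, h, invPerm, Matrix.cons_val, h0]
      refine ⟨?_, ?_, ?_⟩ <;> field_simp <;> rfl
    exact ⟨key f f0 f1 f2, key f' f0' f1' f2'⟩)
  refine ⟨φ, fun i => ?_⟩
  rw [← hW, ← mul_inv_cancel_left₀ h8 (invPerm W i)]
  congr 1
  exact hf (φ : F →ₐ[K] F) f0 f1 f2 i

theorem IsInversion.apply [CharP K 3] [CharP F 3] {φ : F ≃ₐ[K] F} (h : IsInversion (m := m) φ)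
    (i : Fin 14) : φ (fnF K m F i) = invPerm (fnF K m F) i / fnF K m F 11 := by
  rw [← h i, mul_div_cancel_left₀ _ (fnF_ne_zero 11)]

theorem IsInversion.mul_self [CharP K 3] [CharP F 3] {φ : F ≃ₐ[K] F}
    (h : IsInversion (m := m) φ) : φ * φ = 1 := by
  have h8 : fnF K m F 11 ≠ 0 := fnF_ne_zero 11
  have h0 : fnF K m F 0 = 1 := rfl
  have key : ∀ i : Fin 3, φ (φ (genF K m F i)) = genF K m F i := by
    intro i
    fin_cases i
    · change φ (φ (fnF K m F 1)) = fnF K m F 1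
      simp only [h.apply, invPerm, Matrix.cons_val, map_div₀, h0]
      field_simp
    · change φ (φ (fnF K m F 2)) = fnF K m F 2
      simp only [h.apply, invPerm, Matrix.cons_val, map_div₀, h0]
      field_simp
    · change φ (φ (fnF K m F 3)) = fnF K m F 3
      simp only [h.apply, invPerm, Matrix.cons_val, map_div₀, h0]
      field_simp
  have h1 : ((φ * φ : F ≃ₐ[K] F) : F →ₐ[K] F) = ((1 : F ≃ₐ[K] F) : F →ₐ[K] F) :=
    algHom_ext_genF (m := m) key
  ext a
  exact DFunLike.congr_fun h1 a

/-- φ sends x, y₁, y₂ to w₆/w₈, w₁₀/w₈, w₉/w₈, and w₈ has the largest pole order at infinity. -/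
theorem IsInversion.centredAtOrigin [CharP K 3] [CharP F 3] {φ : F ≃ₐ[K] F}
    (h : IsInversion (m := m) φ) {V : ValuationSubring F} (hV : genF K m F 0 ∉ V) :
    CentredAtOrigin K m (pull V φ) := by
  intro i
  rw [valuation_pull_lt_one]
  fin_cases i
  · change V.valuation (φ (fnF K m F 1)) < 1
    rw [h.apply]
    exact valuation_fnF_div_lt_one hV (i := 9) (by decide)
  · change V.valuation (φ (fnF K m F 2)) < 1
    rw [h.apply]
    exact valuation_fnF_div_lt_one hV (i := 13) (by decide)
  · change V.valuation (φ (fnF K m F 3)) < 1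
    rw [h.apply]
    exact valuation_fnF_div_lt_one hV (i := 12) (by decide)

/-- There is only one valuation ring at infinity. -/
theorem eq_of_genF_notMem (hK : Nat.card K = 3 ^ (2 * m + 1)) {V V' : ValuationSubring F}
    (hV : genF K m F 0 ∉ V) (hV' : genF K m F 0 ∉ V') : V = V' := by
  have := charP_three hK
  have := charP_field K F
  obtain ⟨φ, hφ⟩ := exists_isInversion (F := F) hK
  -- The inversion moves both places to the origin, where they coincide.
  have h := (hφ.centredAtOrigin hV).eq (hφ.centredAtOrigin hV')
  have h1 := congrArg (fun V => pull V φ) h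
  simpa only [pull_pull, hφ.mul_self, pull_one] using h1

/-- A valuation ring whose centre on the `x`-line is rational is a translate of the origin. -/
theorem exists_centredAtOrigin_pull (hK : Nat.card K = 3 ^ (2 * m + 1)) {V : ValuationSubring F}
    {b : K} (hb : V.valuation (genF K m F 0 - algebraMap K F b) < 1) :
    ∃ (τ : F ≃ₐ[K] F) (c d : K), IsTranslation (m := m) τ (-b) c d ∧
      CentredAtOrigin K m (pull V τ) := by
  have := charP_three hK
  have := charP_field K F
  obtain ⟨e₁, e₂⟩ := onCurve_genF K m F
  set q := 3 ^ (2 * m + 1) with hq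
  have hbq := pow_q hK b
  have hb1 : V.valuation (genF K m F 0) ≤ 1 := by
    rw [← sub_add_cancel (genF K m F 0) (algebraMap K F b)]
    refine (V.valuation.map_add _ _).trans (max_le hb.le ?_)
    by_cases h0 : b = 0
    · simp [h0]
    · exact (valuation_algebraMap_eq_one _ h0).le
  have hxq : V.valuation (genF K m F 0 ^ q - genF K m F 0) < 1 := by
    have : genF K m F 0 ^ q - genF K m F 0 = (genF K m F 0 - algebraMap K F b) ^ q -
        (genF K m F 0 - algebraMap K F b) := by
      rw [hq, sub_pow_char_pow, ← map_pow, hbq]; ring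
    rw [this]
    refine (V.valuation.map_sub _ _).trans_lt (max_lt ?_ hb)
    rw [map_pow]
    exact pow_lt_one₀ zero_le hb (by positivity)
  have hy₁ : V.valuation (genF K m F 1 ^ q - genF K m F 1) < 1 := by
    rw [e₁, map_mul, map_pow]
    exact (mul_le_of_le_one_left' (pow_le_one' hb1 _)).trans_lt hxq
  have hy₂ : V.valuation (genF K m F 2 ^ q - genF K m F 2) < 1 := by
    rw [e₂, map_mul, map_pow]
    exact (mul_le_of_le_one_left' (pow_le_one' hb1 _)).trans_lt hy₁
  -- Once x has a rational residue, the curve equations force y₁ and y₂ to have residues c and d in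
  -- K. The translation used below is the inverse of the one taking the origin to (b, c, d).
  obtain ⟨c, hc⟩ := exists_valuation_sub_lt_one hK _ hy₁
  obtain ⟨d, hd⟩ := exists_valuation_sub_lt_one hK _ hy₂
  set B := b ^ 3 ^ m with hB
  have hBn : (-b) ^ 3 ^ m = -B := by rw [Odd.neg_pow (Odd.pow (by decide))]
  obtain ⟨τ, hτ⟩ := exists_isTranslation (F := F) hK (-b) (B * b - c) (-d - B * c - B ^ 2 * b)
  refine ⟨τ, _, _, hτ, fun i => ?_⟩
  obtain ⟨t0, t1, t2⟩ := hτ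
  rw [hBn] at t1 t2
  have hB1 : V.valuation (algebraMap K F B) ≤ 1 := by
    by_cases h0 : B = 0
    · simp [h0]
    · exact (valuation_algebraMap_eq_one _ h0).le
  rw [valuation_pull_lt_one]
  fin_cases i
  · change V.valuation (τ (genF K m F 0)) < 1
    rw [t0, map_neg, ← sub_eq_add_neg]
    exact hb
  · change V.valuation (τ (genF K m F 1)) < 1
    have : τ (genF K m F 1) = (genF K m F 1 - algebraMap K F c) -
        algebraMap K F B * (genF K m F 0 - algebraMap K F b) := by
      rw [t1]; simp only [map_neg, map_sub, map_mul]; ring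
    rw [this]
    refine (V.valuation.map_sub _ _).trans_lt (max_lt hc ?_)
    rw [map_mul]
    exact (mul_le_of_le_one_left' hB1).trans_lt hb
  · change V.valuation (τ (genF K m F 2)) < 1
    have : τ (genF K m F 2) = (genF K m F 2 - algebraMap K F d) +
        (algebraMap K F B * (genF K m F 1 - algebraMap K F c) +
        algebraMap K F B ^ 2 * (genF K m F 0 - algebraMap K F b)) := by
      rw [t2]; simp only [map_neg, map_sub, map_mul, map_pow]; ring
    rw [this]
    refine (V.valuation.map_add _ _).trans_lt (max_lt hd
      ((V.valuation.map_add _ _).trans_lt (max_lt ?_ ?_)))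
    · rw [map_mul]
      exact (mul_le_of_le_one_left' hB1).trans_lt hc
    · rw [map_mul, map_pow]
      exact (mul_le_of_le_one_left' (pow_le_one' hB1 _)).trans_lt hb

end Classification

/-! ### Generators of the automorphism group. -/

section Classification

theorem valuation_pow_sub_of_lt_one {F Γ₀ : Type*} [Field F] [LinearOrderedCommGroupWithZero Γ₀]
    (v : Valuation F Γ₀) {a : F} {n : ℕ} (hn : 1 < n) (ha : v a < 1) : v (a ^ n - a) = v a := by
  rcases eq_or_ne a 0 with rfl | h0
  · rw [zero_pow (by omega), sub_zero]
  · rw [Valuation.map_sub_swap]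
    refine v.map_sub_eq_of_lt_left ?_
    rw [map_pow]
    exact pow_lt_self_of_lt_one₀ (zero_lt_iff.2 (v.ne_zero_iff.2 h0)) ha hn

theorem valuation_pow_sub_of_one_lt {F Γ₀ : Type*} [Field F] [LinearOrderedCommGroupWithZero Γ₀]
    (v : Valuation F Γ₀) {a : F} {n : ℕ} (hn : 1 < n) (ha : 1 < v a) :
    v (a ^ n - a) = v a ^ n := by
  rw [← map_pow]
  refine v.map_sub_eq_of_lt_left ?_
  rw [map_pow]
  exact lt_self_pow₀ ha hn

variable {K : Type*} [Field K] {m : ℕ} {F : Type*} [Field F] [Algebra K F]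

theorem pow_q_sub_eq [CharP F 3] [Finite K] (hK : Nat.card K = 3 ^ (2 * m + 1)) (a : F) (c : K) :
    a ^ 3 ^ (2 * m + 1) - a = (a - algebraMap K F c) ^ 3 ^ (2 * m + 1) - (a - algebraMap K F c) := by
  rw [sub_pow_char_pow, ← map_pow, pow_q hK]; ring

theorem pull_injective (σ : F ≃ₐ[K] F) :
    Function.Injective fun V : ValuationSubring F => pull V σ := by
  intro V V' h
  have h1 := congrArg (fun V => pull V σ⁻¹) h
  simpa only [pull_pull, mul_inv_cancel, pull_one] using h1

variable [Finite K] [Algebra (CoordRing K m) F] [IsFractionRing (CoordRing K m) F]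
  [IsScalarTower K (CoordRing K m) F]

theorem pow_q_genF_sub_ne_zero (hK : Nat.card K = 3 ^ (2 * m + 1)) :
    genF K m F 0 ^ 3 ^ (2 * m + 1) - genF K m F 0 ≠ 0 := by
  have := charP_three hK
  intro h
  obtain ⟨c, hc⟩ := exists_eq_algebraMap hK (sub_eq_zero.1 h)
  exact transcendental_genF (K := K) (m := m) (F := F) (hc ▸ isAlgebraic_algebraMap c)

/-- At infinity, `hle` bounds the quotient. At a finite place where x^q - x vanishes, x - b is a
uniformiser for some b ∈ K, and σ(x)^q - σ(x) vanishes as well. -/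
theorem pow_q_sub_div_mem (hK : Nat.card K = 3 ^ (2 * m + 1)) {V : ValuationSubring F}
    (hV : genF K m F 0 ∉ V) {σ : F ≃ₐ[K] F} (hσ : σ (genF K m F 0) ∉ V)
    (hle : V.valuation (σ (genF K m F 0)) ≤ V.valuation (genF K m F 0))
    (V' : ValuationSubring F) :
    (σ (genF K m F 0) ^ 3 ^ (2 * m + 1) - σ (genF K m F 0)) /
      (genF K m F 0 ^ 3 ^ (2 * m + 1) - genF K m F 0) ∈ V' := by
  have := charP_three hK
  have := charP_field K F
  rw [← valuation_le_iff_div_mem (pow_q_genF_sub_ne_zero hK)]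
  by_cases hg : genF K m F 0 ∈ V'
  swap
  · obtain rfl := eq_of_genF_notMem hK hV hg
    rw [valuation_pow_sub_of_one_lt _ one_lt_q (one_lt_valuation_iff.2 hV),
      valuation_pow_sub_of_one_lt _ one_lt_q (one_lt_valuation_iff.2 hσ)]
    exact pow_le_pow_left₀ zero_le hle _
  -- σ fixes the unique place at infinity, so σ(x) has no other pole.
  have hz : σ (genF K m F 0) ∈ V' := by
    by_contra hz
    have h1 : V = pull V σ := eq_of_genF_notMem hK hV hσ
    have h2 : V = pull V' σ := eq_of_genF_notMem hK hV hz
    exact hV (pull_injective σ (h1.symm.trans h2) ▸ hg)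
  have hz1 : V'.valuation (σ (genF K m F 0) ^ 3 ^ (2 * m + 1) - σ (genF K m F 0)) ≤ 1 :=
    (V'.valuation_le_one_iff _).2 (sub_mem (pow_mem hz _) hz)
  have hg1 : V'.valuation (genF K m F 0 ^ 3 ^ (2 * m + 1) - genF K m F 0) ≤ 1 :=
    (V'.valuation_le_one_iff _).2 (sub_mem (pow_mem hg _) hg)
  rcases hg1.eq_or_lt with h | h
  · rwa [h]
  obtain ⟨b, hb⟩ := exists_valuation_sub_lt_one hK _ h
  obtain ⟨τ, c, d, ⟨hτ, -⟩, hcen⟩ := exists_centredAtOrigin_pull hK hb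
  -- After translation to the origin, σ(x) has a residue e ∈ K there, and x - b is the uniformiser,
  -- so v(σ(x) - e) ≤ v(x - b). Replacing z by z - e does not change z^q - z.
  obtain ⟨e, he⟩ := hcen.exists_sub_lt_one (f := τ⁻¹ (σ (genF K m F 0))) (by
    rw [mem_pull]; simpa using hz)
  have h1 := hcen.valuation_le he
  have hτ' : τ⁻¹ (genF K m F 0 - algebraMap K F b) = genF K m F 0 := by
    rw [AlgEquiv.aut_inv, AlgEquiv.symm_apply_eq, hτ, map_neg, ← sub_eq_add_neg]
  have hne : genF K m F 0 ≠ 0 := fnF_ne_zero (K := K) (m := m) (F := F) 1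
  have hne' : genF K m F 0 - algebraMap K F b ≠ 0 := fun h0 => hne (by rw [← hτ', h0, map_zero])
  have h2 : V'.valuation (σ (genF K m F 0) - algebraMap K F e) ≤
      V'.valuation (genF K m F 0 - algebraMap K F b) := by
    rw [valuation_le_iff_div_mem hne']
    have h3 := (valuation_le_iff_div_mem hne).1 h1
    rw [mem_pull, map_div₀] at h3
    convert h3 using 2
    · simp
    · rw [AlgEquiv.aut_inv, AlgEquiv.symm_apply_eq] at hτ'
      exact hτ'
  rw [pow_q_sub_eq hK _ e, pow_q_sub_eq hK (genF K m F 0) b,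
    valuation_pow_sub_of_lt_one _ one_lt_q hb,
    valuation_pow_sub_of_lt_one _ one_lt_q (h2.trans_lt hb)]
  exact h2

/-- The quotient without poles is integral over K; subtracting its residue at a rational place
leaves an algebraic element of valuation below 1, hence zero. So σ(x)^q - σ(x) = c (x^q - x), and
σ(x) - c x is fixed by the q-th power map. -/
theorem exists_eq_affine_of_le (hK : Nat.card K = 3 ^ (2 * m + 1)) {V : ValuationSubring F}
    (hV : genF K m F 0 ∉ V) {σ : F ≃ₐ[K] F} (hσ : σ (genF K m F 0) ∉ V)
    (hle : V.valuation (σ (genF K m F 0)) ≤ V.valuation (genF K m F 0)) :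
    ∃ a b : K, a ≠ 0 ∧
      σ (genF K m F 0) = algebraMap K F a * genF K m F 0 + algebraMap K F b := by
  have := charP_three hK
  have := charP_field K F
  have hmem := pow_q_sub_div_mem hK hV hσ hle
  have hne := pow_q_genF_sub_ne_zero (F := F) hK
  set z := σ (genF K m F 0) with hz
  set g := genF K m F 0 with hg
  have hint := isIntegral_of_forall_mem (K := K) hmem
  obtain ⟨φ, hφ⟩ := exists_isInversion (F := F) hK
  have hcen := hφ.centredAtOrigin hV
  obtain ⟨c, hc⟩ := hcen.exists_sub_lt_one (hmem _)
  have hc0 : (z ^ 3 ^ (2 * m + 1) - z) / (g ^ 3 ^ (2 * m + 1) - g) = algebraMap K F c := by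
    by_contra h0
    have := isTrivialOn_of_finite (K := K) (pull V φ).valuation
    exact Valuation.transcendental_of_ne_one K _ (v := (pull V φ).valuation)
      (sub_ne_zero.2 h0) hc.ne (hint.isAlgebraic.sub (isAlgebraic_algebraMap c))
  rw [div_eq_iff hne] at hc0
  obtain ⟨b, hb⟩ := exists_eq_algebraMap hK (a := z - algebraMap K F c * g) (by
    rw [sub_pow_char_pow, mul_pow, ← map_pow (algebraMap K F), pow_q hK]
    linear_combination hc0)
  refine ⟨c, b, ?_, by rw [← hb]; ring⟩
  rintro rfl
  rw [map_zero, zero_mul, sub_zero] at hb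
  have htr := transcendental_genF (K := K) (m := m) (F := F)
  refine htr ?_
  have : g = algebraMap K F b := by
    rw [← σ.symm_apply_apply g, ← hz, hb, AlgEquiv.commutes]
  exact hg ▸ this ▸ isAlgebraic_algebraMap b

/-- One of σ and σ⁻¹ does not increase the pole of x, and inverses of affine maps are affine. -/
theorem exists_eq_affine (hK : Nat.card K = 3 ^ (2 * m + 1)) {V : ValuationSubring F}
    (hV : genF K m F 0 ∉ V) {σ : F ≃ₐ[K] F} (hσ : σ (genF K m F 0) ∉ V) :
    ∃ a b : K, a ≠ 0 ∧
      σ (genF K m F 0) = algebraMap K F a * genF K m F 0 + algebraMap K F b := by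
  have := charP_three hK
  have := charP_field K F
  rcases le_total (V.valuation (σ (genF K m F 0))) (V.valuation (genF K m F 0)) with h | h
  · exact exists_eq_affine_of_le hK hV hσ h
  have h1 : V = pull V σ := eq_of_genF_notMem hK hV hσ
  have hσ' : σ⁻¹ (genF K m F 0) ∉ V := by
    rw [h1, mem_pull]; simpa using hV
  have hne : genF K m F 0 ≠ 0 := fnF_ne_zero (K := K) (m := m) (F := F) 1
  have hle : V.valuation (σ⁻¹ (genF K m F 0)) ≤ V.valuation (genF K m F 0) := by
    rw [valuation_le_iff_div_mem (by simpa using hne)] at h ⊢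
    rw [h1, mem_pull]
    simpa using h
  obtain ⟨a, b, ha, hab⟩ := exists_eq_affine_of_le hK hV hσ' hle
  rw [AlgEquiv.aut_inv, AlgEquiv.symm_apply_eq, map_add, map_mul, AlgEquiv.commutes,
    AlgEquiv.commutes] at hab
  have ha' : algebraMap K F a ≠ 0 := (map_ne_zero _).2 ha
  refine ⟨a⁻¹, -(a⁻¹ * b), inv_ne_zero ha, ?_⟩
  rw [map_neg, map_mul, map_inv₀]
  nth_rw 2 [hab]
  field_simp
  ring

variable (K m F) in
/-- The translations, the scalings and the inversion. -/
def standardGenerators : Set (F ≃ₐ[K] F) :=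
  {σ | (∃ b c d, IsTranslation (m := m) σ b c d) ∨ (∃ a, a ≠ 0 ∧ IsScaling (m := m) σ a) ∨
    IsInversion (m := m) σ}

/-- Dividing by a scaling and a translation leaves an automorphism fixing x. It changes y₁ and y₂ by
roots of T^q = T, so it is a translation. -/
theorem mem_closure_of_eq_affine (hK : Nat.card K = 3 ^ (2 * m + 1)) {σ : F ≃ₐ[K] F} {a b : K}
    (ha : a ≠ 0) (h : σ (genF K m F 0) = algebraMap K F a * genF K m F 0 + algebraMap K F b) :
    σ ∈ Subgroup.closure (standardGenerators K m F) := by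
  have := charP_three hK
  have := charP_field K F
  obtain ⟨s, hs⟩ := exists_isScaling (F := F) hK ha
  obtain ⟨t, ht⟩ := exists_isTranslation (F := F) hK (a⁻¹ * b) 0 0
  have haF : algebraMap K F a ≠ 0 := (map_ne_zero _).2 ha
  set ψ := (t * s)⁻¹ * σ with hψ
  have h0 : ψ (genF K m F 0) = genF K m F 0 := by
    rw [hψ, AlgEquiv.mul_apply, AlgEquiv.aut_inv, AlgEquiv.symm_apply_eq, h, AlgEquiv.mul_apply,
      hs.1, map_mul, ht.1, AlgEquiv.commutes, map_mul, map_inv₀]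
    field_simp
  obtain ⟨e₁, e₂⟩ := onCurve_genF K m F
  have e₁' := congrArg ψ e₁
  have e₂' := congrArg ψ e₂
  simp only [map_sub, map_mul, map_pow, h0] at e₁' e₂'
  obtain ⟨c, hc⟩ := exists_eq_algebraMap hK (a := ψ (genF K m F 1) - genF K m F 1) (by
    rw [sub_pow_char_pow]
    linear_combination e₁' - e₁)
  obtain ⟨d, hd⟩ := exists_eq_algebraMap hK (a := ψ (genF K m F 2) - genF K m F 2) (by
    rw [sub_pow_char_pow]
    linear_combination e₂' - e₂ + genF K m F 0 ^ 3 ^ m * (e₁' - e₁))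
  have hψt : IsTranslation (m := m) ψ 0 c d := by
    refine ⟨by rw [h0, map_zero, add_zero], ?_, ?_⟩
    · rw [← hc, zero_pow (by positivity), map_zero]; ring
    · rw [← hd, zero_pow (by positivity), map_zero]; ring
  rw [show σ = t * s * ψ by rw [hψ, mul_inv_cancel_left]]
  exact mul_mem (mul_mem (Subgroup.subset_closure (.inl ⟨_, _, _, ht⟩))
    (Subgroup.subset_closure (.inr (.inl ⟨_, ha, hs⟩))))
    (Subgroup.subset_closure (.inl ⟨_, _, _, hψt⟩))

/-- The automorphism group of the Ree function field is generated by the translations, the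
scalings and the inversion. -/
theorem closure_standardGenerators (hK : Nat.card K = 3 ^ (2 * m + 1)) :
    Subgroup.closure (standardGenerators K m F) = ⊤ := by
  have := charP_three hK
  have := charP_field K F
  rw [eq_top_iff]
  intro σ _
  obtain ⟨V, hV⟩ := exists_genF_notMem K m F
  by_cases hσ : σ (genF K m F 0) ∈ V
  swap
  · obtain ⟨a, b, ha, hab⟩ := exists_eq_affine hK hV hσ
    exact mem_closure_of_eq_affine hK ha hab
  obtain ⟨φ, hφ⟩ := exists_isInversion (F := F) hK
  have hφφ : ∀ f, φ (φ f) = f := fun f => DFunLike.congr_fun hφ.mul_self f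
  have hcen := hφ.centredAtOrigin hV
  -- `V` is the image of the origin under the inversion, so its residue field is K and σ(x) has a
  -- rational residue b there.
  obtain ⟨b, hb⟩ := hcen.exists_sub_lt_one (f := φ (σ (genF K m F 0))) (by
    rwa [mem_pull, hφφ])
  rw [valuation_pull_lt_one, map_sub, hφφ, AlgEquiv.commutes, ← AlgEquiv.commutes σ, ← map_sub,
    ← valuation_pull_lt_one] at hb
  obtain ⟨τ, c, d, hτ, hcen'⟩ := exists_centredAtOrigin_pull hK hb
  have h1 := congrArg (fun V => pull V φ) (hcen'.eq hcen)
  simp only [pull_pull, hφ.mul_self, pull_one] at h1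
  -- τ moves the preimage of `V` under σ to the origin and φ moves it on to infinity, so the
  -- composite fixes infinity.
  obtain ⟨a, b', ha, hab⟩ := exists_eq_affine hK hV (σ := σ * τ * φ) (by
    rw [← mem_pull, h1]; exact hV)
  have h2 := mem_closure_of_eq_affine hK ha hab
  rw [show σ = σ * τ * φ * φ⁻¹ * τ⁻¹ by group]
  exact mul_mem (mul_mem h2 (inv_mem (Subgroup.subset_closure (.inr (.inr hφ)))))
    (inv_mem (Subgroup.subset_closure (.inl ⟨_, _, _, hτ⟩)))

end Classification

/-! ### Independence of the fourteen functions. -/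

section LinearIndependence

theorem linearIndependent_of_hasOrder {K F Γ₀ ι : Type*} [Field K] [Finite K] [Field F]
    [Algebra K F] [LinearOrderedCommGroupWithZero Γ₀] {v : Valuation F Γ₀} {g : Γ₀} {N : ℕ}
    (hg : 1 < g) {f : ι → F} {n : ι → ℕ} (hn : Function.Injective n)
    (h : ∀ i, HasOrder v g N (f i) (n i)) (hf : ∀ i, f i ≠ 0) : LinearIndependent K f := by
  rw [linearIndependent_iff']
  intro S c hc
  have key : ∀ i, c i • f i ≠ 0 → HasOrder v g N (c i • f i) (n i) := by
    intro i hi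
    have hci : c i ≠ 0 := left_ne_zero_of_smul hi
    have := h i
    unfold HasOrder at this ⊢
    rw [Algebra.smul_def, map_mul, valuation_algebraMap_eq_one v hci, one_mul, this]
  have := eq_zero_of_sum_eq_zero_of_valuation_ne v S (fun i => c i • f i)
    (fun i _ j _ hi hj hij => hn ((key i hi).eq_of_valuation_eq hg (key j hj) hij)) hc
  intro i hi
  exact (smul_eq_zero.1 (this i hi)).resolve_right (hf i)

theorem poleOrder_injective {s : ℕ} (hs : 3 ≤ s) : Function.Injective (poleOrder s) := by
  have h2 : 3 * s ≤ s ^ 2 := by rw [sq]; exact Nat.mul_le_mul_right s hs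
  have h3 : 3 * s ^ 2 ≤ s ^ 3 := by rw [pow_succ' s 2]; exact Nat.mul_le_mul_right _ hs
  have h4 : 3 * s ^ 3 ≤ s ^ 4 := by rw [pow_succ' s 3]; exact Nat.mul_le_mul_right _ hs
  -- The indices listed by increasing pole order.
  let e : Fin 14 → Fin 14 := ![0, 1, 2, 3, 7, 10, 4, 5, 8, 6, 12, 13, 9, 11]
  have he : Function.Surjective e := by decide
  have hmono : StrictMono (poleOrder s ∘ e) := by
    refine Fin.strictMono_iff_lt_succ.2 fun i => ?_
    fin_cases i <;> simp [poleOrder, e] <;> omega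
  intro i j hij
  obtain ⟨i, rfl⟩ := he i
  obtain ⟨j, rfl⟩ := he j
  exact congrArg e (hmono.injective hij)

variable {K : Type*} [Field K] {m : ℕ} {F : Type*} [Field F] [Algebra K F] [Finite K]
  [Algebra (CoordRing K m) F] [IsFractionRing (CoordRing K m) F]
  [IsScalarTower K (CoordRing K m) F]

-- For m ≥ 1 the pole orders are distinct. For m = 0 the only coincidence is between w₁ and w₄, and
-- it disappears when w₄ is replaced by w₁ + w₄, of order 16.
variable (K m F) in
theorem linearIndependent_fnF [CharP K 3] [CharP F 3] : LinearIndependent K (fnF K m F) := by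
  obtain ⟨V, hV⟩ := exists_genF_notMem K m F
  have hx := one_lt_valuation_iff.2 hV
  obtain ⟨h, h0⟩ := (onCurve_genF K m F).hasOrder hx
  have hne := fnF_ne_zero (K := K) (m := m) (F := F)
  rcases Nat.eq_zero_or_pos m with rfl | hm
  swap
  · exact linearIndependent_of_hasOrder hx
      (poleOrder_injective (Nat.le_self_pow hm.ne' 3)) h hne
  specialize h0 rfl
  set f := fnF K 0 F with hf
  have h1 : ∀ i, HasOrder V.valuation (V.valuation (genF K 0 F 0)) 9
      (Function.update f 7 (f 4 + f 7) i) (Function.update (poleOrder 1) 7 16 i) := by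
    intro i
    rcases eq_or_ne i 7 with rfl | hi
    · rw [Function.update_self, Function.update_self]
      exact h0
    · rw [Function.update_of_ne hi, Function.update_of_ne hi]
      simpa [hf, fnF] using h i
  have hli : LinearIndependent K (Function.update f 7 (f 4 + f 7)) :=
    linearIndependent_of_hasOrder hx (by decide) h1 fun i => (h1 i).ne_zero hx (by norm_num)
  rw [Fintype.linearIndependent_iff] at hli ⊢
  intro c hc
  -- c₄w₁ + c₇w₄ = (c₄ - c₇)w₁ + c₇(w₁ + w₄), with coefficients indexed by position.
  have h2 := hli (Function.update c 4 (c 4 - c 7)) (by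
    rw [← hc]
    simp only [Fin.sum_univ_succ, Fin.sum_univ_zero]
    simp [Function.update, sub_smul]
    abel)
  intro i
  have h7 : c 7 = 0 := by simpa using h2 7
  rcases eq_or_ne i 4 with rfl | hi
  · simpa [h7] using h2 4
  · simpa [Function.update_of_ne hi] using h2 i

end LinearIndependence

/-! ### Matrices acting up to a scalar function. -/

section ScaledAction

variable {K F ι : Type*} [Field K] [Field F] [Algebra K F] [Fintype ι] [DecidableEq ι]

variable (K) in
/-- The pairs of an automorphism `σ` and an invertible matrix `M` such that `σ⁻¹` maps the vector
`W` to `M W`, up to a scalar factor. -/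
def scaledAction (W : ι → F) : Subgroup ((F ≃ₐ[K] F) × GL ι K) where
  carrier := {p | ∃ u : Fˣ, ∀ i, u * p.1⁻¹ (W i) = ∑ j, p.2.1 i j • W j}
  one_mem' := ⟨1, fun i => by simp [Matrix.one_apply, ite_smul]⟩
  mul_mem' := by
    rintro ⟨σ, M⟩ ⟨τ, N⟩ ⟨u, hu⟩ ⟨v, hv⟩
    -- The scalars form a cocycle. Recording σ⁻¹ rather than σ makes the matrices multiply in the
    -- same order as the automorphisms.
    refine ⟨Units.map ((τ⁻¹ : F ≃ₐ[K] F) : F →* F) u * v, fun i => ?_⟩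
    calc τ⁻¹ (u : F) * v * (σ * τ)⁻¹ (W i) = v * τ⁻¹ (u * σ⁻¹ (W i)) := by
          rw [map_mul, mul_inv_rev, AlgEquiv.mul_apply]; ring
      _ = ∑ j, M.1 i j • (v * τ⁻¹ (W j)) := by
          rw [show (u : F) * σ⁻¹ (W i) = _ from hu i]
          simp only [map_sum, map_smul, Finset.mul_sum, mul_smul_comm]
      _ = ∑ j, (M * N).1 i j • W j := by
          simp only [show ∀ j, (v : F) * τ⁻¹ (W j) = _ from hv, Units.val_mul, Matrix.mul_apply,
            Finset.sum_smul, Finset.smul_sum, smul_smul]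
          exact Finset.sum_comm
  inv_mem' := by
    rintro ⟨σ, M⟩ ⟨u, hu⟩
    refine ⟨(Units.map (σ : F →* F) u)⁻¹, fun i => ?_⟩
    have h1 : W i = ∑ j, (M⁻¹).1 i j • (u * σ⁻¹ (W j)) := by
      simp only [show ∀ j, (u : F) * σ⁻¹ (W j) = _ from hu, Finset.smul_sum, smul_smul]
      rw [Finset.sum_comm]
      simp only [← Finset.sum_smul, ← Matrix.mul_apply, ← Units.val_mul, inv_mul_cancel]
      simp [Matrix.one_apply, ite_smul]
    have hσ : ∀ a, σ (σ⁻¹ a) = a := σ.apply_symm_apply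
    have h2 : σ (W i) = σ u * ∑ j, (M⁻¹).1 i j • W j := by
      conv_lhs => rw [h1]
      simp only [map_sum, map_smul, map_mul, hσ, Finset.mul_sum, mul_smul_comm]
    change ((Units.map (σ : F →* F) u)⁻¹ : Fˣ).1 * σ⁻¹⁻¹ (W i) = ∑ j, (M⁻¹).1 i j • W j
    rw [inv_inv, h2, Units.inv_mul_eq_iff_eq_mul]
    rfl

/-- A row vector killed by `M` gives a linear relation among the u σ(W i), hence among the W i. -/
theorem isUnit_of_scaledAction {W : ι → F} (hW : LinearIndependent K W) {σ : F ≃ₐ[K] F} {u : F}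
    (hu : u ≠ 0) {M : Matrix ι ι K} (h : ∀ i, u * σ (W i) = ∑ j, M i j • W j) : IsUnit M := by
  rw [← Matrix.vecMul_injective_iff_isUnit]
  refine (injective_iff_map_eq_zero M.vecMulLinear).2 fun c hc => ?_
  rw [Fintype.linearIndependent_iff] at hW
  refine funext (hW c ?_)
  have h1 : u * σ (∑ i, c i • W i) = 0 := by
    calc u * σ (∑ i, c i • W i) = ∑ i, c i • (u * σ (W i)) := by
          simp only [map_sum, map_smul, Finset.mul_sum, mul_smul_comm]
      _ = ∑ j, M.vecMulLinear c j • W j := by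
          simp only [h, Finset.smul_sum, smul_smul]
          rw [Finset.sum_comm]
          simp only [← Finset.sum_smul]
          rfl
      _ = 0 := by simp [hc]
  exact (map_eq_zero σ).1 ((mul_eq_zero.1 h1).resolve_left hu)

end ScaledAction

/-! ### Stabilisers in finite groups. -/

section Stabilizer

open scoped Pointwise

/-- In a finite group g⁻¹ is a power of g, so one inclusion suffices. -/
theorem mem_stabilizer_of_smul_subset {G α : Type*} [Group G] [Finite G] [MulAction G α]
    {s : Set α} {g : G} (h : g • s ⊆ s) : g ∈ MulAction.stabilizer G s := by
  have key : ∀ n : ℕ, g ^ n • s ⊆ s := by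
    intro n
    induction n with
    | zero => simp
    | succ n ih =>
      rw [pow_succ, mul_smul]
      exact (Set.smul_set_mono h).trans ih
  refine MulAction.mem_stabilizer_iff.2 (h.antisymm ?_)
  rw [Set.subset_smul_set_iff]
  have h1 : g⁻¹ = g ^ (orderOf g - 1) := by
    rw [inv_eq_iff_mul_eq_one, ← pow_succ', Nat.sub_add_cancel (orderOf_pos g), pow_orderOf_eq_one]
  rw [h1]
  exact key _

end Stabilizer

/-! ### The invariant seven-dimensional block. -/

section Block

/-- The partition of the coordinates into those of `1, x, w₁, w₂, w₃, w₆, w₈` and the others. -/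
def blockIndex : Fin 14 → Fin 2 := ![1, 1, 0, 0, 1, 1, 1, 0, 0, 1, 0, 1, 0, 0]

/-- The determinant of the block of the coordinates `1, x, w₁, w₂, w₃, w₆, w₈`. -/
def blockDet {K : Type*} [CommRing K] (M : Matrix (Fin 14) (Fin 14) K) : K :=
  (M.toSquareBlock blockIndex 1).det

variable {K : Type*} [CommRing K] {M N : Matrix (Fin 14) (Fin 14) K}

theorem blockDet_one : blockDet (1 : Matrix (Fin 14) (Fin 14) K) = 1 := by
  rw [blockDet, show (1 : Matrix (Fin 14) (Fin 14) K).toSquareBlock blockIndex 1 = 1 from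
    Matrix.toBlock_one_self _, Matrix.det_one]

/-- Triangularity of the left factor removes the mixed term, so the blocks themselves multiply. -/
theorem blockDet_mul (hM : M.BlockTriangular blockIndex) :
    blockDet (M * N) = blockDet M * blockDet N := by
  have h0 : M.toBlock (fun i => blockIndex i = 1) (fun i => ¬ blockIndex i = 1) = 0 := by
    ext i j
    refine hM ?_
    have hi := i.2
    have hj := j.2
    omega
  rw [blockDet, blockDet, blockDet, ← Matrix.det_mul]
  congr 1
  refine (Matrix.toBlock_mul_eq_add _ (fun i => blockIndex i = 1) _ M N).trans ?_
  rw [h0, Matrix.zero_mul, add_zero]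
  rfl

theorem blockDet_smul (c : K) : blockDet (c • M) = c ^ 7 * blockDet M := by
  have h : (c • M).toSquareBlock blockIndex 1 = c • M.toSquareBlock blockIndex 1 := rfl
  rw [blockDet, h, Matrix.det_smul]
  rfl

variable (K) in
/-- The invertible matrices that preserve the span of the coordinates
`1, x, w₁, w₂, w₃, w₆, w₈`. -/
def blockSubgroup : Subgroup (GL (Fin 14) K) where
  carrier := {M | M.1.BlockTriangular blockIndex}
  one_mem' := Matrix.blockTriangular_one
  mul_mem' := fun hM hN => Matrix.BlockTriangular.mul hM hN
  inv_mem' := by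
    intro M hM
    have := M.isUnit.invertible
    have h := Matrix.blockTriangular_inv_of_blockTriangular hM
    rwa [← Matrix.coe_units_inv] at h

variable (K) in
/-- The elements of `blockSubgroup` that have determinant `1` on this span. -/
def unitBlockSubgroup : Subgroup (GL (Fin 14) K) where
  carrier := {M | M ∈ blockSubgroup K ∧ blockDet M.1 = 1}
  one_mem' := ⟨one_mem _, blockDet_one⟩
  mul_mem' := fun {M N} hM hN => ⟨mul_mem hM.1 hN.1, by
    rw [Units.val_mul, blockDet_mul hM.1, hM.2, hN.2, mul_one]⟩
  inv_mem' := fun {M} hM => ⟨inv_mem hM.1, by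
    have h := blockDet_mul (N := (M⁻¹).1) hM.1
    rwa [← Units.val_mul, mul_inv_cancel, Units.val_one, blockDet_one, hM.2, one_mul,
      eq_comm] at h⟩

theorem isUnit_blockDet {M : GL (Fin 14) K} (hM : M ∈ blockSubgroup K) : IsUnit (blockDet M.1) := by
  refine IsUnit.of_mul_eq_one (blockDet (M⁻¹).1) ?_
  rw [← blockDet_mul hM, ← Units.val_mul, mul_inv_cancel, Units.val_one, blockDet_one]

end Block

/-! ### Seventh roots in the field with q elements. -/

section Pow

/-- Odd powers of 3 are congruent to 3, 6 or 5 modulo 7, never to 1. -/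
theorem coprime_seven (n : ℕ) : (3 ^ (2 * n + 1) - 1).Coprime 7 := by
  rw [Nat.coprime_comm, Nat.Prime.coprime_iff_not_dvd (by norm_num)]
  intro h
  have h1 : 3 ^ (2 * n + 1) % 7 = 1 := by
    have := Nat.one_le_pow (2 * n + 1) 3 (by norm_num)
    omega
  have key : ∀ n : ℕ, 3 ^ (2 * n + 1) % 7 = 3 ∨ 3 ^ (2 * n + 1) % 7 = 6 ∨
      3 ^ (2 * n + 1) % 7 = 5 := by
    intro n
    induction n with
    | zero => simp
    | succ n ih =>
      rw [show 2 * (n + 1) + 1 = (2 * n + 1) + 2 by ring, pow_add]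
      omega
  rcases key n with h | h | h <;> omega

theorem pow_seven_bijective {K : Type*} [Field K] [Finite K] {m : ℕ}
    (hK : Nat.card K = 3 ^ (2 * m + 1)) : Function.Bijective fun c : Kˣ => c ^ 7 := by
  have h : (Nat.card Kˣ).Coprime 7 := by
    rw [Nat.card_units, hK]
    exact coprime_seven m
  exact (powCoprime h).bijective

end Pow

/-! ### Matrices of the generators. -/

section Matrices

theorem comp_vecCons {A B : Type*} (f : A → B) {n : ℕ} (a : A) (v : Fin n → A) :
    f ∘ Matrix.vecCons a v = Matrix.vecCons (f a) (f ∘ v) := Fin.comp_cons _ _ _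

theorem map_transMatrix {A B : Type*} [CommRing A] [CommRing B] (f : A →+* B) (b b' c c' d d' : A) :
    (transMatrix b b' c c' d d').map f = transMatrix (f b) (f b') (f c) (f c') (f d) (f d') := by
  have h (M : Fin 14 → Fin 14 → A) :
      (Matrix.of M).map f = Matrix.of ((fun r : Fin 14 → A => f ∘ r) ∘ M) := rfl
  unfold transMatrix
  rw [h]
  simp only [comp_vecCons, map_add, map_sub, map_neg, map_mul, map_pow, map_one, map_zero,
    Matrix.empty_eq]

theorem transMatrix_blockTriangular {A : Type*} [CommRing A] (b b' c c' d d' : A) :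
    (transMatrix b b' c c' d d').BlockTriangular blockIndex := by
  intro i j h
  fin_cases i <;> fin_cases j <;> first | rfl | exact absurd h (by decide)

theorem transMatrix_mulVec_single {A : Type*} [CommRing A] (b b' c c' d d' : A) :
    (transMatrix b b' c c' d d').mulVec (Pi.single 11 1) = Pi.single 11 1 := by
  rw [Matrix.mulVec_single_one]
  funext i
  fin_cases i <;> rfl

theorem map_weights {A B : Type*} [CommRing A] [CommRing B] (f : A →+* B) (a b : A) (i : Fin 14) :
    f (weights a b i) = weights (f a) (f b) i := by
  fin_cases i <;> simp [weights]

/-- The signed permutation matrix of the inversion. -/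
def invMatrix (A : Type*) [CommRing A] : Matrix (Fin 14) (Fin 14) A :=
  Matrix.of fun i j => invPerm (Pi.single j 1) i

theorem map_invMatrix {A B : Type*} [CommRing A] [CommRing B] (f : A →+* B) :
    (invMatrix A).map f = invMatrix B := by
  ext i j
  simp only [invMatrix, invPerm, Matrix.map_apply, Matrix.of_apply, Pi.single_apply]
  fin_cases i <;> simp [apply_ite f]

theorem invMatrix_mulVec {A : Type*} [CommRing A] (W : Fin 14 → A) :
    (invMatrix A).mulVec W = invPerm W := by
  funext i
  simp only [Matrix.mulVec, dotProduct, invMatrix, invPerm, Matrix.of_apply, Pi.single_apply]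
  fin_cases i <;> simp

theorem invMatrix_blockTriangular {A : Type*} [CommRing A] :
    (invMatrix A).BlockTriangular blockIndex := by
  intro i j h
  -- The entries are integers, so the vanishing is decided over ℤ and transported.
  have h1 : ∀ i j : Fin 14, blockIndex j < blockIndex i → invPerm (Pi.single j (1 : ℤ)) i = 0 := by
    decide
  rw [← map_invMatrix (Int.castRingHom A), Matrix.map_apply, invMatrix, Matrix.of_apply, h1 i j h,
    map_zero]

theorem invPerm_single_zero {A : Type*} [CommRing A] :
    invPerm (Pi.single 0 1 : Fin 14 → A) = Pi.single 11 1 := by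
  funext i
  fin_cases i <;> simp [invPerm]

theorem invPerm_single_eleven {A : Type*} [CommRing A] :
    invPerm (Pi.single 11 1 : Fin 14 → A) = Pi.single 0 1 := by
  funext i
  fin_cases i <;> simp [invPerm]

theorem coords_zero (m : ℕ) {A : Type*} [CommRing A] :
    coords m (0 : A) 0 0 = Pi.single 0 1 := by
  funext i
  fin_cases i <;> simp [coords]

end Matrices

/-! ### Stabiliser of the model. -/

section Model

open scoped Pointwise

/-- The vectors that represent the points of the model of the Ree curve. -/
def IsModelVector (m : ℕ) {A : Type*} [CommRing A] (W : Fin 14 → A) : Prop :=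
  (∃ x y₁ y₂ : A, OnCurve m x y₁ y₂ ∧ W = coords m x y₁ y₂) ∨ W = Pi.single 11 1

variable (K : Type*) [Field K] (m : ℕ)

/-- The invertible matrices that preserve the model of the Ree curve. -/
noncomputable def modelStabilizer : Subgroup (GL (Fin 14) K) :=
  (MulAction.stabilizer (GL (Fin 14) (AlgebraicClosure K)) (model K m)).comap
    (Matrix.GeneralLinearGroup.map (algebraMap K (AlgebraicClosure K)))

variable {K m}

theorem mem_modelStabilizer {M : GL (Fin 14) K} : M ∈ modelStabilizer K m ↔
    (fun p => Matrix.GeneralLinearGroup.map (algebraMap K (AlgebraicClosure K)) M • p) ''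
      model K m = model K m := Iff.rfl

theorem mem_modelStabilizer_of_mulVec [Finite K] {M : GL (Fin 14) K}
    (h : ∀ W : Fin 14 → AlgebraicClosure K, IsModelVector m W →
      ∃ (c : AlgebraicClosure K) (W' : Fin 14 → AlgebraicClosure K), IsModelVector m W' ∧
        (M.1.map (algebraMap K (AlgebraicClosure K))).mulVec W = c • W') :
    M ∈ modelStabilizer K m := by
  -- The action is pulled back to matrices over K because that group is finite, so mapping the model
  -- into itself is enough.
  let A : MulAction (GL (Fin 14) K) (ℙ (AlgebraicClosure K) (Fin 14 → AlgebraicClosure K)) :=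
    MulAction.compHom _
      (Matrix.GeneralLinearGroup.map (n := Fin 14) (algebraMap K (AlgebraicClosure K)))
  have h1 : M ∈ MulAction.stabilizer (GL (Fin 14) K) (model K m) := by
    refine mem_stabilizer_of_smul_subset ?_
    rintro _ ⟨p, hp, rfl⟩
    have key : ∀ (W : Fin 14 → AlgebraicClosure K) (hW : W ≠ 0), IsModelVector m W →
        Matrix.GeneralLinearGroup.map (algebraMap K (AlgebraicClosure K)) M •
          Projectivization.mk (AlgebraicClosure K) W hW ∈ model K m := by
      intro W hW hW'
      obtain ⟨c, W', hW'', e⟩ := h W hW'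
      rcases hW'' with ⟨x, y₁, y₂, hc, rfl⟩ | rfl
      · refine .inl ⟨x, y₁, y₂, hc, ?_⟩
        rw [Projectivization.smul_mk, Projectivization.mk_eq_mk_iff']
        exact ⟨c, e.symm⟩
      · refine .inr ?_
        rw [Projectivization.smul_mk, Projectivization.mk_eq_mk_iff']
        exact ⟨c, e.symm⟩
    rcases hp with ⟨x, y₁, y₂, hc, rfl⟩ | rfl
    · exact key _ _ (.inl ⟨x, y₁, y₂, hc, rfl⟩)
    · exact key _ _ (.inr rfl)
  exact h1

theorem smul_mem_modelStabilizer {M N : GL (Fin 14) K} (hM : M ∈ modelStabilizer K m) {c : K}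
    (h : N.1 = c • M.1) : N ∈ modelStabilizer K m := by
  rw [mem_modelStabilizer] at hM ⊢
  conv_rhs => rw [← hM]
  refine Set.image_congr fun p _ => ?_
  induction p using Projectivization.ind with
  | h v hv =>
    rw [Projectivization.smul_mk, Projectivization.smul_mk, Projectivization.mk_eq_mk_iff']
    refine ⟨algebraMap K _ c, ?_⟩
    change algebraMap K (AlgebraicClosure K) c •
      (M.1.map (algebraMap K (AlgebraicClosure K))).mulVec v =
      (N.1.map (algebraMap K (AlgebraicClosure K))).mulVec v
    rw [h, ← Matrix.smul_mulVec]
    congr 1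
    ext i j
    simp

end Model

/-! ### Normalisation of the projective representation. -/

section Representation

variable {K : Type*} [Field K] {m : ℕ} {F : Type*} [Field F] [Algebra K F] [Finite K]
  [Algebra (CoordRing K m) F] [IsFractionRing (CoordRing K m) F]
  [IsScalarTower K (CoordRing K m) F]

theorem sum_smul_eq_mulVec {A : Type*} [Field A] [Algebra K A] (M : Matrix (Fin 14) (Fin 14) K)
    (W : Fin 14 → A) (i : Fin 14) : ∑ j, M i j • W j = (M.map (algebraMap K A)).mulVec W i := by
  simp [Matrix.mulVec, dotProduct, Algebra.smul_def]

variable (K m F) in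
/-- The group of the pairs `(σ, M)` such that `M` describes the action of `σ⁻¹` on the coordinate
functions, up to a factor, preserves the span of `1, x, w₁, w₂, w₃, w₆, w₈`, and preserves the
model. -/
noncomputable def actionPairs : Subgroup ((F ≃ₐ[K] F) × GL (Fin 14) K) :=
  scaledAction K (fnF K m F) ⊓
    (blockSubgroup K ⊓ modelStabilizer K m).comap (MonoidHom.snd (F ≃ₐ[K] F) (GL (Fin 14) K))

theorem exists_mem_actionPairs [CharP K 3] [CharP F 3] {σ : F ≃ₐ[K] F} {u : F} (hu : u ≠ 0)
    {M : Matrix (Fin 14) (Fin 14) K}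
    (h : ∀ i, u * σ (fnF K m F i) = (M.map (algebraMap K F)).mulVec (fnF K m F) i)
    (hM : M.BlockTriangular blockIndex)
    (hmodel : ∀ W : Fin 14 → AlgebraicClosure K, IsModelVector m W →
      ∃ (c : AlgebraicClosure K) (W' : Fin 14 → AlgebraicClosure K), IsModelVector m W' ∧
        (M.map (algebraMap K (AlgebraicClosure K))).mulVec W = c • W') :
    σ ∈ (actionPairs K m F).map (MonoidHom.fst (F ≃ₐ[K] F) (GL (Fin 14) K)) := by
  simp only [← sum_smul_eq_mulVec] at h
  obtain ⟨N, rfl⟩ := isUnit_of_scaledAction (linearIndependent_fnF K m F) hu h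
  -- The pairs record the action of the inverse, so the relation for σ places σ⁻¹ in the image.
  rw [← inv_mem_iff]
  refine ⟨(σ⁻¹, N), ⟨⟨Units.mk0 u hu, ?_⟩, hM, mem_modelStabilizer_of_mulVec hmodel⟩, rfl⟩
  simpa using h

theorem OnCurve.translate (hK : Nat.card K = 3 ^ (2 * m + 1)) {L : Type*} [Field L] [Algebra K L]
    [CharP L 3] {x y₁ y₂ : L} (h : OnCurve m x y₁ y₂) (b c d : K) :
    OnCurve m (x + algebraMap K L b)
      (y₁ + algebraMap K L (b ^ 3 ^ m) * x + algebraMap K L c)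
      (y₂ - algebraMap K L (b ^ 3 ^ m) * y₁ + algebraMap K L (b ^ 3 ^ m) ^ 2 * x +
        algebraMap K L d) ∧
    coords m (x + algebraMap K L b) (y₁ + algebraMap K L (b ^ 3 ^ m) * x + algebraMap K L c)
      (y₂ - algebraMap K L (b ^ 3 ^ m) * y₁ + algebraMap K L (b ^ 3 ^ m) ^ 2 * x +
        algebraMap K L d) =
    ((transMatrix b (b ^ 3 ^ m) c (c ^ 3 ^ m) d (d ^ 3 ^ m)).map (algebraMap K L)).mulVec
      (coords m x y₁ y₂) := by
  have hf := Flag.of_onCurve h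
  have hf' := translate_flag hK hf b c d
  exact ⟨hf'.onCurve, by
    rw [hf'.coords_eq, hf.coords_eq, map_transMatrix, flagCoords_translate]⟩

theorem map_diagonal_weights {L : Type*} [Field L] [Algebra K L] (a b : K) :
    (Matrix.diagonal (weights a b)).map (algebraMap K L) =
      Matrix.diagonal (weights (algebraMap K L a) (algebraMap K L b)) := by
  rw [Matrix.diagonal_map (map_zero _)]
  simp only [map_weights]

theorem OnCurve.scale (hK : Nat.card K = 3 ^ (2 * m + 1)) {L : Type*} [Field L] [Algebra K L]
    [CharP L 3] {x y₁ y₂ : L} (h : OnCurve m x y₁ y₂) (a : K) :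
    OnCurve m (algebraMap K L a * x) (algebraMap K L a * algebraMap K L (a ^ 3 ^ m) * y₁)
      (algebraMap K L a * algebraMap K L (a ^ 3 ^ m) ^ 2 * y₂) ∧
    coords m (algebraMap K L a * x) (algebraMap K L a * algebraMap K L (a ^ 3 ^ m) * y₁)
      (algebraMap K L a * algebraMap K L (a ^ 3 ^ m) ^ 2 * y₂) =
    ((Matrix.diagonal (weights a (a ^ 3 ^ m))).map (algebraMap K L)).mulVec
      (coords m x y₁ y₂) := by
  have hf := Flag.of_onCurve h
  have hf' := scale_flag hK hf a
  exact ⟨hf'.onCurve, by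
    rw [hf'.coords_eq, hf.coords_eq, map_diagonal_weights, flagCoords_scale]⟩

theorem IsTranslation.mem_map_actionPairs (hK : Nat.card K = 3 ^ (2 * m + 1)) {σ : F ≃ₐ[K] F}
    {b c d : K} (h : IsTranslation (m := m) σ b c d) :
    σ ∈ (actionPairs K m F).map (MonoidHom.fst (F ≃ₐ[K] F) (GL (Fin 14) K)) := by
  have := charP_three hK
  have := charP_field K F
  have := charP_field K (AlgebraicClosure K)
  refine exists_mem_actionPairs one_ne_zero
    (M := transMatrix b (b ^ 3 ^ m) c (c ^ 3 ^ m) d (d ^ 3 ^ m)) (fun i => ?_)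
    (transMatrix_blockTriangular _ _ _ _ _ _) ?_
  · rw [one_mul]
    have h1 := map_coords m (σ : F →+* F) (genF K m F 0) (genF K m F 1) (genF K m F 2) i
    refine h1.trans ?_
    refine Eq.trans ?_ (congrFun ((onCurve_genF K m F).translate hK b c d).2 i)
    obtain ⟨h0, h1, h2⟩ := h
    change coords m (σ (genF K m F 0)) (σ (genF K m F 1)) (σ (genF K m F 2)) i = _
    rw [h0, h1, h2]
  · rintro W (⟨x, y₁, y₂, hc, rfl⟩ | rfl)
    · obtain ⟨hc', e⟩ := hc.translate hK b c d
      exact ⟨1, _, .inl ⟨_, _, _, hc', rfl⟩, by rw [one_smul, e]⟩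
    · exact ⟨1, _, .inr rfl, by rw [one_smul, map_transMatrix, transMatrix_mulVec_single]⟩

theorem IsScaling.mem_map_actionPairs (hK : Nat.card K = 3 ^ (2 * m + 1)) {σ : F ≃ₐ[K] F}
    {a : K} (h : IsScaling (m := m) σ a) :
    σ ∈ (actionPairs K m F).map (MonoidHom.fst (F ≃ₐ[K] F) (GL (Fin 14) K)) := by
  have := charP_three hK
  have := charP_field K F
  have := charP_field K (AlgebraicClosure K)
  refine exists_mem_actionPairs one_ne_zero
    (M := Matrix.diagonal (weights a (a ^ 3 ^ m))) (fun i => ?_)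
    (Matrix.blockTriangular_diagonal _) ?_
  · rw [one_mul]
    have h1 := map_coords m (σ : F →+* F) (genF K m F 0) (genF K m F 1) (genF K m F 2) i
    refine h1.trans ?_
    refine Eq.trans ?_ (congrFun ((onCurve_genF K m F).scale hK a).2 i)
    obtain ⟨h0, h1, h2⟩ := h
    change coords m (σ (genF K m F 0)) (σ (genF K m F 1)) (σ (genF K m F 2)) i = _
    rw [h0, h1, h2]
  · rintro W (⟨x, y₁, y₂, hc, rfl⟩ | rfl)
    · obtain ⟨hc', e⟩ := hc.scale hK a
      exact ⟨1, _, .inl ⟨_, _, _, hc', rfl⟩, by rw [one_smul, e]⟩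
    · refine ⟨weights (algebraMap K _ a) (algebraMap K _ (a ^ 3 ^ m)) 11, _, .inr rfl, ?_⟩
      rw [map_diagonal_weights]
      funext i
      rw [Matrix.mulVec_diagonal]
      by_cases hi : i = 11
      · subst hi; rfl
      · simp [hi]

theorem IsInversion.mem_map_actionPairs (hK : Nat.card K = 3 ^ (2 * m + 1)) {σ : F ≃ₐ[K] F}
    (h : IsInversion (m := m) σ) :
    σ ∈ (actionPairs K m F).map (MonoidHom.fst (F ≃ₐ[K] F) (GL (Fin 14) K)) := by
  have := charP_three hK
  have := charP_field K F
  have := charP_field K (AlgebraicClosure K)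
  refine exists_mem_actionPairs (fnF_ne_zero (K := K) (m := m) 11) (M := invMatrix K)
    (fun i => ?_) invMatrix_blockTriangular ?_
  · rw [map_invMatrix, invMatrix_mulVec]
    exact h i
  · intro W hW
    rw [map_invMatrix, invMatrix_mulVec]
    rcases hW with ⟨x, y₁, y₂, hc, rfl⟩ | rfl
    · have hf := Flag.of_onCurve hc
      -- Where w₈ ≠ 0 the inverted point is affine; the remaining point, the origin, goes to
      -- infinity.
      by_cases h8 : coords m x y₁ y₂ 11 = 0
      · obtain ⟨rfl, rfl, rfl⟩ := hf.eq_zero_of_w₈_eq_zero hf.coords_eq.symm h8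
        exact ⟨1, _, .inr rfl, by rw [one_smul, coords_zero, invPerm_single_zero]⟩
      · have hinv := hf.inversion hf.coords_eq.symm h8
        refine ⟨coords m x y₁ y₂ 11, _, .inl ⟨_, _, _, hinv.onCurve, rfl⟩, ?_⟩
        rw [hinv.coords_eq, flagCoords_inversion hf.coords_eq.symm h8, smul_smul,
          mul_inv_cancel₀ h8, one_smul]
    · exact ⟨1, _, .inl ⟨0, 0, 0, onCurve_zero m, rfl⟩, by
        rw [one_smul, coords_zero, invPerm_single_eleven]⟩

theorem map_actionPairs (hK : Nat.card K = 3 ^ (2 * m + 1)) :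
    (actionPairs K m F).map (MonoidHom.fst (F ≃ₐ[K] F) (GL (Fin 14) K)) = ⊤ := by
  rw [eq_top_iff, ← closure_standardGenerators (F := F) hK, Subgroup.closure_le]
  rintro σ (⟨b, c, d, h⟩ | ⟨a, -, h⟩ | h)
  · exact h.mem_map_actionPairs hK
  · exact h.mem_map_actionPairs hK
  · exact h.mem_map_actionPairs hK

/-- Nonzero algebraic elements have valuation 1. At a rational place, such an element differs from
its residue by an algebraic element of valuation below 1, which is zero. -/
theorem exists_eq_algebraMap_of_isAlgebraic (hK : Nat.card K = 3 ^ (2 * m + 1)) {a : F}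
    (ha : IsAlgebraic K a) : ∃ c : K, a = algebraMap K F c := by
  have := charP_three hK
  have := charP_field K F
  obtain ⟨V, hV⟩ := exists_genF_notMem K m F
  obtain ⟨φ, hφ⟩ := exists_isInversion (F := F) hK
  have := isTrivialOn_of_finite (K := K) (pull V φ).valuation
  have key : ∀ b : F, IsAlgebraic K b → b = 0 ∨ (pull V φ).valuation b = 1 := by
    intro b hb
    by_contra! h
    exact Valuation.transcendental_of_ne_one K _ (v := (pull V φ).valuation) h.1 h.2 hb
  obtain ⟨c, hc⟩ := (hφ.centredAtOrigin hV).exists_sub_lt_one (f := a) (by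
    rw [← ValuationSubring.valuation_le_one_iff]
    rcases key a ha with rfl | h
    · simp
    · exact h.le)
  refine ⟨c, sub_eq_zero.1 ((key _ (ha.sub (isAlgebraic_algebraMap c))).resolve_right hc.ne)⟩

variable (K m F) in
/-- The elements of `actionPairs` that are normalised by the determinant on the span of
`1, x, w₁, w₂, w₃, w₆, w₈`. -/
noncomputable def normalizedPairs : Subgroup ((F ≃ₐ[K] F) × GL (Fin 14) K) :=
  scaledAction K (fnF K m F) ⊓
    (unitBlockSubgroup K ⊓ modelStabilizer K m).comap (MonoidHom.snd (F ≃ₐ[K] F) (GL (Fin 14) K))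

theorem normalizedPairs_fst_surjective (hK : Nat.card K = 3 ^ (2 * m + 1)) (σ : F ≃ₐ[K] F) :
    ∃ M, (σ, M) ∈ normalizedPairs K m F := by
  obtain ⟨⟨σ', M⟩, ⟨⟨u, hu⟩, hM, hmodel⟩, hσ⟩ :=
    (map_actionPairs (F := F) hK).ge (Subgroup.mem_top σ)
  obtain rfl : σ' = σ := hσ
  replace hM : M.1.BlockTriangular blockIndex := hM
  -- The scalar c multiplies the block determinant by c^7, so c must be the seventh root of its
  -- inverse.
  obtain ⟨c, hc⟩ := (pow_seven_bijective hK).2 (isUnit_blockDet hM).unit⁻¹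
  let cM : GL (Fin 14) K := Units.map (algebraMap K (Matrix (Fin 14) (Fin 14) K) : _ →* _) c * M
  have hcM : cM.1 = (c : K) • M.1 := (Algebra.smul_def (c : K) M.1).symm
  refine ⟨cM, ⟨Units.map (algebraMap K F : K →* F) c * u, fun i => ?_⟩, ⟨?_, ?_⟩,
    smul_mem_modelStabilizer hmodel hcM⟩
  · change algebraMap K F c * u * σ'⁻¹ (fnF K m F i) = ∑ j, cM.1 i j • fnF K m F j
    rw [mul_assoc, show (u : F) * σ'⁻¹ (fnF K m F i) = _ from hu i, hcM, ← Algebra.smul_def,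
      Finset.smul_sum]
    simp only [Matrix.smul_apply, smul_smul, smul_eq_mul]
  · change cM.1.BlockTriangular blockIndex
    rw [hcM]
    intro i j hij
    rw [Matrix.smul_apply, hM hij, smul_zero]
  · change blockDet cM.1 = 1
    rw [hcM, blockDet_smul, ← Units.val_pow_eq_pow_val, show c ^ 7 = _ from hc]
    exact IsUnit.val_inv_mul _

/-- Multiplication by u preserves a finite-dimensional space, so u is integral over K and hence a
constant c. Then M = c · 1 and c^7 = 1, which forces c = 1. -/
theorem eq_one_of_mem_normalizedPairs (hK : Nat.card K = 3 ^ (2 * m + 1)) {M : GL (Fin 14) K}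
    (hM : ((1 : F ≃ₐ[K] F), M) ∈ normalizedPairs K m F) : M = 1 := by
  have := charP_three hK
  have := charP_field K F
  obtain ⟨⟨u, hu⟩, ⟨-, hdet⟩, -⟩ := hM
  have hu' : ∀ i, (u : F) * fnF K m F i = ∑ j, M.1 i j • fnF K m F j := by simpa using hu
  have hint : IsIntegral K (u : F) := by
    refine isIntegral_of_smul_mem_submodule (Submodule.span K (Set.range (fnF K m F))) ?_
      (Submodule.fg_span (Set.finite_range _)) _ fun n hn => ?_
    · intro h
      have := Submodule.subset_span (R := K) (Set.mem_range_self (f := fnF K m F) 0)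
      rw [h] at this
      exact fnF_ne_zero (K := K) 0 this
    · induction hn using Submodule.span_induction with
      | mem x hx =>
        obtain ⟨i, rfl⟩ := hx
        rw [smul_eq_mul, hu' i]
        exact Submodule.sum_mem _ fun j _ => Submodule.smul_mem _ _
          (Submodule.subset_span (Set.mem_range_self j))
      | zero => simp
      | add x y _ _ hx hy => rw [smul_add]; exact add_mem hx hy
      | smul c x _ hx => rw [smul_comm]; exact Submodule.smul_mem _ _ hx
  obtain ⟨c, hc⟩ := exists_eq_algebraMap_of_isAlgebraic (m := m) hK hint.isAlgebraic
  have hMc : M.1 = c • (1 : Matrix (Fin 14) (Fin 14) K) := by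
    ext i j
    have h1 : ∑ j, (M.1 i j - (c • (1 : Matrix (Fin 14) (Fin 14) K)) i j) • fnF K m F j = 0 := by
      simp only [sub_smul, Finset.sum_sub_distrib, ← hu' i, hc, Matrix.smul_apply,
        Matrix.one_apply, smul_eq_mul, mul_ite, mul_one, mul_zero, ite_smul, zero_smul,
        Finset.sum_ite_eq, Finset.mem_univ, if_true]
      rw [Algebra.smul_def, sub_self]
    exact sub_eq_zero.1 (Fintype.linearIndependent_iff.1 (linearIndependent_fnF K m F) _ h1 j)
  change blockDet M.1 = 1 at hdet
  rw [hMc, blockDet_smul, blockDet_one, mul_one] at hdet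
  have hc0 : c ≠ 0 := by rintro rfl; simp at hdet
  have h1 : Units.mk0 c hc0 = 1 := (pow_seven_bijective hK).1 (by
    ext; simpa using hdet)
  have h2 : c = 1 := congrArg Units.val h1
  ext i j
  rw [hMc, h2, one_smul]
  rfl

/-- The matrix representation of the automorphism group. -/
theorem exists_matrixRepresentation (hK : Nat.card K = 3 ^ (2 * m + 1)) :
    ∃ Θ : (F ≃ₐ[K] F) →* GL (Fin 14) K, ∀ σ, (σ, Θ σ) ∈ normalizedPairs K m F := by
  -- The normalised pairs form the graph of the desired homomorphism, since each σ occurs exactly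
  -- once.
  have hbij : Function.Bijective ((MonoidHom.fst (F ≃ₐ[K] F) (GL (Fin 14) K)).comp
      (normalizedPairs K m F).subtype) := by
    constructor
    · refine (injective_iff_map_eq_one _).2 ?_
      rintro ⟨⟨σ, M⟩, h⟩ (rfl : σ = 1)
      obtain rfl := eq_one_of_mem_normalizedPairs hK h
      rfl
    · intro σ
      obtain ⟨M, h⟩ := normalizedPairs_fst_surjective hK σ
      exact ⟨⟨_, h⟩, rfl⟩
  let e := MulEquiv.ofBijective _ hbij
  refine ⟨(MonoidHom.snd _ _).comp ((normalizedPairs K m F).subtype.comp e.symm.toMonoidHom),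
    fun σ => ?_⟩
  have h : (e.symm σ).1.1 = σ := e.apply_symm_apply σ
  have h2 := (e.symm σ).2
  have h3 : (e.symm σ).1 = (σ, (e.symm σ).1.2) := Prod.ext h rfl
  rw [h3] at h2
  exact h2

end Representation

/-! ### From matrices to operators on the span. -/

section LinearRepresentation

variable {K F : Type*} [Field K] [Field F] [Algebra K F]

/-- The action on the span of linearly independent elements that a matrix representation
defines. -/
theorem exists_linearRepresentation {ι : Type*} [Fintype ι] [DecidableEq ι] {W : ι → F}
    (hW : LinearIndependent K W) (Θ : (F ≃ₐ[K] F) →* GL ι K)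
    (hΘ : ∀ σ, (σ, Θ σ) ∈ scaledAction K W) :
    ∃ ρ : (F ≃ₐ[K] F) →*
        (Submodule.span K (Set.range W) ≃ₗ[K] Submodule.span K (Set.range W)),
      (∀ σ, ∃ u : Fˣ, ∀ f : Submodule.span K (Set.range W), (ρ σ f : F) = u * σ (f : F)) ∧
      ∀ σ i, (ρ σ⁻¹ ⟨W i, Submodule.subset_span (Set.mem_range_self i)⟩ : F) =
        ∑ j, (Θ σ).1 i j • W j := by
  let b := Module.Basis.span hW
  have hb : ∀ i, (b i : F) = W i := fun i => congrArg Subtype.val (Module.Basis.span_apply hW i)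
  let ρ₀ : (F ≃ₐ[K] F) →* Module.End K (Submodule.span K (Set.range W)) :=
    -- The rows of Θ give images of basis vectors, hence the transpose. Transposing and inverting
    -- both reverse products, so the result is a homomorphism.
    { toFun := fun σ => Matrix.toLinAlgEquiv b (Θ σ⁻¹).1.transpose
      map_one' := by simp
      map_mul' := fun σ τ => by
        rw [mul_inv_rev, map_mul, Units.val_mul, Matrix.transpose_mul, map_mul] }
  have h0 : ∀ σ i, (ρ₀ σ (b i) : F) = ∑ j, (Θ σ⁻¹).1 i j • W j := by
    intro σ i
    change ((Matrix.toLinAlgEquiv b (Θ σ⁻¹).1.transpose (b i) : _) : F) = _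
    rw [Matrix.toLinAlgEquiv_self]
    simp [hb]
  let ρ := (LinearMap.GeneralLinearGroup.generalLinearEquiv K _).toMonoidHom.comp
    ρ₀.toHomUnits
  have hρ : ∀ σ f, ρ σ f = ρ₀ σ f := fun _ _ => rfl
  refine ⟨ρ, fun σ => ?_, fun σ i => ?_⟩
  · obtain ⟨u, hu⟩ := hΘ σ⁻¹
    refine ⟨u, fun f => ?_⟩
    have h1 : (Submodule.subtype _).comp (ρ₀ σ) =
        (LinearMap.mulLeft K (u : F)).comp (σ.toLinearMap.comp (Submodule.subtype _)) := by
      refine b.ext fun i => ?_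
      have := hu i
      rw [inv_inv] at this
      change (ρ₀ σ (b i) : F) = u * σ (b i : F)
      rw [h0, hb]
      exact this.symm
    exact LinearMap.congr_fun h1 f
  · have h1 := h0 σ⁻¹ i
    rw [inv_inv] at h1
    rw [← h1, hρ]
    congr 2
    exact Subtype.ext (hb i).symm

end LinearRepresentation

end Ree
theorem mainTheorem10 (m : ℕ) (K : Type*) [Field K] [Finite K]
    (hK : Nat.card K = 3 ^ (2 * m + 1)) :
    IsField (Ree.FunctionField K m) ∧
    -- the action `ρ` on `D'` and its matrix form `Θ` in the coordinates of the 13-space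
    ∃ (ρ : Ree.ReeGroup K m →* (Ree.D' K m ≃ₗ[K] Ree.D' K m))
      (Θ : Ree.ReeGroup K m →* GL (Fin 14) K),
      (∀ σ : Ree.ReeGroup K m, ∃ u : (Ree.FunctionField K m)ˣ, ∀ f : Ree.D' K m,
        (ρ σ f : Ree.FunctionField K m) = u * σ (f : Ree.FunctionField K m)) ∧
      (∀ (σ : Ree.ReeGroup K m) (i : Fin 14),
        ρ σ⁻¹ (Ree.fnD' K m i) = ∑ j, (Θ σ).1 i j • Ree.fnD' K m j) ∧
      (∀ σ : Ree.ReeGroup K m,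
        (fun p => Matrix.GeneralLinearGroup.map (algebraMap K (AlgebraicClosure K)) (Θ σ) • p) ''
          Ree.model K m = Ree.model K m) ∧
      -- the involution `φ`
      ∃ φ : Ree.ReeGroup K m, orderOf φ = 2 ∧
        ∀ i : Fin 14, Ree.fn K m 11 * φ (Ree.fn K m i) =
          ![Ree.fn K m 11, Ree.fn K m 9, Ree.fn K m 13, Ree.fn K m 12, Ree.fn K m 6,
            -Ree.fn K m 5, Ree.fn K m 4, Ree.fn K m 8, Ree.fn K m 7, Ree.fn K m 1,
            -Ree.fn K m 10, Ree.fn K m 0, Ree.fn K m 3, Ree.fn K m 2] i := by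
  have := Ree.charP_three hK
  have := Ree.isDomain_coordRing (K := K) (m := m)
  have := Ree.charP_field K (Ree.FunctionField K m)
  obtain ⟨Θ, hΘ⟩ := Ree.exists_matrixRepresentation (F := Ree.FunctionField K m) hK
  obtain ⟨ρ, hρ, hρΘ⟩ := Ree.exists_linearRepresentation
    (Ree.linearIndependent_fnF K m (Ree.FunctionField K m)) Θ fun σ => (hΘ σ).1
  obtain ⟨φ, hφ⟩ := Ree.exists_isInversion (F := Ree.FunctionField K m) hK
  refine ⟨Field.toIsField _, ρ, Θ, hρ, fun σ i => Subtype.ext ?_, fun σ => (hΘ σ).2.2, φ, ?_, hφ⟩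
  · refine (hρΘ σ i).trans ?_
    simp only [Submodule.coe_sum, Submodule.coe_smul]
    rfl
  · refine orderOf_eq_prime (by rw [sq, hφ.mul_self]) ?_
    -- If the inversion were the identity, the place at infinity would be centred at the origin and
    -- x would have no pole there.
    rintro rfl
    obtain ⟨V, hV⟩ := Ree.exists_genF_notMem K m (Ree.FunctionField K m)
    exact hV ((V.valuation_le_one_iff _).1 (hφ.centredAtOrigin hV 0).le)
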